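/- Let $\mathbb{T}^3=\mathbb{R}^3/\mathbb{Z}^3$, let $N\ge 9$ be an integer, let $\vec u\in C^{N+2}([0,\infty)\times\mathbb{T}^3;\mathbb{R}^3)$ be a given velocity field, and let $b>0$ and $M$ be real numbers. There exist $T>0$ and $C<\infty$, depending only on $N,\vec u,b,M$, such that for every $\theta_0^0\in H^{N+2}(\mathbb{T}^3)$ with $\theta_0^0\ge b$ almost everywhere and $\|\theta_0^0\|_{H^{N+2}(\mathbb{T}^3)}\le M$ the problem $$f_0=\theta_0^4,\qquad \partial_t(\theta_0+\theta_0^4)+\operatorname{div}(\vec u\,\theta_0)-\Delta\Big(\theta_0+\tfrac13\theta_0^4\Big)=0\ \text{ in }(0,T)\times\mathbb{T}^3,$$ $$\theta_0(0,\cdot)=\theta_0^0,\qquad f_0(0,\cdot)=(\theta_0^0)^4\ \text{ in }\mathbb{T}^3$$ has one and only one solution $(\theta_0,f_0)$ on $[0,T]$ with $$\theta_0,\ f_0\in C([0,T];H^{N+2}(\mathbb{T}^3))\cap L^2(0,T;H^{N+3}(\mathbb{T}^3)).$$ Here $\theta_0=\theta_0(t,x)$ and $f_0=f_0(t,x)$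 are real-valued, $\theta_0(t,\cdot)$ is identified with its $C^2$ representative, and the equation holds pointwise. Moreover $$\|\theta_0\|_{L^\infty(0,T;H^{N+2})}+\|f_0\|_{L^\infty(0,T;H^{N+2})}+\|\theta_0\|_{L^2(0,T;H^{N+3})}+\|f_0\|_{L^2(0,T;H^{N+3})}\le C$$ and $\theta_0\ge b/2$ on $[0,T]\times\mathbb{T}^3$. The norm of $H^k(\mathbb{T}^3)=W^{k,2}(\mathbb{T}^3)$ is $\|g\|_{H^k}=\big(\sum_{|\alpha|\le k}\|D^\alpha g\|_{L^2}^2\big)^{1/2}$ with weak derivatives $D^\alpha g$. -/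

import Mathlib

open MeasureTheory Set
open scoped ENNReal ContDiff

namespace EquilibriumLimit

/-- The three-dimensional torus `ℝ³ / ℤ³`; its `volume` has total mass one. -/
abbrev T3 : Type := UnitAddTorus (Fin 3)

/-- The covering map `ℝ³ → T3`. -/
def proj (y : Fin 3 → ℝ) : T3 := fun i => (y i : UnitAddCircle)

/-- The periodic function on `ℝ³` that corresponds to a function on the torus. -/
def lift (g : T3 → ℝ) : (Fin 3 → ℝ) → ℝ := fun y => g (proj y)

/-- `g` is of class `C^n` on the torus. -/
def IsCk (n : WithTop ℕ∞) (g : T3 → ℝ) : Prop := ContDiff ℝ n (lift g)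

/-- The classical partial derivative `∂g/∂xᵢ` on the torus. -/
noncomputable def pd (i : Fin 3) (g : T3 → ℝ) : T3 → ℝ := fun x =>
  deriv (fun s : ℝ => g (x + Pi.single i (s : UnitAddCircle))) 0

/-- The classical partial derivative `D^α g` for a multi-index `α`. -/
noncomputable def pdIter (α : Fin 3 → ℕ) (g : T3 → ℝ) : T3 → ℝ :=
  (pd 0)^[α 0] ((pd 1)^[α 1] ((pd 2)^[α 2] g))

/-- `div v` for a vector field `v` on the torus. -/
noncomputable def divergence (v : T3 → Fin 3 → ℝ) : T3 → ℝ := fun x =>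
  ∑ i, pd i (fun y => v y i) x

/-- The Laplacian of `g`. -/
noncomputable def laplacian (g : T3 → ℝ) : T3 → ℝ := fun x => ∑ i, pd i (pd i g) x

/-- The time-dependent vector field `u` belongs to `C^n([0, ∞) × T3)`. -/
def IsCkVelocity (n : ℕ) (u : ℝ → T3 → Fin 3 → ℝ) : Prop :=
  ∀ i, ContDiffOn ℝ n (fun p : ℝ × (Fin 3 → ℝ) => u p.1 (proj p.2) i) (Ici 0 ×ˢ univ)

section helpers

theorem proj_add_single (y : Fin 3 → ℝ) (i : Fin 3) (s : ℝ) :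
    proj y + Pi.single i (s : UnitAddCircle) = proj (y + s • Pi.single i (1 : ℝ)) := by
  funext j
  by_cases h : j = i
  · subst h; simp [proj]
  · simp [proj, h]

theorem isOpenQuotientMap_proj : IsOpenQuotientMap proj :=
  IsOpenQuotientMap.piMap (fun _ : Fin 3 => QuotientAddGroup.isOpenQuotientMap_mk)

theorem IsCk.continuous {n : WithTop ℕ∞} {g : T3 → ℝ} (hg : IsCk n g) : Continuous g :=
  isOpenQuotientMap_proj.isQuotientMap.continuous_iff.2 (ContDiff.continuous hg)

theorem lift_pd {g : T3 → ℝ} (hg : IsCk ∞ g) (i : Fin 3) (y : Fin 3 → ℝ) :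
    lift (pd i g) y = fderiv ℝ (lift g) y (Pi.single i 1) := by
  have hd : DifferentiableAt ℝ (lift g) y := (ContDiff.differentiable hg (by simp)) y
  have : (fun s : ℝ => g (proj y + Pi.single i (s : UnitAddCircle)))
      = fun s : ℝ => lift g (y + s • Pi.single i (1 : ℝ)) := by
    funext s; rw [proj_add_single]; rfl
  show deriv (fun s : ℝ => g (proj y + Pi.single i (s : UnitAddCircle))) 0 = _
  rw [this]
  exact hd.lineDeriv_eq_fderiv

theorem IsCk.pd {g : T3 → ℝ} (hg : IsCk ∞ g) (i : Fin 3) : IsCk ∞ (pd i g) := by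
  have : lift (EquilibriumLimit.pd i g) = fun y => fderiv ℝ (lift g) y (Pi.single i 1) :=
    funext (lift_pd hg i)
  unfold IsCk
  rw [this]
  exact (ContDiff.fderiv_right (m := ∞) hg (by simp)).clm_apply contDiff_const

theorem IsCk.pd_iterate {g : T3 → ℝ} (hg : IsCk ∞ g) (i : Fin 3) (n : ℕ) :
    IsCk ∞ ((EquilibriumLimit.pd i)^[n] g) := by
  induction n with
  | zero => exact hg
  | succ n ih => rw [Function.iterate_succ_apply']; exact ih.pd i

theorem IsCk.pdIter {g : T3 → ℝ} (hg : IsCk ∞ g) (α : Fin 3 → ℕ) :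
    IsCk ∞ (pdIter α g) :=
  ((hg.pd_iterate 2 _).pd_iterate 1 _).pd_iterate 0 _

theorem integrable_mul {φ : T3 → ℝ} (hφ : Continuous φ) (f : Lp ℝ 2 (volume : Measure T3)) :
    Integrable (fun x => f x * φ x) := by
  have h1 : MemLp φ 2 (volume : Measure T3) :=
    MemLp.of_bound hφ.aestronglyMeasurable ‖ContinuousMap.mk φ hφ‖
      (Filter.Eventually.of_forall (ContinuousMap.mk φ hφ).norm_coe_le_norm)
  exact (Lp.memLp f).integrable_mul h1

end helpers

/-- `g ∈ L²` is the weak derivative `D^α f` of `f ∈ L²`. -/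
def IsWeakDeriv (α : Fin 3 → ℕ) (f g : Lp ℝ 2 (volume : Measure T3)) : Prop :=
  ∀ φ : T3 → ℝ, IsCk ∞ φ →
    ∫ x, f x * pdIter α φ x = (-1) ^ (∑ i, α i) * ∫ x, g x * φ x

/-- The multi-indices of order at most `k`. -/
abbrev MultiIdx (k : ℕ) : Type := {α : Fin 3 → Fin (k + 1) // ∑ i, (α i : ℕ) ≤ k}

/-- The multi-index of order zero. -/
def MultiIdx.zero (k : ℕ) : MultiIdx k := ⟨fun _ => 0, by simp⟩

/-- The Sobolev space `H^k(T3) = W^{k,2}(T3)`. An element is an `L²` function together with its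
weak derivatives of order at most `k`, which are required to exist in `L²` (they are unique); the
norm inherited from the `ℓ²` sum is `(∑_{|α| ≤ k} ‖D^α f‖²_{L²})^{1/2}`. -/
noncomputable def Sob (k : ℕ) :
    Submodule ℝ (PiLp 2 (fun _ : MultiIdx k => Lp ℝ 2 (volume : Measure T3))) where
  carrier := {w | ∀ α : MultiIdx k, IsWeakDeriv (fun i => (α.1 i : ℕ)) (w (MultiIdx.zero k)) (w α)}
  zero_mem' := by
    intro α φ _
    have h : ∀ ψ : T3 → ℝ, ∫ x, (0 : Lp ℝ 2 (volume : Measure T3)) x * ψ x = 0 := by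
      intro ψ
      rw [integral_congr_ae (g := fun _ => (0 : ℝ)), integral_zero]
      filter_upwards [Lp.coeFn_zero ℝ 2 (volume : Measure T3)] with x hx
      rw [hx]; simp
    show ∫ x, (0 : Lp ℝ 2 (volume : Measure T3)) x * _
      = _ * ∫ x, (0 : Lp ℝ 2 (volume : Measure T3)) x * _
    rw [h, h, mul_zero]
  add_mem' := by
    intro v w hv hw α φ hφ
    have h : ∀ ψ : T3 → ℝ, Continuous ψ → ∀ f g : Lp ℝ 2 (volume : Measure T3),
        ∫ x, (f + g) x * ψ x = (∫ x, f x * ψ x) + ∫ x, g x * ψ x := by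
      intro ψ hψ f g
      rw [← integral_add (integrable_mul hψ f) (integrable_mul hψ g)]
      refine integral_congr_ae ?_
      filter_upwards [Lp.coeFn_add f g] with x hx
      rw [hx, Pi.add_apply, add_mul]
    rw [PiLp.add_apply, PiLp.add_apply, h _ (hφ.pdIter _).continuous, h _ hφ.continuous,
      hv α φ hφ, hw α φ hφ, mul_add]
  smul_mem' := by
    intro c w hw α φ hφ
    have h : ∀ ψ : T3 → ℝ, ∀ f : Lp ℝ 2 (volume : Measure T3),
        ∫ x, (c • f) x * ψ x = c * ∫ x, f x * ψ x := by
      intro ψ f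
      rw [← integral_const_mul]
      refine integral_congr_ae ?_
      filter_upwards [Lp.coeFn_smul c f] with x hx
      rw [hx, Pi.smul_apply, smul_eq_mul, mul_assoc]
    rw [PiLp.smul_apply, PiLp.smul_apply, h, h, hw α φ hφ]
    ring

/-- The underlying `L²` function of an element of `H^k(T3)`. -/
noncomputable def toL2 {k : ℕ} (w : Sob k) : Lp ℝ 2 (volume : Measure T3) :=
  w.1 (MultiIdx.zero k)

/-- The function `g` on the torus is (almost everywhere) the element `w` of `H^k(T3)`. -/
def Represents {k : ℕ} (w : Sob k) (g : T3 → ℝ) : Prop := toL2 w =ᵐ[volume] g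

/-- The `H^k(T3)` norm of a function on the torus, `∞` if the function is not in `H^k(T3)`. -/
noncomputable def sobNorm (k : ℕ) (g : T3 → ℝ) : ℝ≥0∞ :=
  ⨅ (w : Sob k) (_ : Represents w g), ‖w‖ₑ

/-- `θ ∈ C([0, T]; H^k(T3))`. -/
def MemC (k : ℕ) (T : ℝ) (θ : ℝ → T3 → ℝ) : Prop :=
  ∃ U : ℝ → Sob k, ContinuousOn U (Icc 0 T) ∧ ∀ t ∈ Icc 0 T, Represents (U t) (θ t)

/-- `θ ∈ L²(0, T; H^k(T3))`. -/
def MemL2 (k : ℕ) (T : ℝ) (θ : ℝ → T3 → ℝ) : Prop :=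
  ∃ U : ℝ → Sob k, MemLp U 2 (volume.restrict (Ioo 0 T)) ∧
    ∀ᵐ t ∂(volume.restrict (Ioo 0 T)), Represents (U t) (θ t)

/-- The norm of `θ` in `L^p(0, T; H^k(T3))`. -/
noncomputable def timeNorm (p : ℝ≥0∞) (k : ℕ) (T : ℝ) (θ : ℝ → T3 → ℝ) : ℝ≥0∞ :=
  eLpNorm (fun t => sobNorm k (θ t)) p (volume.restrict (Ioo 0 T))

/-- `(θ, f)` is a solution on `[0, T]`, in `C([0, T]; H^k) ∩ L²(0, T; H^{k+1})`, of
`f = θ⁴`, `∂ₜ(θ + θ⁴) + div(u θ) - Δ(θ + θ⁴ / 3) = 0` with initial data `θ(0) = θ₀`,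
`f(0) = θ₀⁴`. The equation holds pointwise, and `θ(t, ·)` denotes the `C²` representative of its
class, so that all the space derivatives are classical. -/
structure IsSolution (k : ℕ) (u : ℝ → T3 → Fin 3 → ℝ) (θ₀ : Sob k) (T : ℝ)
    (θ f : ℝ → T3 → ℝ) : Prop where
  memC_θ : MemC k T θ
  memL2_θ : MemL2 (k + 1) T θ
  memC_f : MemC k T f
  memL2_f : MemL2 (k + 1) T f
  isC2_θ : ∀ t ∈ Icc 0 T, IsCk 2 (θ t)
  f_eq : ∀ t ∈ Icc 0 T, ∀ x, f t x = θ t x ^ 4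
  differentiableAt_time : ∀ t ∈ Ioo 0 T, ∀ x,
    DifferentiableAt ℝ (fun s => θ s x + θ s x ^ 4) t
  equation : ∀ t ∈ Ioo 0 T, ∀ x,
    deriv (fun s => θ s x + θ s x ^ 4) t + divergence (fun y i => u t y i * θ t y) x
      - laplacian (fun y => θ t y + 1 / 3 * θ t y ^ 4) x = 0
  initial_θ : θ 0 =ᵐ[volume] toL2 θ₀
  initial_f : f 0 =ᵐ[volume] fun x => toL2 θ₀ x ^ 4

end EquilibriumLimit

/-!
The equation is solved for the unknown `w = θ + θ⁴`. For `s ≥ b / 4` the map `s ↦ s + s⁴` has a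
smooth inverse, which extends to a smooth function `Θ` on the whole line with `0 ≤ Θ' ≤ 1`
(`IsInverse`, `exists_isInverse`). Since `θ + θ⁴ / 3 = w - (2 / 3) (w - Θ(w))`, the equation becomes
`∂ₜw = Δ(w - P(w)) - div(u Θ(w))` with `P(x) = (2 / 3) (x - Θ(x))` (`excess`). The decisive fact is
`|P'| ≤ 2 / 3 < 1`: the nonlinear part of the diffusion is dominated by `Δw`, although it is of the
same order, and so it can be treated as a perturbation of the heat equation, at the top order of
the a priori bound as well as in the contraction estimate.

Everything is expressed by Fourier coefficients (`fc`), for which the heat equation with a source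
decouples into scalar linear equations with explicit solutions (`duhamel`, `nextCoef`). The norm of
`H^k` is replaced by the equivalent one with the Fourier weight `W k` (`HB`), in which only pure
derivatives `∂ᵢ^k` occur; hence Leibniz' rule and the chain rule are needed in one variable at a
time only. For `k ≥ 8` and a product of two derivatives of total order at most `k`, one of the
factors is bounded by Sobolev's embedding. This gives the bounds for products and compositions
(`HB_mul`, `HB_comp`, `HB_comp_sub`), and it shows that `∂ᵢ^(k+1) P(w) - P'(w) ∂ᵢ^(k+1) w` is of
lower order (`Ctl.top_order`, `sum_excess_le`).

Existence follows by iteration: `w` is replaced by the solution of the heat equation with the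
source computed from `w`, truncated to finitely many frequencies so that all the functions are
smooth (`iterStep`, `approx`). By the energy inequality for each frequency (`energy_heat`), a bound
in `C([0, T]; H^k) ∩ L²(0, T; H^{k+1})` is preserved for a time `T` that depends only on the size
of the data (`exists_isApprox_iterStep`). The bound is proved in a stronger form, in which every
Fourier coefficient is evaluated at its own time (`TimeBound`); this gives continuity in time with
values in `H^k` by dominated convergence. In `L²` with an exponential weight in time the iteration
is a contraction up to a truncation error that decays geometrically (`sum_nextCoef_sub_le`,
`wnorm_iterStep_sub_le`), so that the iterates converge to a solution of the equation for the
Fourier coefficients (`exists_fourier_solution`).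

This solution is Lipschitz in time, uniformly in space (`abs_sub_initial_le`). Hence `Θ(w) ≥ b / 2`
for a short time, and there `θ = Θ(w)` is a classical solution of the original equation
(`isSolution_of_fourier`). Conversely any classical solution `θ` with values above `b / 4` gives a
solution `θ + θ⁴` in Fourier form (`fc_eq_nextCoef_of_isSolution`), which is unique by the
contraction estimate. Since the known solution stays above `b / 2`, the other one cannot be the
first to reach `b / 3`, and so the two agree on all of `[0, T]` (`eq_of_isSolution`).
-/

namespace EquilibriumLimit

open UnitAddTorus Filter Topology
open scoped ComplexConjugate

/-! ### Fourier coefficients on the torus -/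

instance instIsProbabilityMeasureUnitAddCircle :
    IsProbabilityMeasure (volume : Measure UnitAddCircle) :=
  ⟨by rw [AddCircle.measure_univ]; simp⟩

theorem volume_unitAddCircle :
    (volume : Measure UnitAddCircle) = AddCircle.haarAddCircle := by
  have h := AddCircle.volume_eq_smul_haarAddCircle (T := 1)
  rwa [ENNReal.ofReal_one, one_smul] at h

/-- `volume` on `T3` as the product of the Haar measures that Mathlib uses for multivariate
Fourier series. -/
theorem volume_T3 :
    (volume : Measure T3) = Measure.pi fun _ : Fin 3 => AddCircle.haarAddCircle := by
  rw [← volume_unitAddCircle]; rfl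

theorem orthonormal_mFourierLp :
    Orthonormal ℂ (fun n => ContinuousMap.toLp (E := ℂ) 2 (volume : Measure T3) ℂ (mFourier n)) := by
  have key : ∀ μ : Measure T3, ∀ _ : IsFiniteMeasure μ,
      μ = (Measure.pi fun _ : Fin 3 => AddCircle.haarAddCircle) →
      Orthonormal ℂ (fun n => ContinuousMap.toLp (E := ℂ) 2 μ ℂ (mFourier n)) := by
    rintro _ _ rfl
    exact UnitAddTorus.orthonormal_mFourier
  exact key _ _ volume_T3

theorem hasSum_sq_fourier (f : Lp ℂ 2 (volume : Measure T3)) :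
    HasSum (fun n : Fin 3 → ℤ => ‖∫ x, mFourier (-n) x * f x‖ ^ 2) (∫ t, ‖f t‖ ^ 2) := by
  have key : ∀ μ : Measure T3, μ = (Measure.pi fun _ : Fin 3 => AddCircle.haarAddCircle) →
      ∀ f : Lp ℂ 2 μ,
      HasSum (fun n : Fin 3 → ℤ => ‖∫ x, mFourier (-n) x * f x ∂μ‖ ^ 2) (∫ t, ‖f t‖ ^ 2 ∂μ) := by
    rintro _ rfl f
    exact UnitAddTorus.hasSum_sq_mFourierCoeff f
  exact key _ volume_T3 f

theorem hasSum_fourier_apply (f : C(T3, ℂ))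
    (h : Summable fun n : Fin 3 → ℤ => ∫ x, mFourier (-n) x * f x) (x : T3) :
    HasSum (fun n : Fin 3 → ℤ => (∫ x, mFourier (-n) x * f x) * mFourier n x) (f x) := by
  have key : ∀ μ : Measure T3, μ = (Measure.pi fun _ : Fin 3 => AddCircle.haarAddCircle) →
      (Summable fun n : Fin 3 → ℤ => ∫ x : T3, mFourier (-n) x * f x ∂μ) →
      HasSum (fun n : Fin 3 → ℤ => (∫ x : T3, mFourier (-n) x * f x ∂μ) * mFourier n x) (f x) := by
    rintro _ rfl h
    exact UnitAddTorus.hasSum_mFourier_series_apply_of_summable h x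
  exact key _ volume_T3 h

theorem continuous_integrable {E : Type*} [NormedAddCommGroup E] {g : T3 → E} (hg : Continuous g) :
    Integrable g := by
  have := hg.continuousOn.integrableOn_compact (μ := volume) (isCompact_univ (X := T3))
  rwa [integrableOn_univ] at this

theorem continuous_memLp {E : Type*} [NormedAddCommGroup E]
    {g : T3 → E} (hg : Continuous g) : MemLp g 2 := by
  obtain ⟨C, hC⟩ := isCompact_univ.exists_bound_of_continuousOn hg.continuousOn
  have hs : AEStronglyMeasurable g := (continuous_integrable hg).aestronglyMeasurable
  exact MemLp.of_bound hs C (Eventually.of_forall fun x => hC x (mem_univ x))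

/-- The `n`-th Fourier coefficient of a real function on the torus. -/
noncomputable def fc (g : T3 → ℝ) (n : Fin 3 → ℤ) : ℂ := ∫ x, mFourier (-n) x * (g x : ℂ)

theorem norm_mFourier_apply (n : Fin 3 → ℤ) (x : T3) : ‖mFourier n x‖ = 1 := by
  simp only [mFourier, fourier_apply, ContinuousMap.coe_mk, norm_prod]
  exact Finset.prod_eq_one fun i _ => Circle.norm_coe _

theorem integrable_mFourier_mul {g : T3 → ℝ} (hg : Integrable g) (n : Fin 3 → ℤ) :
    Integrable fun x => mFourier n x * (g x : ℂ) :=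
  hg.ofReal.bdd_mul (c := 1) (mFourier n).continuous.aestronglyMeasurable
    (Eventually.of_forall fun x => (norm_mFourier_apply n x).le)

theorem fc_congr_ae {f g : T3 → ℝ} (h : f =ᵐ[volume] g) (n : Fin 3 → ℤ) : fc f n = fc g n := by
  refine integral_congr_ae ?_
  filter_upwards [h] with x hx
  rw [hx]

theorem fc_add {f g : T3 → ℝ} (hf : Integrable f) (hg : Integrable g) (n : Fin 3 → ℤ) :
    fc (fun x => f x + g x) n = fc f n + fc g n := by
  unfold fc
  rw [← integral_add (integrable_mFourier_mul hf _) (integrable_mFourier_mul hg _)]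
  exact integral_congr_ae (Eventually.of_forall fun x => by push_cast; ring)

theorem fc_sub {f g : T3 → ℝ} (hf : Integrable f) (hg : Integrable g) (n : Fin 3 → ℤ) :
    fc (fun x => f x - g x) n = fc f n - fc g n := by
  unfold fc
  rw [← integral_sub (integrable_mFourier_mul hf _) (integrable_mFourier_mul hg _)]
  exact integral_congr_ae (Eventually.of_forall fun x => by push_cast; ring)

theorem fc_const_mul (c : ℝ) (f : T3 → ℝ) (n : Fin 3 → ℤ) :
    fc (fun x => c * f x) n = c * fc f n := by
  unfold fc
  rw [← integral_const_mul]
  exact integral_congr_ae (Eventually.of_forall fun x => by push_cast; ring)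

theorem fc_sum {ι : Type*} (s : Finset ι) {f : ι → T3 → ℝ} (hf : ∀ i ∈ s, Integrable (f i))
    (n : Fin 3 → ℤ) : fc (fun x => ∑ i ∈ s, f i x) n = ∑ i ∈ s, fc (f i) n := by
  unfold fc
  rw [← integral_finsetSum _ fun i hi => integrable_mFourier_mul (hf i hi) _]
  exact integral_congr_ae (Eventually.of_forall fun x => by
    push_cast; rw [Finset.mul_sum])

theorem norm_fc_le {g : T3 → ℝ} {C : ℝ} (hC : ∀ x, |g x| ≤ C) (n : Fin 3 → ℤ) : ‖fc g n‖ ≤ C := by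
  have := norm_integral_le_of_norm_le_const (μ := (volume : Measure T3))
    (f := fun x => mFourier (-n) x * (g x : ℂ)) (C := C)
    (Eventually.of_forall fun x => by
      rw [norm_mul, norm_mFourier_apply, one_mul, Complex.norm_real]; exact hC x)
  simpa [fc] using this

theorem conj_fc (g : T3 → ℝ) (n : Fin 3 → ℤ) : conj (fc g n) = fc g (-n) := by
  unfold fc
  rw [← integral_conj]
  refine integral_congr_ae (Eventually.of_forall fun x => ?_)
  simp [mFourier_neg]

/-- Parseval's identity for real square-integrable functions. -/
theorem hasSum_sq_fc {g : T3 → ℝ} (hg : MemLp g 2) :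
    HasSum (fun n => ‖fc g n‖ ^ 2) (∫ x, g x ^ 2) := by
  have hg' : MemLp (fun x => (g x : ℂ)) 2 (volume : Measure T3) := hg.ofReal
  have h := hasSum_sq_fourier (hg'.toLp _)
  have h1 : (∫ t, ‖(hg'.toLp _ : Lp ℂ 2 (volume : Measure T3)) t‖ ^ 2) = ∫ x, g x ^ 2 := by
    refine integral_congr_ae ?_
    filter_upwards [hg'.coeFn_toLp] with x hx
    rw [hx, Complex.norm_real, Real.norm_eq_abs, sq_abs]
  rw [h1] at h
  convert h using 3 with n
  congr 1
  refine integral_congr_ae ?_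
  filter_upwards [hg'.coeFn_toLp] with x hx
  rw [hx]

/-- Bessel's inequality. -/
theorem sum_sq_fc_le {g : T3 → ℝ} (hg : MemLp g 2) (s : Finset (Fin 3 → ℤ)) :
    ∑ n ∈ s, ‖fc g n‖ ^ 2 ≤ ∫ x, g x ^ 2 :=
  sum_le_hasSum s (fun _ _ => by positivity) (hasSum_sq_fc hg)

theorem hasSum_fc_apply {g : T3 → ℝ} (hg : Continuous g) (h : Summable fun n => fc g n) (x : T3) :
    HasSum (fun n => fc g n * mFourier n x) (g x : ℂ) :=
  hasSum_fourier_apply ⟨fun x => (g x : ℂ), by fun_prop⟩ h x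

theorem abs_le_tsum_fc {g : T3 → ℝ} (hg : Continuous g) (h : Summable fun n => ‖fc g n‖) (x : T3) :
    |g x| ≤ ∑' n, ‖fc g n‖ := by
  have h1 := hasSum_fc_apply hg h.of_norm x
  have h2 : ‖(g x : ℂ)‖ ≤ ∑' n, ‖fc g n * mFourier n x‖ := by
    rw [← h1.tsum_eq]
    exact norm_tsum_le_tsum_norm (by simpa [norm_mFourier_apply] using h)
  simpa [norm_mFourier_apply] using h2

theorem eq_of_fc {f g : T3 → ℝ} (hf : Continuous f) (hg : Continuous g)
    (h : ∀ n, fc f n = fc g n) : f = g := by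
  funext x
  have h3 : ∀ n, fc (fun x => f x - g x) n = 0 := fun n => by
    rw [fc_sub (continuous_integrable hf) (continuous_integrable hg), h, sub_self]
  have h5 := abs_le_tsum_fc (g := fun x => f x - g x) (hf.sub hg)
    (by simp_rw [h3, norm_zero]; exact summable_zero) x
  simp_rw [h3, norm_zero, tsum_zero] at h5
  exact sub_eq_zero.1 (abs_nonpos_iff.1 h5)

theorem integral_mFourier_mul (m n : Fin 3 → ℤ) :
    ∫ x : T3, mFourier (-m) x * mFourier n x = if m = n then 1 else 0 := by
  have h := (orthonormal_iff_ite.1 orthonormal_mFourierLp) m n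
  rw [ContinuousMap.inner_toLp] at h
  rw [← h]
  refine integral_congr_ae (Eventually.of_forall fun x => ?_)
  simp [mFourier_neg, mul_comm]

/-! ### Pure derivatives and integration by parts -/

/-- The `j`-th classical derivative of `g` in the direction `i`. -/
noncomputable def D (i : Fin 3) (j : ℕ) (g : T3 → ℝ) : T3 → ℝ := fun x =>
  iteratedDeriv j (fun s : ℝ => g (x + Pi.single i (s : UnitAddCircle))) 0

theorem add_single_add (x : T3) (i : Fin 3) (s t : ℝ) :
    x + Pi.single i (s : UnitAddCircle) + Pi.single i (t : UnitAddCircle)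
      = x + Pi.single i ((s + t : ℝ) : UnitAddCircle) := by
  rw [add_assoc, ← Pi.single_add]; norm_cast

theorem D_zero (i : Fin 3) (g : T3 → ℝ) : D i 0 g = g := by
  funext x; simp [D]

theorem D_add_single (i : Fin 3) (j : ℕ) (g : T3 → ℝ) (x : T3) (s : ℝ) :
    D i j g (x + Pi.single i (s : UnitAddCircle))
      = iteratedDeriv j (fun s : ℝ => g (x + Pi.single i (s : UnitAddCircle))) s := by
  have h := congrFun (iteratedDeriv_comp_const_add j
    (fun s : ℝ => g (x + Pi.single i (s : UnitAddCircle))) s) 0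
  rw [add_zero] at h
  rw [← h]
  simp only [D, add_single_add]

theorem D_succ (i : Fin 3) (j : ℕ) (g : T3 → ℝ) : D i (j + 1) g = pd i (D i j g) := by
  funext x
  simp_rw [pd, D_add_single]
  rw [D, iteratedDeriv_succ]

theorem D_one (i : Fin 3) (g : T3 → ℝ) : D i 1 g = pd i g := by
  rw [D_succ, D_zero]

theorem D_eq_iterate (i : Fin 3) (j : ℕ) (g : T3 → ℝ) : D i j g = (pd i)^[j] g := by
  induction j with
  | zero => rw [D_zero]; rfl
  | succ j ih => rw [D_succ, ih, Function.iterate_succ_apply']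

theorem D_D (i : Fin 3) (a b : ℕ) (g : T3 → ℝ) : D i a (D i b g) = D i (a + b) g := by
  simp_rw [D_eq_iterate, Function.iterate_add_apply]

theorem D_succ' (i : Fin 3) (j : ℕ) (g : T3 → ℝ) : D i (j + 1) g = D i j (pd i g) := by
  rw [← D_one, D_D]

theorem proj_surjective (x : T3) : ∃ y, proj y = x :=
  isOpenQuotientMap_proj.surjective x

theorem slice_eq_lift (g : T3 → ℝ) (y : Fin 3 → ℝ) (i : Fin 3) :
    (fun s : ℝ => g (proj y + Pi.single i (s : UnitAddCircle)))
      = fun s : ℝ => lift g (y + s • Pi.single i (1 : ℝ)) := by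
  funext s; rw [proj_add_single]; rfl

theorem IsCk.slice {m : WithTop ℕ∞} {g : T3 → ℝ} (hg : IsCk m g) (x : T3) (i : Fin 3) :
    ContDiff ℝ m (fun s : ℝ => g (x + Pi.single i (s : UnitAddCircle))) := by
  obtain ⟨y, rfl⟩ := proj_surjective x
  rw [slice_eq_lift]
  exact ContDiff.comp (g := lift g) hg (by fun_prop)

theorem IsCk.mono {m n : WithTop ℕ∞} {g : T3 → ℝ} (hg : IsCk n g) (h : m ≤ n) : IsCk m g :=
  ContDiff.of_le hg h

theorem lift_pd_of_one {g : T3 → ℝ} (hg : IsCk 1 g) (i : Fin 3) :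
    lift (pd i g) = fun y => fderiv ℝ (lift g) y (Pi.single i 1) := by
  funext y
  have hd : DifferentiableAt ℝ (lift g) y := (ContDiff.differentiable hg (by simp)) y
  show deriv (fun s : ℝ => g (proj y + Pi.single i (s : UnitAddCircle))) 0 = _
  rw [slice_eq_lift]
  exact hd.lineDeriv_eq_fderiv

theorem IsCk.pd_nat {m : ℕ} {g : T3 → ℝ} (hg : IsCk (m + 1 : ℕ) g) (i : Fin 3) :
    IsCk m (EquilibriumLimit.pd i g) := by
  unfold IsCk
  rw [lift_pd_of_one (hg.mono (by exact_mod_cast Nat.le_add_left 1 m))]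
  exact (ContDiff.fderiv_right (m := m) hg (by norm_cast)).clm_apply contDiff_const

theorem IsCk.D_nat {m : ℕ} {j : ℕ} {g : T3 → ℝ} (hg : IsCk (m + j : ℕ) g) (i : Fin 3) :
    IsCk m (EquilibriumLimit.D i j g) := by
  induction j generalizing m with
  | zero => rw [D_zero]; exact hg
  | succ j ih => rw [D_succ]; exact IsCk.pd_nat (ih (by rwa [add_assoc, add_comm 1])) i

theorem IsCk.D {j : ℕ} {g : T3 → ℝ} (hg : IsCk ∞ g) (i : Fin 3) :
    IsCk ∞ (EquilibriumLimit.D i j g) := by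
  rw [D_eq_iterate]; exact hg.pd_iterate i j

theorem IsCk.continuous_D {m j : ℕ} {g : T3 → ℝ} (hg : IsCk m g) (i : Fin 3) (hj : j ≤ m) :
    Continuous (EquilibriumLimit.D i j g) := by
  have : IsCk (m - j : ℕ) (EquilibriumLimit.D i j g) := by
    apply IsCk.D_nat; rwa [Nat.sub_add_cancel hj]
  exact this.continuous

theorem IsCk.nat {g : T3 → ℝ} (hg : IsCk ∞ g) (m : ℕ) : IsCk m g :=
  hg.mono (by exact_mod_cast le_top)

theorem IsCk.sub {m : WithTop ℕ∞} {f g : T3 → ℝ} (hf : IsCk m f) (hg : IsCk m g) :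
    IsCk m (fun x => f x - g x) := ContDiff.sub hf hg

theorem IsCk.mul {m : WithTop ℕ∞} {f g : T3 → ℝ} (hf : IsCk m f) (hg : IsCk m g) :
    IsCk m (fun x => f x * g x) := ContDiff.mul hf hg

theorem IsCk.comp {m : WithTop ℕ∞} {Ψ : ℝ → ℝ} {g : T3 → ℝ} (hΨ : ContDiff ℝ m Ψ)
    (hg : IsCk m g) : IsCk m (fun x => Ψ (g x)) := ContDiff.comp hΨ hg

/-- Leibniz' rule. -/
theorem D_mul {l : ℕ} {f g : T3 → ℝ} (hf : IsCk l f) (hg : IsCk l g) (i : Fin 3) (x : T3) :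
    D i l (fun x => f x * g x) x
      = ∑ a ∈ Finset.range (l + 1), (l.choose a : ℝ) * D i a f x * D i (l - a) g x :=
  iteratedDeriv_mul (hf.slice x i).contDiffAt (hg.slice x i).contDiffAt

theorem D_add {l : ℕ} {f g : T3 → ℝ} (hf : IsCk l f) (hg : IsCk l g) (i : Fin 3) (x : T3) :
    D i l (fun x => f x + g x) x = D i l f x + D i l g x :=
  iteratedDeriv_add (hf.slice x i).contDiffAt (hg.slice x i).contDiffAt

theorem D_sub {l : ℕ} {f g : T3 → ℝ} (hf : IsCk l f) (hg : IsCk l g) (i : Fin 3) (x : T3) :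
    D i l (fun x => f x - g x) x = D i l f x - D i l g x :=
  iteratedDeriv_sub (hf.slice x i).contDiffAt (hg.slice x i).contDiffAt

theorem hasDerivAt_slice {g : T3 → ℝ} (hg : IsCk 1 g) (i : Fin 3) (x : T3) (s : ℝ) :
    HasDerivAt (fun s : ℝ => g (x + Pi.single i (s : UnitAddCircle)))
      (pd i g (x + Pi.single i (s : UnitAddCircle))) s := by
  have h := ((hg.slice x i).differentiable (by simp) s).hasDerivAt
  rw [← D_one, D_add_single, iteratedDeriv_one]
  exact h

theorem hasDerivAt_slice_zero {g : T3 → ℝ} (hg : IsCk 1 g) (i : Fin 3) (x : T3) :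
    HasDerivAt (fun s : ℝ => g (x + Pi.single i (s : UnitAddCircle))) (pd i g x) 0 := by
  simpa using hasDerivAt_slice hg i x 0

theorem pd_comp {Ψ : ℝ → ℝ} {g : T3 → ℝ} (hΨ : Differentiable ℝ Ψ) (hg : IsCk 1 g)
    (i : Fin 3) (x : T3) : pd i (fun x => Ψ (g x)) x = deriv Ψ (g x) * pd i g x := by
  have h := hasDerivAt_slice_zero hg i x
  have h2 := (hΨ (g (x + Pi.single i ((0 : ℝ) : UnitAddCircle)))).hasDerivAt.comp 0 h
  have h3 := h2.deriv
  rw [AddCircle.coe_zero, Pi.single_zero, add_zero] at h3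
  exact h3

theorem pd_mul {f g : T3 → ℝ} (hf : IsCk 1 f) (hg : IsCk 1 g) (i : Fin 3) (x : T3) :
    pd i (fun x => f x * g x) x = pd i f x * g x + f x * pd i g x := by
  have h := ((hasDerivAt_slice_zero hf i x).mul (hasDerivAt_slice_zero hg i x)).deriv
  rw [AddCircle.coe_zero, Pi.single_zero, add_zero] at h
  exact h

theorem IsCk.continuous_pd {g : T3 → ℝ} (hg : IsCk 1 g) (i : Fin 3) :
    Continuous (EquilibriumLimit.pd i g) := by
  rw [← D_one]; exact IsCk.continuous_D (m := 1) hg i le_rfl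

theorem integral_add_right_T3 (f : T3 → ℝ) (a : T3) : ∫ x, f (x + a) = ∫ x, f x :=
  integral_add_right_eq_self f a

theorem exists_abs_le {g : T3 → ℝ} (hg : Continuous g) : ∃ C, ∀ x, |g x| ≤ C := by
  obtain ⟨C, hC⟩ := isCompact_univ.exists_bound_of_continuousOn hg.continuousOn
  exact ⟨C, fun x => hC x (mem_univ x)⟩

theorem hasDerivAt_integral_slice {g : T3 → ℝ} (hg : IsCk 1 g) (i : Fin 3) :
    HasDerivAt (fun s : ℝ => ∫ x : T3, g (x + Pi.single i (s : UnitAddCircle)))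
      (∫ x : T3, pd i g (x + Pi.single i ((0 : ℝ) : UnitAddCircle))) 0 := by
  obtain ⟨C, hC⟩ := exists_abs_le (hg.continuous_pd i)
  have hc : ∀ s : ℝ, Continuous fun x : T3 => g (x + Pi.single i (s : UnitAddCircle)) := fun s =>
    hg.continuous.comp (continuous_add_const _)
  have hc' : Continuous fun x : T3 => pd i g (x + Pi.single i ((0 : ℝ) : UnitAddCircle)) :=
    (hg.continuous_pd i).comp (continuous_add_const _)
  have h1 := (continuous_integrable hc').aestronglyMeasurable
  have h2 := continuous_integrable (hc 0)
  have h3 : ∀ᶠ s : ℝ in 𝓝 (0 : ℝ), AEStronglyMeasurable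
      (fun x : T3 => g (x + Pi.single i (s : UnitAddCircle))) volume :=
    Eventually.of_forall fun s => (continuous_integrable (hc s)).aestronglyMeasurable
  have h4 : ∀ᵐ x : T3, ∀ s ∈ (univ : Set ℝ),
      ‖pd i g (x + Pi.single i (s : UnitAddCircle))‖ ≤ C :=
    Eventually.of_forall fun x s _ => hC _
  have h5 : ∀ᵐ x : T3, ∀ s ∈ (univ : Set ℝ), HasDerivAt
      (fun s : ℝ => g (x + Pi.single i (s : UnitAddCircle)))
      (pd i g (x + Pi.single i (s : UnitAddCircle))) s :=
    Eventually.of_forall fun x s _ => hasDerivAt_slice hg i x s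
  have h6 : Integrable (fun _ : T3 => C) := integrable_const C
  exact (hasDerivAt_integral_of_dominated_loc_of_deriv_le univ_mem h3 h2 h1 h4 h6 h5).2

/-- The integral of a derivative over the torus vanishes, since translations do not change the
integral of `g`. -/
theorem integral_pd {g : T3 → ℝ} (hg : IsCk 1 g) (i : Fin 3) : ∫ x, pd i g x = 0 := by
  have h := hasDerivAt_integral_slice hg i
  rw [integral_add_right_T3 (pd i g)] at h
  have h2 : (fun s : ℝ => ∫ x : T3, g (x + Pi.single i (s : UnitAddCircle)))
      = fun _ => ∫ x, g x := funext fun s => integral_add_right_T3 g _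
  rw [h2] at h
  exact h.unique (hasDerivAt_const _ _)

theorem integral_mul_pd {f g : T3 → ℝ} (hf : IsCk 1 f) (hg : IsCk 1 g) (i : Fin 3) :
    ∫ x, f x * pd i g x = - ∫ x, pd i f x * g x := by
  have h := integral_pd (hf.mul hg) i
  simp_rw [pd_mul hf hg] at h
  have h1 := integral_add (continuous_integrable ((hf.continuous_pd i).mul hg.continuous))
    (continuous_integrable (hf.continuous.mul (hg.continuous_pd i)))
  simp only [Pi.mul_apply] at h1
  rw [h1] at h
  linarith

/-- The angular frequency `2 π nᵢ`. -/
noncomputable def freq (n : Fin 3 → ℤ) (i : Fin 3) : ℝ := 2 * Real.pi * n i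

/-- The real Fourier mode `Re (z e_n)`. -/
noncomputable def mode (n : Fin 3 → ℤ) (z : ℂ) : T3 → ℝ := fun x => (z * mFourier n x).re

theorem mFourier_proj (n : Fin 3 → ℤ) (y : Fin 3 → ℝ) :
    mFourier n (proj y) = Complex.exp (Complex.I * ((∑ i, freq n i * y i : ℝ) : ℂ)) := by
  simp only [mFourier, proj, ContinuousMap.coe_mk, fourier_coe_apply]
  rw [← Complex.exp_sum]
  congr 1
  simp only [freq]
  push_cast
  rw [Finset.mul_sum]
  exact Finset.sum_congr rfl fun i _ => by ring

theorem isCk_mode (n : Fin 3 → ℤ) (z : ℂ) : IsCk ∞ (mode n z) := by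
  have : lift (mode n z)
      = fun y => (z * Complex.exp (Complex.I * ((∑ i, freq n i * y i : ℝ) : ℂ))).re := by
    funext y; simp only [lift, mode]; rw [mFourier_proj]
  unfold IsCk
  rw [this]
  have h1 : ContDiff ℝ ∞ fun y : Fin 3 → ℝ => ((∑ i, freq n i * y i : ℝ) : ℂ) :=
    Complex.ofRealCLM.contDiff.comp (E := Fin 3 → ℝ) (f := fun y => ∑ i, freq n i * y i)
      (ContDiff.sum fun i _ => contDiff_const.mul (contDiff_apply ℝ ℝ i))
  exact Complex.reCLM.contDiff.comp (contDiff_const.mul (contDiff_const.mul h1).cexp)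

theorem hasDerivAt_mFourier (n : Fin 3 → ℤ) (i : Fin 3) (x : T3) :
    HasDerivAt (fun s : ℝ => mFourier n (x + Pi.single i (s : UnitAddCircle)))
      (Complex.I * freq n i * mFourier n x) 0 := by
  obtain ⟨y, rfl⟩ := proj_surjective x
  simp_rw [proj_add_single, mFourier_proj]
  have h0 : ∀ s : ℝ, ∑ j, freq n j * (y + s • (Pi.single i (1 : ℝ) : Fin 3 → ℝ)) j
      = (∑ j, freq n j * y j) + s * freq n i := by
    intro s
    simp only [Pi.add_apply, Pi.smul_apply, smul_eq_mul, mul_add, Finset.sum_add_distrib]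
    congr 1
    rw [Finset.sum_eq_single i] <;> simp +contextual [mul_comm]
  simp_rw [h0]
  have h1 : HasDerivAt (fun s : ℝ => (((∑ j, freq n j * y j) + s * freq n i : ℝ) : ℂ))
      ((freq n i : ℝ) : ℂ) 0 := by
    have := ((hasDerivAt_id (0 : ℝ)).mul_const (freq n i)).const_add (∑ j, freq n j * y j)
    simpa using this.ofReal_comp
  have h2 := (h1.const_mul Complex.I).cexp
  convert h2 using 1
  simp; ring

theorem pd_mode (n : Fin 3 → ℤ) (z : ℂ) (i : Fin 3) :
    pd i (mode n z) = mode n (Complex.I * freq n i * z) := by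
  funext x
  have h := ((hasDerivAt_mFourier n i x).const_mul z)
  have h2 := Complex.reCLM.hasFDerivAt.comp_hasDerivAt 0 h
  have h3 := h2.deriv
  simp only [Function.comp_def, Complex.reCLM_apply] at h3
  simp only [pd, mode]
  rw [h3]
  congr 1; ring

theorem D_mode (n : Fin 3 → ℤ) (z : ℂ) (i : Fin 3) (j : ℕ) :
    D i j (mode n z) = mode n ((Complex.I * freq n i) ^ j * z) := by
  induction j with
  | zero => simp [D_zero]
  | succ j ih => rw [D_succ, ih, pd_mode]; congr 1; ring

theorem re_mul_fc {g : T3 → ℝ} (hg : Integrable g) (n : Fin 3 → ℤ) (z : ℂ) :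
    ∫ x, g x * mode (-n) z x = (z * fc g n).re := by
  have h1 : z * fc g n = ∫ x, z * (mFourier (-n) x * (g x : ℂ)) := (integral_const_mul _ _).symm
  rw [h1]
  have h2 := integral_re (𝕜 := ℂ) ((integrable_mFourier_mul hg (-n)).const_mul z)
  simp only [RCLike.re_to_complex] at h2
  rw [← h2]
  refine integral_congr_ae (Eventually.of_forall fun x => ?_)
  simp only [mode, ← mul_assoc, Complex.re_mul_ofReal, mul_comm (g x)]

theorem eq_of_re_mul {a b : ℂ} (h : ∀ z : ℂ, (z * a).re = (z * b).re) : a = b := by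
  have h1 := h 1
  have h2 := h (-Complex.I)
  apply Complex.ext
  · simpa using h1
  · simpa using h2

theorem freq_neg (n : Fin 3 → ℤ) (i : Fin 3) : freq (-n) i = - freq n i := by
  simp [freq]

theorem fc_pd {g : T3 → ℝ} (hg : IsCk 1 g) (i : Fin 3) (n : Fin 3 → ℤ) :
    fc (pd i g) n = Complex.I * freq n i * fc g n := by
  refine eq_of_re_mul fun z => ?_
  rw [← re_mul_fc (continuous_integrable (hg.continuous_pd i))]
  have h := integral_mul_pd hg ((isCk_mode (-n) z).mono (by exact_mod_cast le_top)) i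
  rw [pd_mode, re_mul_fc (continuous_integrable hg.continuous)] at h
  rw [← neg_eq_iff_eq_neg.2 h, ← Complex.neg_re, freq_neg]
  congr 1; push_cast; ring

theorem fc_D {j : ℕ} {g : T3 → ℝ} (hg : IsCk j g) (i : Fin 3) (n : Fin 3 → ℤ) :
    fc (D i j g) n = (Complex.I * freq n i) ^ j * fc g n := by
  induction j with
  | zero => simp [D_zero]
  | succ j ih =>
    rw [D_succ, fc_pd, ih (hg.mono (by exact_mod_cast Nat.le_succ j)), pow_succ]
    · ring
    · exact IsCk.D_nat (m := 1) (by rwa [add_comm]) i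

theorem norm_fc_D {j : ℕ} {g : T3 → ℝ} (hg : IsCk j g) (i : Fin 3) (n : Fin 3 → ℤ) :
    ‖fc (D i j g) n‖ = |freq n i| ^ j * ‖fc g n‖ := by
  rw [fc_D hg, norm_mul, norm_pow, norm_mul]; simp

/-! ### Weighted bounds on Fourier coefficients, products and compositions -/

/-- The weight `1 + ∑ᵢ (2 π nᵢ)^(2k)`, equivalent to the Fourier weight of `‖·‖²` in `H^k`. Only
pure derivatives enter, so that each of them can be estimated separately. -/
noncomputable def W (k : ℕ) (n : Fin 3 → ℤ) : ℝ := 1 + ∑ i, freq n i ^ (2 * k)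

/-- The size of a frequency. -/
noncomputable def sz (n : Fin 3 → ℤ) : ℝ := 1 + ∑ i, |freq n i|

/-- The Fourier multiplier of `-Δ`. -/
noncomputable def lam (n : Fin 3 → ℤ) : ℝ := ∑ i, freq n i ^ 2

/-- `g` has squared `H^k` norm (in the norm with weight `W k`) at most `R`. -/
def HB (k : ℕ) (g : T3 → ℝ) (R : ℝ) : Prop :=
  ∀ s : Finset (Fin 3 → ℤ), ∑ n ∈ s, W k n * ‖fc g n‖ ^ 2 ≤ R

theorem one_le_W (k : ℕ) (n : Fin 3 → ℤ) : 1 ≤ W k n := by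
  have : 0 ≤ ∑ i, freq n i ^ (2 * k) :=
    Finset.sum_nonneg fun i _ => by rw [pow_mul]; positivity
  unfold W; linarith

theorem W_pos (k : ℕ) (n : Fin 3 → ℤ) : 0 < W k n := lt_of_lt_of_le one_pos (one_le_W k n)

theorem one_le_sz (n : Fin 3 → ℤ) : 1 ≤ sz n := by
  have : 0 ≤ ∑ i, |freq n i| := Finset.sum_nonneg fun i _ => abs_nonneg _
  unfold sz; linarith

theorem sz_pos (n : Fin 3 → ℤ) : 0 < sz n := lt_of_lt_of_le one_pos (one_le_sz n)

theorem abs_freq_le_sz (n : Fin 3 → ℤ) (i : Fin 3) : |freq n i| ≤ sz n := by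
  have := Finset.single_le_sum (f := fun i => |freq n i|) (fun i _ => abs_nonneg _)
    (Finset.mem_univ i)
  unfold sz; linarith

theorem freq_pow_le_W {j k : ℕ} (hj : j ≤ k) (n : Fin 3 → ℤ) (i : Fin 3) :
    freq n i ^ (2 * j) ≤ W k n := by
  have h1 : freq n i ^ (2 * k) ≤ ∑ i, freq n i ^ (2 * k) :=
    Finset.single_le_sum (f := fun i => freq n i ^ (2 * k))
      (fun i _ => by rw [pow_mul]; positivity) (Finset.mem_univ i)
  have h2 : freq n i ^ (2 * j) ≤ 1 + freq n i ^ (2 * k) := by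
    rw [pow_mul, pow_mul]
    rcases le_total (freq n i ^ 2) 1 with h | h
    · have := pow_le_one₀ (n := j) (sq_nonneg _) h
      have : 0 ≤ (freq n i ^ 2) ^ k := by positivity
      linarith
    · have := pow_le_pow_right₀ h hj
      linarith
  unfold W; linarith

theorem sz_pow_le (k : ℕ) (n : Fin 3 → ℤ) : sz n ^ (2 * k) ≤ 4 ^ (2 * k) * W k n := by
  have key : ∃ M : ℝ, 0 ≤ M ∧ sz n ≤ 4 * M ∧ M ^ (2 * k) ≤ W k n := by
    by_cases h : ∃ i, 1 ≤ |freq n i|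
    · obtain ⟨i, -, hi⟩ := Finset.exists_max_image Finset.univ (fun i => |freq n i|) ⟨0, by simp⟩
      obtain ⟨i', hi'⟩ := h
      refine ⟨|freq n i|, abs_nonneg _, ?_, ?_⟩
      · have h1 := hi i' (Finset.mem_univ _)
        have h2 : ∑ j, |freq n j| ≤ ∑ _j : Fin 3, |freq n i| :=
          Finset.sum_le_sum fun j hj => hi j hj
        simp at h2
        unfold sz; linarith
      · rw [pow_mul, sq_abs, ← pow_mul]; exact freq_pow_le_W le_rfl n i
    · push Not at h
      refine ⟨1, by norm_num, ?_, by rw [one_pow]; exact one_le_W k n⟩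
      have h2 : ∑ j, |freq n j| ≤ ∑ _j : Fin 3, (1 : ℝ) :=
        Finset.sum_le_sum fun j hj => (h j).le
      simp at h2
      unfold sz; linarith
  obtain ⟨M, hM, h1, h2⟩ := key
  calc sz n ^ (2 * k) ≤ (4 * M) ^ (2 * k) := pow_le_pow_left₀ (sz_pos n).le h1 _
    _ = 4 ^ (2 * k) * M ^ (2 * k) := mul_pow _ _ _
    _ ≤ _ := by gcongr

/-- Comparison with the sum of `‖n‖⁻⁴` over the lattice `ℤ³`, whose exponent exceeds its rank. -/
theorem summable_sz : Summable fun n : Fin 3 → ℤ => (sz n ^ 4)⁻¹ := by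
  let b := Pi.basisFun ℝ (Fin 3)
  let L := Submodule.span ℤ (Set.range b)
  have hr : Module.finrank ℤ L < 4 := by
    rw [ZLattice.rank ℝ L]; simp
  have h := ZLattice.summable_norm_pow_inv L 4 hr
  have hmem : ∀ n : Fin 3 → ℤ, (fun i => (n i : ℝ)) ∈ L := by
    intro n
    have : (fun i => (n i : ℝ)) = ∑ i, n i • b i := by
      funext j
      simp [b, Pi.single_apply]
    rw [this]
    exact Submodule.sum_mem _ fun i _ =>
      Submodule.smul_mem _ _ (Submodule.subset_span (Set.mem_range_self i))
  let φ : (Fin 3 → ℤ) → L := fun n => ⟨fun i => (n i : ℝ), hmem n⟩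
  have hφ : Function.Injective φ := by
    intro m n hmn
    funext i
    have := congrFun (congrArg Subtype.val hmn) i
    simpa [φ] using this
  have h2 := h.comp_injective hφ
  rw [← (Set.finite_singleton (0 : Fin 3 → ℤ)).summable_compl_iff]
  refine Summable.of_nonneg_of_le (fun n => inv_nonneg.2 (pow_nonneg (sz_pos _).le 4)) (fun n => ?_)
    (h2.comp_injective (Subtype.val_injective (p := (· ∈ ({0} : Set (Fin 3 → ℤ))ᶜ))))
  have hn : (n : Fin 3 → ℤ) ≠ 0 := n.2
  have hpos : 0 < ‖φ n‖ := by
    rw [norm_pos_iff]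
    intro h0
    refine hn (hφ (h0.trans ?_))
    ext i; simp [φ]
  have hle : ‖φ n‖ ≤ sz n := by
    have : ‖φ n‖ = ‖(fun i => ((n : Fin 3 → ℤ) i : ℝ))‖ := rfl
    rw [this, pi_norm_le_iff_of_nonneg (sz_pos _).le]
    intro i
    refine le_trans ?_ (abs_freq_le_sz _ i)
    rw [freq, abs_mul, Real.norm_eq_abs, abs_of_pos (show 0 < 2 * Real.pi by positivity)]
    have := Real.pi_gt_three
    nlinarith [abs_nonneg ((n : Fin 3 → ℤ) i : ℝ)]
  simp only [Function.comp_apply, inv_pow]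
  gcongr

/-- The constant of the Sobolev embedding. -/
noncomputable def CS : ℝ := ∑' n : Fin 3 → ℤ, (sz n ^ 4)⁻¹

theorem CS_nonneg : 0 ≤ CS := tsum_nonneg fun n => inv_nonneg.2 (pow_nonneg (sz_pos n).le 4)

theorem norm_le_of_weight {k : ℕ} {n : Fin 3 → ℤ} {K : ℝ} (hK : 0 ≤ K) {z : ℂ}
    (h : W k n * ‖z‖ ^ 2 ≤ K ^ 2) : ‖z‖ ≤ 4 ^ k * K * (sz n ^ k)⁻¹ := by
  have hs := sz_pos n
  rw [← div_eq_mul_inv, le_div_iff₀ (by positivity)]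
  refine le_of_sq_le_sq ?_ (by positivity)
  calc (‖z‖ * sz n ^ k) ^ 2 = sz n ^ (2 * k) * ‖z‖ ^ 2 := by ring
    _ ≤ (4 ^ (2 * k) * W k n) * ‖z‖ ^ 2 := by gcongr; exact sz_pow_le k n
    _ = 4 ^ (2 * k) * (W k n * ‖z‖ ^ 2) := by ring
    _ ≤ 4 ^ (2 * k) * K ^ 2 := by gcongr
    _ = _ := by ring

theorem HB.single {k : ℕ} {g : T3 → ℝ} {R : ℝ} (h : HB k g R) (n : Fin 3 → ℤ) :
    W k n * ‖fc g n‖ ^ 2 ≤ R := by simpa using h {n}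

theorem HB.nonneg {k : ℕ} {g : T3 → ℝ} {R : ℝ} (h : HB k g R) : 0 ≤ R := by simpa using h ∅

theorem HB.mono {k : ℕ} {g : T3 → ℝ} {R R' : ℝ} (h : HB k g R) (hR : R ≤ R') : HB k g R' :=
  fun s => (h s).trans hR

theorem weight_mul_inv_le {j k : ℕ} (h : j + 4 ≤ k) (n : Fin 3 → ℤ) :
    sz n ^ j * (sz n ^ k)⁻¹ ≤ (sz n ^ 4)⁻¹ := by
  have hs := sz_pos n
  rw [← div_eq_mul_inv, div_le_iff₀ (by positivity), ← div_eq_inv_mul, le_div_iff₀ (by positivity),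
    ← pow_add]
  exact pow_le_pow_right₀ (one_le_sz n) h

theorem sz_pow_mul_norm_le {j k : ℕ} (hjk : j + 4 ≤ k) {n : Fin 3 → ℤ} {K : ℝ} (hK : 0 ≤ K) {z : ℂ}
    (h : W k n * ‖z‖ ^ 2 ≤ K ^ 2) : sz n ^ j * ‖z‖ ≤ 4 ^ k * K * (sz n ^ 4)⁻¹ := by
  have hs := sz_pos n
  calc sz n ^ j * ‖z‖ ≤ sz n ^ j * (4 ^ k * K * (sz n ^ k)⁻¹) := by
        gcongr; exact norm_le_of_weight hK h
    _ = 4 ^ k * K * (sz n ^ j * (sz n ^ k)⁻¹) := by ring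
    _ ≤ _ := by gcongr; exact weight_mul_inv_le hjk n

/-- Control of the derivatives of `f` in the direction `i`: those of order at most `k - 4` are
bounded by `K`, those of order at most `k` are bounded by `K` in `L²`, as far as their order is at
most `r`. -/
structure Ctl (i : Fin 3) (k r : ℕ) (K : ℝ) (f : T3 → ℝ) : Prop where
  sup : ∀ j ≤ r, j + 4 ≤ k → ∀ x, |D i j f x| ≤ K
  l2 : ∀ j ≤ r, ∫ x, D i j f x ^ 2 ≤ K ^ 2

theorem Ctl.mono {i : Fin 3} {k r r' : ℕ} {K K' : ℝ} {f : T3 → ℝ} (h : Ctl i k r K f)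
    (hr : r' ≤ r) (hK0 : 0 ≤ K) (hK : K ≤ K') : Ctl i k r' K' f :=
  ⟨fun j hj h4 x => (h.sup j (hj.trans hr) h4 x).trans hK,
    fun j hj => (h.l2 j (hj.trans hr)).trans (by gcongr)⟩

/-- Sobolev's embedding in the form needed here. -/
theorem HB.ctl {k : ℕ} {g : T3 → ℝ} {K : ℝ} (hK : 0 ≤ K) (hg : IsCk k g) (h : HB k g (K ^ 2))
    (i : Fin 3) : Ctl i k k ((1 + 4 ^ k * CS) * K) g := by
  have hCS := CS_nonneg
  refine ⟨fun j hj h4 x => ?_, fun j hj => ?_⟩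
  · have hb : ∀ n, ‖fc (D i j g) n‖ ≤ 4 ^ k * K * (sz n ^ 4)⁻¹ := fun n => by
      rw [norm_fc_D (hg.mono (by exact_mod_cast hj))]
      refine le_trans ?_ (sz_pow_mul_norm_le h4 hK (h.single n))
      gcongr
      exact abs_freq_le_sz n i
    have hs : Summable fun n => ‖fc (D i j g) n‖ :=
      Summable.of_nonneg_of_le (fun _ => norm_nonneg _) hb (summable_sz.mul_left _)
    calc |D i j g x| ≤ ∑' n, ‖fc (D i j g) n‖ := abs_le_tsum_fc (hg.continuous_D i hj) hs x
      _ ≤ ∑' n, 4 ^ k * K * (sz n ^ 4)⁻¹ := hs.tsum_le_tsum hb (summable_sz.mul_left _)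
      _ = 4 ^ k * K * CS := tsum_mul_left
      _ ≤ (1 + 4 ^ k * CS) * K := by nlinarith
  · have h1 := hasSum_sq_fc (continuous_memLp (hg.continuous_D i hj))
    have h2 : ∫ x, D i j g x ^ 2 ≤ K ^ 2 := by
      refine hasSum_le_of_sum_le h1 fun s => le_trans (Finset.sum_le_sum fun n _ => ?_) (h s)
      rw [norm_fc_D (hg.mono (by exact_mod_cast hj)), mul_pow, ← pow_mul, mul_comm j, pow_mul,
        sq_abs, ← pow_mul]
      gcongr
      exact freq_pow_le_W hj n i
    refine h2.trans ?_
    gcongr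
    have : 0 ≤ 4 ^ k * CS * K := by positivity
    nlinarith

theorem HB_of_l2 {k : ℕ} {g : T3 → ℝ} {K : ℝ} (hg : IsCk k g) (h0 : ∫ x, g x ^ 2 ≤ K ^ 2)
    (h : ∀ i, ∫ x, D i k g x ^ 2 ≤ K ^ 2) : HB k g (4 * K ^ 2) := by
  intro s
  have h1 : ∑ n ∈ s, W k n * ‖fc g n‖ ^ 2
      = ∑ n ∈ s, ‖fc g n‖ ^ 2 + ∑ i, ∑ n ∈ s, ‖fc (D i k g) n‖ ^ 2 := by
    rw [Finset.sum_comm, ← Finset.sum_add_distrib]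
    refine Finset.sum_congr rfl fun n _ => ?_
    rw [W, add_mul, one_mul, Finset.sum_mul]
    congr 1
    refine Finset.sum_congr rfl fun i _ => ?_
    rw [norm_fc_D hg, mul_pow, ← pow_mul, mul_comm k, pow_mul, pow_mul, sq_abs]
  have h2 := (sum_sq_fc_le (continuous_memLp hg.continuous) s).trans h0
  have h3 : ∀ i, ∑ n ∈ s, ‖fc (D i k g) n‖ ^ 2 ≤ K ^ 2 := fun i =>
    (sum_sq_fc_le (continuous_memLp (hg.continuous_D i le_rfl)) s).trans (h i)
  rw [h1, Fin.sum_univ_three]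
  linarith [h3 0, h3 1, h3 2]

theorem Ctl.hb {k : ℕ} {g : T3 → ℝ} {K : ℝ} (hg : IsCk k g) (h : ∀ i, Ctl i k k K g) :
    HB k g (4 * K ^ 2) := by
  refine HB_of_l2 hg ?_ fun i => (h i).l2 k le_rfl
  have := (h 0).l2 0 (Nat.zero_le k)
  rwa [D_zero] at this

theorem integral_sq_sum_le {ι : Type*} (s : Finset ι) (c : ι → ℝ) (hc : ∀ a ∈ s, 0 ≤ c a)
    (f : ι → T3 → ℝ) (hf : ∀ a ∈ s, Continuous (f a)) {B : ℝ}
    (hB : ∀ a ∈ s, ∫ x, f a x ^ 2 ≤ B ^ 2) :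
    ∫ x, (∑ a ∈ s, c a * f a x) ^ 2 ≤ ((∑ a ∈ s, c a) * B) ^ 2 := by
  have hint : ∀ a ∈ s, Integrable fun x => c a * f a x ^ 2 := fun a ha =>
    continuous_integrable (continuous_const.mul ((hf a ha).pow 2))
  calc ∫ x, (∑ a ∈ s, c a * f a x) ^ 2
      ≤ ∫ x, (∑ a ∈ s, c a) * ∑ a ∈ s, c a * f a x ^ 2 := by
        refine integral_mono (continuous_integrable ?_) ?_ fun x => ?_
        · exact (continuous_finsetSum _ fun a ha => continuous_const.mul (hf a ha)).pow 2
        · exact (integrable_finsetSum _ hint).const_mul _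
        · exact Finset.sum_sq_le_sum_mul_sum_of_sq_le_mul s hc
            (fun a ha => mul_nonneg (hc a ha) (sq_nonneg _)) fun a _ => le_of_eq (by ring)
    _ = (∑ a ∈ s, c a) * ∑ a ∈ s, c a * ∫ x, f a x ^ 2 := by
        rw [integral_const_mul, integral_finsetSum _ hint]
        simp_rw [integral_const_mul]
    _ ≤ (∑ a ∈ s, c a) * ∑ a ∈ s, c a * B ^ 2 := by
        refine mul_le_mul_of_nonneg_left (Finset.sum_le_sum fun a ha => ?_) (Finset.sum_nonneg hc)
        exact mul_le_mul_of_nonneg_left (hB a ha) (hc a ha)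
    _ = _ := by rw [← Finset.sum_mul]; ring

theorem integral_sq_add_le {f g : T3 → ℝ} (hf : Continuous f) (hg : Continuous g) {B : ℝ}
    (h1 : ∫ x, f x ^ 2 ≤ B ^ 2) (h2 : ∫ x, g x ^ 2 ≤ B ^ 2) :
    ∫ x, (f x + g x) ^ 2 ≤ (2 * B) ^ 2 := by
  have i1 : Integrable fun x => 2 * f x ^ 2 := continuous_integrable (by fun_prop)
  have i2 : Integrable fun x => 2 * g x ^ 2 := continuous_integrable (by fun_prop)
  calc ∫ x, (f x + g x) ^ 2 ≤ ∫ x, (2 * f x ^ 2 + 2 * g x ^ 2) :=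
        integral_mono (continuous_integrable ((hf.add hg).pow 2)) (i1.add i2)
          fun x => by nlinarith [sq_nonneg (f x - g x)]
    _ = 2 * (∫ x, f x ^ 2) + 2 * ∫ x, g x ^ 2 := by
        rw [integral_add i1 i2, integral_const_mul, integral_const_mul]
    _ ≤ _ := by linarith

theorem integral_sq_mul_le {f h : T3 → ℝ} (hf : Continuous f) (hh : Continuous h) {K L : ℝ}
    (h1 : ∀ x, |f x| ≤ K) (h2 : ∫ x, h x ^ 2 ≤ L ^ 2) :
    ∫ x, (f x * h x) ^ 2 ≤ (K * L) ^ 2 := by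
  calc ∫ x, (f x * h x) ^ 2 ≤ ∫ x, K ^ 2 * h x ^ 2 := by
        refine integral_mono (continuous_integrable (by fun_prop))
          (continuous_integrable (by fun_prop)) fun x => ?_
        simp only [mul_pow]
        exact mul_le_mul_of_nonneg_right
          (sq_le_sq' (abs_le.1 (h1 x)).1 (abs_le.1 (h1 x)).2) (sq_nonneg _)
    _ = K ^ 2 * ∫ x, h x ^ 2 := integral_const_mul _ _
    _ ≤ K ^ 2 * L ^ 2 := by gcongr
    _ = _ := by ring

/-- A single term of Leibniz' rule in `L²`. The shift `p` serves for factors `h` that are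
derivatives of order `p` of a controlled function: one of the two factors has low order and is
bounded. -/
theorem integral_sq_leibniz_term {i : Fin 3} {k l a b p : ℕ} (hk : 8 ≤ k) (hlk : l ≤ k)
    (hab : a + b = l) (hp : p ≤ 1) {f h : T3 → ℝ} {K L : ℝ} (hf : IsCk l f)
    (hh : IsCk l h) (hfc : Ctl i k l K f)
    (hsup : b + p + 4 ≤ k → ∀ x, |D i b h x| ≤ L) (hl2 : ∫ x, D i b h x ^ 2 ≤ L ^ 2) :
    ∫ x, (D i a f x * D i b h x) ^ 2 ≤ (K * L) ^ 2 := by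
  have hfa := hf.continuous_D i (show a ≤ l by omega)
  have hhb := hh.continuous_D i (show b ≤ l by omega)
  by_cases ha : a + 4 ≤ k
  · exact integral_sq_mul_le hfa hhb (hfc.sup a (by omega) ha) hl2
  · simp_rw [mul_comm (D i a f _), mul_comm K]
    exact integral_sq_mul_le hhb hfa (hsup (by omega)) (hfc.l2 a (by omega))

/-- Leibniz' rule for `∂ᵢ^l (f h)`, in the supremum norm as long as the order is low enough, and in
`L²`. The factor `2 ^ k` bounds the sum of the binomial coefficients. -/
theorem D_mul_bounds {i : Fin 3} {k l p : ℕ} (hk : 8 ≤ k) (hlk : l ≤ k) (hp : p ≤ 1)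
    {f h : T3 → ℝ} {K L : ℝ} (hK : 0 ≤ K) (hL : 0 ≤ L) (hf : IsCk l f)
    (hh : IsCk l h) (hfc : Ctl i k l K f)
    (hsup : ∀ b ≤ l, b + p + 4 ≤ k → ∀ x, |D i b h x| ≤ L)
    (hl2 : ∀ b ≤ l, ∫ x, D i b h x ^ 2 ≤ L ^ 2) :
    (l + p + 4 ≤ k → ∀ x, |D i l (fun x => f x * h x) x| ≤ 2 ^ k * K * L) ∧
      ∫ x, D i l (fun x => f x * h x) x ^ 2 ≤ (2 ^ k * K * L) ^ 2 := by
  have hsum : ∑ a ∈ Finset.range (l + 1), (l.choose a : ℝ) = 2 ^ l := by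
    exact_mod_cast Nat.sum_range_choose l
  have hpow : (2 : ℝ) ^ l ≤ 2 ^ k := pow_le_pow_right₀ (by norm_num) hlk
  constructor
  · intro hl x
    rw [D_mul hf hh]
    calc |∑ a ∈ Finset.range (l + 1), (l.choose a : ℝ) * D i a f x * D i (l - a) h x|
        ≤ ∑ a ∈ Finset.range (l + 1), (l.choose a : ℝ) * (K * L) := by
          refine (Finset.abs_sum_le_sum_abs _ _).trans (Finset.sum_le_sum fun a ha => ?_)
          rw [Finset.mem_range] at ha
          rw [abs_mul, abs_mul, Nat.abs_cast, mul_assoc]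
          have h1 := hfc.sup a (by omega) (by omega) x
          have h2 := hsup (l - a) (by omega) (by omega) x
          gcongr
      _ = 2 ^ l * (K * L) := by rw [← Finset.sum_mul, hsum]
      _ ≤ 2 ^ k * (K * L) := by gcongr
      _ = _ := by ring
  · have h1 : ∀ x, D i l (fun x => f x * h x) x = ∑ a ∈ Finset.range (l + 1),
        (l.choose a : ℝ) * (D i a f x * D i (l - a) h x) := fun x => by
      rw [D_mul hf hh]; exact Finset.sum_congr rfl fun a _ => by ring
    simp_rw [h1]
    refine (integral_sq_sum_le _ _ (fun a _ => Nat.cast_nonneg _)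
      (fun a x => D i a f x * D i (l - a) h x) (fun a ha => ?_) (B := K * L)
      fun a ha => ?_).trans ?_
    · rw [Finset.mem_range] at ha
      exact (hf.continuous_D i (by omega)).mul (hh.continuous_D i (by omega))
    · rw [Finset.mem_range] at ha
      exact integral_sq_leibniz_term hk hlk (by omega) hp hf hh hfc (hsup _ (by omega))
        (hl2 _ (by omega))
    · rw [hsum, mul_assoc]
      gcongr

theorem Ctl.mul {i : Fin 3} {k : ℕ} (hk : 8 ≤ k) {f h : T3 → ℝ} {K L : ℝ} (hK : 0 ≤ K)
    (hL : 0 ≤ L) (hf : IsCk k f) (hh : IsCk k h) (hfc : Ctl i k k K f) (hhc : Ctl i k k L h) :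
    Ctl i k k (2 ^ k * K * L) (fun x => f x * h x) := by
  have key := fun (l : ℕ) (hl : l ≤ k) => D_mul_bounds (p := 0) hk hl zero_le_one hK hL
    (hf.mono (by exact_mod_cast hl)) (hh.mono (by exact_mod_cast hl)) (hfc.mono hl hK le_rfl)
    (fun b hb h4 => hhc.sup b (hb.trans hl) h4) (fun b hb => hhc.l2 b (hb.trans hl))
  exact ⟨fun j hj h4 => (key j hj).1 h4, fun j hj => (key j hj).2⟩

/-- The derivatives of order at most `k - 1` of `f ∂ᵢv`. -/
theorem Ctl.mul_pd {i : Fin 3} {k l : ℕ} (hk : 8 ≤ k) (hlk : l + 1 ≤ k) {f v : T3 → ℝ} {K L : ℝ}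
    (hK : 0 ≤ K) (hL : 0 ≤ L) (hf : IsCk ∞ f) (hv : IsCk ∞ v) (hfc : Ctl i k l K f)
    (hvc : Ctl i k k L v) :
    (l + 1 + 4 ≤ k → ∀ x, |D i l (fun x => f x * pd i v x) x| ≤ 2 ^ k * K * L) ∧
      ∫ x, D i l (fun x => f x * pd i v x) x ^ 2 ≤ (2 ^ k * K * L) ^ 2 := by
  refine D_mul_bounds hk (by omega) le_rfl hK hL (hf.nat l) ((hv.pd i).nat l) hfc
    (fun b hb h4 x => ?_) (fun b hb => ?_)
  · rw [← D_succ']; exact hvc.sup _ (by omega) (by omega) x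
  · rw [← D_succ']; exact hvc.l2 _ (by omega)

theorem contDiff_deriv {Ψ : ℝ → ℝ} (h : ContDiff ℝ ∞ Ψ) : ContDiff ℝ ∞ (deriv Ψ) :=
  ((contDiff_infty_iff_deriv).1 h).2

theorem pd_comp_infty {Ψ : ℝ → ℝ} {g : T3 → ℝ} (hΨ : ContDiff ℝ ∞ Ψ) (hg : IsCk ∞ g)
    (i : Fin 3) : pd i (fun x => Ψ (g x)) = fun x => deriv Ψ (g x) * pd i g x :=
  funext fun x => pd_comp (hΨ.differentiable (by simp)) (hg.mono (by exact_mod_cast le_top)) i x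

theorem exists_bound_Icc {Ψ : ℝ → ℝ} (hΨ : Continuous Ψ) (K : ℝ) :
    ∃ C, 0 ≤ C ∧ ∀ x, |x| ≤ K → |Ψ x| ≤ C := by
  obtain ⟨C, hC⟩ := (isCompact_Icc (a := -K) (b := K)).exists_bound_of_continuousOn hΨ.continuousOn
  exact ⟨max C 0, le_max_right _ _, fun x hx => (hC x (abs_le.1 hx)).trans (le_max_left _ _)⟩

theorem exists_lip_Icc {Ψ : ℝ → ℝ} (hΨ : ContDiff ℝ ∞ Ψ) (K : ℝ) :
    ∃ C, 0 ≤ C ∧ ∀ x y, |x| ≤ K → |y| ≤ K → |Ψ x - Ψ y| ≤ C * |x - y| := by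
  obtain ⟨C, hC0, hC⟩ := exists_bound_Icc (contDiff_deriv hΨ).continuous K
  refine ⟨C, hC0, fun x y hx hy => ?_⟩
  exact (convex_Icc (-K) K).norm_image_sub_le_of_norm_deriv_le
    (fun z _ => hΨ.differentiable (by simp) z) (fun z hz => hC z (abs_le.2 hz))
    (abs_le.1 hy) (abs_le.1 hx)

theorem integral_sq_le_of_abs_le {f : T3 → ℝ} {C : ℝ} (h : ∀ x, |f x| ≤ C) :
    ∫ x, f x ^ 2 ≤ C ^ 2 := by
  have h1 : ∀ x, ‖f x ^ 2‖ ≤ C ^ 2 := fun x => by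
    rw [Real.norm_eq_abs, abs_of_nonneg (sq_nonneg _), ← sq_abs]
    exact pow_le_pow_left₀ (abs_nonneg _) (h x) 2
  have := norm_integral_le_of_norm_le_const (μ := (volume : Measure T3)) (Eventually.of_forall h1)
  simp only [probReal_univ, mul_one] at this
  exact (le_abs_self _).trans this

theorem integral_sq_mono {f g : T3 → ℝ} (hf : Continuous f) (hg : Continuous g)
    (h : ∀ x, |f x| ≤ |g x|) : ∫ x, f x ^ 2 ≤ ∫ x, g x ^ 2 :=
  integral_mono (continuous_integrable (hf.pow 2)) (continuous_integrable (hg.pow 2))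
    fun x => sq_le_sq.2 (h x)

/-- Composition with a smooth function, by induction on the order: `∂ᵢ(Ψ(v)) = Ψ'(v) ∂ᵢv`. -/
theorem Ctl.comp {i : Fin 3} {k : ℕ} (hk : 8 ≤ k) {K : ℝ} (hK : 0 ≤ K) (r : ℕ) (hr : r ≤ k) :
    ∀ Ψ : ℝ → ℝ, ContDiff ℝ ∞ Ψ → ∃ C, 0 ≤ C ∧ ∀ v, IsCk ∞ v → Ctl i k k K v →
      Ctl i k r C (fun x => Ψ (v x)) := by
  have h0 : ∀ Ψ : ℝ → ℝ, ContDiff ℝ ∞ Ψ → ∃ C, 0 ≤ C ∧ ∀ v, IsCk ∞ v → Ctl i k k K v →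
      ∀ x, |Ψ (v x)| ≤ C := by
    intro Ψ hΨ
    obtain ⟨C, hC0, hC⟩ := exists_bound_Icc hΨ.continuous K
    refine ⟨C, hC0, fun v hv hvc x => hC _ ?_⟩
    have := hvc.sup 0 (Nat.zero_le _) (by omega) x
    rwa [D_zero] at this
  induction r with
  | zero =>
    intro Ψ hΨ
    obtain ⟨C, hC0, hC⟩ := h0 Ψ hΨ
    refine ⟨C, hC0, fun v hv hvc => ⟨fun j hj _ x => ?_, fun j hj => ?_⟩⟩ <;>
    obtain rfl : j = 0 := by omega
    · rw [D_zero]; exact hC v hv hvc x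
    · rw [D_zero]; exact integral_sq_le_of_abs_le (hC v hv hvc)
  | succ r ih =>
    intro Ψ hΨ
    obtain ⟨C0, hC00, hC0⟩ := h0 Ψ hΨ
    obtain ⟨C1, hC10, hC1⟩ := ih (by omega) (deriv Ψ) (contDiff_deriv hΨ)
    have hpos : 0 ≤ 2 ^ k * C1 * K := by positivity
    refine ⟨C0 + 2 ^ k * C1 * K, by positivity, fun v hv hvc => ?_⟩
    have key := fun (j : ℕ) (hj : j ≤ r) => Ctl.mul_pd (l := j) hk (by omega) hC10 hK
      (hv.comp (contDiff_deriv hΨ)) hv ((hC1 v hv hvc).mono hj hC10 le_rfl) hvc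
    refine ⟨fun j hj h4 x => ?_, fun j hj => ?_⟩
    · rcases j with _ | j
      · rw [D_zero]; linarith [hC0 v hv hvc x]
      · rw [D_succ', pd_comp_infty hΨ hv]
        linarith [(key j (by omega)).1 h4 x]
    · rcases j with _ | j
      · rw [D_zero]
        refine (integral_sq_le_of_abs_le (hC0 v hv hvc)).trans ?_
        gcongr; linarith
      · rw [D_succ', pd_comp_infty hΨ hv]
        refine (key j (by omega)).2.trans ?_
        gcongr; linarith

/-- Composition with a smooth function is locally Lipschitz. -/
theorem Ctl.comp_sub {i : Fin 3} {k : ℕ} (hk : 8 ≤ k) {K : ℝ} (hK : 0 ≤ K) (r : ℕ) (hr : r ≤ k) :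
    ∀ Ψ : ℝ → ℝ, ContDiff ℝ ∞ Ψ → ∃ C, 0 ≤ C ∧ ∀ v w, IsCk ∞ v → IsCk ∞ w → Ctl i k k K v →
      Ctl i k k K w → ∀ δ, 0 ≤ δ → Ctl i k k δ (fun x => v x - w x) →
      Ctl i k r (C * δ) (fun x => Ψ (v x) - Ψ (w x)) := by
  have h0 : ∀ Ψ : ℝ → ℝ, ContDiff ℝ ∞ Ψ → ∃ C, 0 ≤ C ∧ ∀ v w, Ctl i k k K v →
      Ctl i k k K w → ∀ x, |Ψ (v x) - Ψ (w x)| ≤ C * |v x - w x| := by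
    intro Ψ hΨ
    obtain ⟨C, hC0, hC⟩ := exists_lip_Icc hΨ K
    refine ⟨C, hC0, fun v w hvc hwc x => hC _ _ ?_ ?_⟩
    · have := hvc.sup 0 (Nat.zero_le _) (by omega) x
      rwa [D_zero] at this
    · have := hwc.sup 0 (Nat.zero_le _) (by omega) x
      rwa [D_zero] at this
  -- the term of order zero, with an arbitrary larger constant
  have hz : ∀ Ψ : ℝ → ℝ, ContDiff ℝ ∞ Ψ → ∃ C, 0 ≤ C ∧ ∀ C', C ≤ C' → ∀ v w, IsCk ∞ v → IsCk ∞ w →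
      Ctl i k k K v → Ctl i k k K w → ∀ δ, 0 ≤ δ → Ctl i k k δ (fun x => v x - w x) →
      (∀ x, |Ψ (v x) - Ψ (w x)| ≤ C' * δ) ∧ ∫ x, (Ψ (v x) - Ψ (w x)) ^ 2 ≤ (C' * δ) ^ 2 := by
    intro Ψ hΨ
    obtain ⟨C, hC0, hC⟩ := h0 Ψ hΨ
    refine ⟨C, hC0, fun C' hC' v w hv hw hvc hwc δ hδ hz => ⟨fun x => ?_, ?_⟩⟩
    · have h1 := hz.sup 0 (Nat.zero_le _) (by omega) x
      rw [D_zero] at h1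
      refine (hC v w hvc hwc x).trans ?_
      have : 0 ≤ C' := hC0.trans hC'
      gcongr
    · have h1 := hz.l2 0 (Nat.zero_le _)
      rw [D_zero] at h1
      have hvw : Continuous fun x => v x - w x := hv.continuous.sub hw.continuous
      calc ∫ x, (Ψ (v x) - Ψ (w x)) ^ 2 ≤ ∫ x, (C * (v x - w x)) ^ 2 := by
            refine integral_sq_mono ?_ (continuous_const.mul hvw) fun x => ?_
            · exact (hΨ.continuous.comp hv.continuous).sub (hΨ.continuous.comp hw.continuous)
            · rw [abs_mul, abs_of_nonneg hC0]; exact hC v w hvc hwc x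
        _ = C ^ 2 * ∫ x, (v x - w x) ^ 2 := by
            rw [← integral_const_mul]; simp_rw [mul_pow]
        _ ≤ C ^ 2 * δ ^ 2 := by gcongr
        _ ≤ C' ^ 2 * δ ^ 2 := by gcongr
        _ = _ := by ring
  induction r with
  | zero =>
    intro Ψ hΨ
    obtain ⟨C, hC0, hC⟩ := hz Ψ hΨ
    refine ⟨C, hC0, fun v w hv hw hvc hwc δ hδ hd => ⟨fun j hj _ x => ?_, fun j hj => ?_⟩⟩ <;>
    obtain rfl : j = 0 := by omega
    · rw [D_zero]; exact (hC C le_rfl v w hv hw hvc hwc δ hδ hd).1 x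
    · rw [D_zero]; exact (hC C le_rfl v w hv hw hvc hwc δ hδ hd).2
  | succ r ih =>
    intro Ψ hΨ
    obtain ⟨C0, hC00, hC0⟩ := hz Ψ hΨ
    obtain ⟨C1, hC10, hC1⟩ := ih (by omega) (deriv Ψ) (contDiff_deriv hΨ)
    obtain ⟨C2, hC20, hC2⟩ := Ctl.comp hk hK r (by omega) (deriv Ψ) (contDiff_deriv hΨ) (i := i)
    have hpos : 0 ≤ 2 ^ k * C2 + 2 ^ k * C1 * K := by positivity
    refine ⟨C0 + 2 * (2 ^ k * C2 + 2 ^ k * C1 * K), by positivity,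
      fun v w hv hw hvc hwc δ hδ hd => ?_⟩
    have hz0 := hC0 (C0 + 2 * (2 ^ k * C2 + 2 ^ k * C1 * K)) (by linarith) v w hv hw hvc hwc δ hδ hd
    have hdv := hv.comp (contDiff_deriv hΨ)
    have hdw := hw.comp (contDiff_deriv hΨ)
    have hvw := hv.sub hw
    have h1 := fun (j : ℕ) (hj : j ≤ r) => Ctl.mul_pd (l := j) hk (by omega) hC20 hδ
      hdv hvw ((hC2 v hv hvc).mono hj hC20 le_rfl) hd
    have h2 := fun (j : ℕ) (hj : j ≤ r) => Ctl.mul_pd (l := j) hk (by omega)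
      (mul_nonneg hC10 hδ) hK (hdv.sub hdw) hw
      ((hC1 v w hv hw hvc hwc δ hδ hd).mono hj (mul_nonneg hC10 hδ) le_rfl) hwc
    have hpd : pd i (fun x => Ψ (v x) - Ψ (w x)) = fun x => deriv Ψ (v x) * pd i (fun x => v x - w x) x
        + (deriv Ψ (v x) - deriv Ψ (w x)) * pd i w x := by
      have e1 := fun x => D_sub (l := 1) ((hv.comp hΨ).nat 1) ((hw.comp hΨ).nat 1) i x
      have e2 := fun x => D_sub (l := 1) (hv.nat 1) (hw.nat 1) i x
      simp_rw [D_one] at e1 e2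
      funext x
      rw [e1, e2, pd_comp_infty hΨ hv, pd_comp_infty hΨ hw]
      ring
    have hC1f := hdv.mul (hvw.pd i)
    have hC2f := (hdv.sub hdw).mul (hw.pd i)
    have hD : ∀ j x, D i (j + 1) (fun x => Ψ (v x) - Ψ (w x)) x
        = D i j (fun x => deriv Ψ (v x) * pd i (fun x => v x - w x) x) x
          + D i j (fun x => (deriv Ψ (v x) - deriv Ψ (w x)) * pd i w x) x := fun j x => by
      rw [D_succ', hpd, D_add (hC1f.nat j) (hC2f.nat j)]
    refine ⟨fun j hj h4 x => ?_, fun j hj => ?_⟩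
    · rcases j with _ | j
      · rw [D_zero]; exact hz0.1 x
      · rw [hD]
        have e1 := (h1 j (by omega)).1 h4 x
        have e2 := (h2 j (by omega)).1 h4 x
        refine (abs_add_le _ _).trans ((add_le_add e1 e2).trans ?_)
        have : 0 ≤ (C0 + (2 ^ k * C2 + 2 ^ k * C1 * K)) * δ := by positivity
        linarith
    · rcases j with _ | j
      · rw [D_zero]; exact hz0.2
      · simp_rw [hD]
        have e1 := (h1 j (by omega)).2
        have e2 := (h2 j (by omega)).2
        have c1 : Continuous _ := (hC1f.D (j := j) i).continuous
        have c2 : Continuous _ := (hC2f.D (j := j) i).continuous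
        refine (integral_sq_add_le c1 c2 (B := (2 ^ k * C2 + 2 ^ k * C1 * K) * δ) ?_ ?_).trans ?_
        · refine e1.trans ?_
          apply pow_le_pow_left₀ (by positivity)
          have : 0 ≤ 2 ^ k * C1 * K * δ := by positivity
          linarith
        · refine e2.trans ?_
          apply pow_le_pow_left₀ (by positivity)
          have : 0 ≤ 2 ^ k * C2 * δ := by positivity
          linarith
        · apply pow_le_pow_left₀ (by positivity)
          have : 0 ≤ C0 * δ := by positivity
          linarith

/-- The derivative of order `k + 1` of `Ψ(v)` is `Ψ'(v) ∂ᵢ^(k+1) v` up to terms that are controlled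
by the derivatives of order at most `k`. -/
theorem Ctl.top_order {i : Fin 3} {k : ℕ} (hk : 8 ≤ k) {K : ℝ} (hK : 0 ≤ K) {Ψ : ℝ → ℝ}
    (hΨ : ContDiff ℝ ∞ Ψ) : ∃ C, 0 ≤ C ∧ ∀ v, IsCk ∞ v → Ctl i k k K v →
      ∫ x, (D i (k + 1) (fun x => Ψ (v x)) x - deriv Ψ (v x) * D i (k + 1) v x) ^ 2 ≤ C ^ 2 := by
  obtain ⟨C1, hC10, hC1⟩ := Ctl.comp hk hK k le_rfl (deriv Ψ) (contDiff_deriv hΨ) (i := i)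
  refine ⟨2 ^ k * (C1 * K), by positivity, fun v hv hvc => ?_⟩
  have hdv := hv.comp (contDiff_deriv hΨ)
  have h1 : ∀ x, D i (k + 1) (fun x => Ψ (v x)) x - deriv Ψ (v x) * D i (k + 1) v x
      = ∑ a ∈ Finset.range k, (k.choose (a + 1) : ℝ) *
        (D i (a + 1) (fun x => deriv Ψ (v x)) x * D i (k - (a + 1)) (pd i v) x) := fun x => by
    rw [D_succ', pd_comp_infty hΨ hv, D_mul (hdv.nat k) ((hv.pd i).nat k),
      Finset.sum_range_succ', D_zero, Nat.choose_zero_right, D_succ' i k v]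
    simp [mul_assoc]
  simp_rw [h1]
  refine (integral_sq_sum_le _ _ (fun a _ => Nat.cast_nonneg _)
    (fun a x => D i (a + 1) (fun x => deriv Ψ (v x)) x * D i (k - (a + 1)) (pd i v) x)
    (fun a ha => ?_) (B := C1 * K) fun a ha => ?_).trans ?_
  · exact (hdv.D i).continuous.mul ((hv.pd i).D i).continuous
  · rw [Finset.mem_range] at ha
    refine integral_sq_leibniz_term (p := 1) hk le_rfl (by omega) le_rfl (hdv.nat k)
      ((hv.pd i).nat k) (hC1 v hv hvc) (fun h4 x => ?_) ?_
    · rw [← D_succ']; exact hvc.sup _ (by omega) (by omega) x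
    · rw [← D_succ']; exact hvc.l2 _ (by omega)
  · have hsum : ∑ a ∈ Finset.range k, (k.choose (a + 1) : ℝ) ≤ 2 ^ k := by
      have : ∑ a ∈ Finset.range (k + 1), (k.choose a : ℝ) = 2 ^ k := by
        exact_mod_cast Nat.sum_range_choose k
      rw [Finset.sum_range_succ'] at this
      simp at this
      linarith
    have : 0 ≤ ∑ a ∈ Finset.range k, (k.choose (a + 1) : ℝ) :=
      Finset.sum_nonneg fun _ _ => Nat.cast_nonneg _
    gcongr

/-! ### Truncated Fourier series and rough functions -/

/-- The real trigonometric polynomial `Re ∑_{n ∈ s} c_n e_n`. -/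
noncomputable def trig (s : Finset (Fin 3 → ℤ)) (c : (Fin 3 → ℤ) → ℂ) : T3 → ℝ := fun x =>
  ∑ n ∈ s, mode n (c n) x

/-- The cube of frequencies with `|nᵢ| ≤ N`. -/
noncomputable def box (N : ℕ) : Finset (Fin 3 → ℤ) := Fintype.piFinset fun _ => Finset.Icc (-(N : ℤ)) N

theorem mem_box {N : ℕ} {n : Fin 3 → ℤ} : n ∈ box N ↔ ∀ i, |n i| ≤ N := by
  simp [box, Fintype.mem_piFinset, abs_le]

theorem neg_mem_box {N : ℕ} {n : Fin 3 → ℤ} : -n ∈ box N ↔ n ∈ box N := by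
  simp [mem_box]

theorem box_mono {M N : ℕ} (h : M ≤ N) : box M ⊆ box N := fun n hn => by
  rw [mem_box] at hn ⊢
  exact fun i => (hn i).trans (by exact_mod_cast h)

theorem exists_mem_box (n : Fin 3 → ℤ) : ∃ N, n ∈ box N := by
  refine ⟨∑ i, (n i).natAbs, mem_box.2 fun i => ?_⟩
  have := Finset.single_le_sum (f := fun i => (n i).natAbs) (fun _ _ => Nat.zero_le _)
    (Finset.mem_univ i)
  rw [Int.abs_eq_natAbs]
  exact_mod_cast this

theorem tendsto_box : Tendsto box atTop atTop :=
  tendsto_atTop_finset_of_monotone (fun _ _ h => box_mono h) exists_mem_box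

theorem isCk_trig (s : Finset (Fin 3 → ℤ)) (c : (Fin 3 → ℤ) → ℂ) : IsCk ∞ (trig s c) := by
  have : lift (trig s c) = fun y => ∑ n ∈ s, lift (mode n (c n)) y := rfl
  unfold IsCk
  rw [this]
  exact ContDiff.sum fun n _ => isCk_mode n (c n)

theorem fc_mode (m n : Fin 3 → ℤ) (z : ℂ) :
    fc (mode m z) n = ((if n = m then z else 0) + (if n = -m then conj z else 0)) / 2 := by
  have h1 : ∀ x, mFourier (-n) x * ((mode m z x : ℝ) : ℂ)
      = (z / 2) * (mFourier (-n) x * mFourier m x)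
        + (conj z / 2) * (mFourier (-n) x * mFourier (-m) x) := by
    intro x
    rw [mode, Complex.re_eq_add_conj, map_mul, ← mFourier_neg]
    ring
  have hi : ∀ (a : ℂ) (p q : Fin 3 → ℤ), Integrable fun x : T3 =>
      a * (mFourier p x * mFourier q x) := fun a p q =>
    continuous_integrable (continuous_const.mul
      ((mFourier p).continuous.mul (mFourier q).continuous))
  unfold fc
  simp_rw [h1]
  rw [integral_add (hi _ _ _) (hi _ _ _), integral_const_mul, integral_const_mul,
    integral_mFourier_mul, integral_mFourier_mul]
  split_ifs <;> ring

theorem fc_trig {s : Finset (Fin 3 → ℤ)} {c : (Fin 3 → ℤ) → ℂ} (hs : ∀ n, -n ∈ s ↔ n ∈ s)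
    (hc : ∀ n, conj (c n) = c (-n)) (n : Fin 3 → ℤ) :
    fc (trig s c) n = if n ∈ s then c n else 0 := by
  have h1 : fc (trig s c) n = ∑ m ∈ s, fc (mode m (c m)) n :=
    fc_sum s (fun m _ => continuous_integrable (isCk_mode m (c m)).continuous) n
  have h2 : ∀ m, n = -m ↔ -n = m := fun m => by constructor <;> (rintro rfl; simp)
  rw [h1]
  simp_rw [fc_mode, h2]
  rw [← Finset.sum_div, Finset.sum_add_distrib, Finset.sum_ite_eq, Finset.sum_ite_eq, hc,
    neg_neg]
  simp only [hs]
  split_ifs <;> ring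

/-- The Fourier truncation of `v`. -/
noncomputable def trunc (N : ℕ) (v : T3 → ℝ) : T3 → ℝ := trig (box N) (fc v)

theorem isCk_trunc (N : ℕ) (v : T3 → ℝ) : IsCk ∞ (trunc N v) := isCk_trig _ _

theorem fc_trunc (N : ℕ) (v : T3 → ℝ) (n : Fin 3 → ℤ) :
    fc (trunc N v) n = if n ∈ box N then fc v n else 0 :=
  fc_trig (fun _ => neg_mem_box) (conj_fc v) n

theorem HB.trunc {k : ℕ} {v : T3 → ℝ} {R : ℝ} (h : HB k v R) (N : ℕ) : HB k (trunc N v) R := by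
  intro s
  refine le_trans (Finset.sum_le_sum fun n _ => ?_) (h s)
  have := W_pos k n
  rw [fc_trunc]
  split_ifs
  · exact le_rfl
  · simp; positivity

theorem HB.summable_sz {k j : ℕ} (hjk : j + 4 ≤ k) {v : T3 → ℝ} {R : ℝ} (h : HB k v R) :
    Summable fun n => sz n ^ j * ‖fc v n‖ := by
  have h1 : HB k v (√R ^ 2) := by rwa [Real.sq_sqrt h.nonneg]
  exact Summable.of_nonneg_of_le
    (fun n => mul_nonneg (pow_nonneg (sz_pos n).le _) (norm_nonneg _))
    (fun n => sz_pow_mul_norm_le hjk (Real.sqrt_nonneg R) (h1.single n))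
    (EquilibriumLimit.summable_sz.mul_left _)

theorem HB.tsum_le {k j : ℕ} (hjk : j + 4 ≤ k) {v : T3 → ℝ} {K : ℝ} (hK : 0 ≤ K)
    (h : HB k v (K ^ 2)) : ∑' n, sz n ^ j * ‖fc v n‖ ≤ 4 ^ k * K * CS := by
  rw [CS, ← tsum_mul_left]
  exact (h.summable_sz hjk).tsum_le_tsum (fun n => sz_pow_mul_norm_le hjk hK (h.single n))
    (EquilibriumLimit.summable_sz.mul_left _)

theorem HB.summable {k : ℕ} (hk : 4 ≤ k) {v : T3 → ℝ} {R : ℝ} (h : HB k v R) :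
    Summable fun n => ‖fc v n‖ := by
  simpa using h.summable_sz (j := 0) (by omega)

theorem HB.abs_le {k : ℕ} (hk : 4 ≤ k) {v : T3 → ℝ} (hv : Continuous v) {K : ℝ} (hK : 0 ≤ K)
    (h : HB k v (K ^ 2)) (x : T3) : |v x| ≤ 4 ^ k * K * CS := by
  have := h.tsum_le (j := 0) (by omega) hK
  simp only [pow_zero, one_mul] at this
  exact (abs_le_tsum_fc hv (h.summable hk) x).trans this

theorem abs_mode_le (n : Fin 3 → ℤ) (z : ℂ) (x : T3) : |mode n z x| ≤ ‖z‖ := by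
  refine (Complex.abs_re_le_norm _).trans ?_
  rw [norm_mul, norm_mFourier_apply, mul_one]

theorem hasSum_mode {v : T3 → ℝ} (hv : Continuous v) (h : Summable fun n => ‖fc v n‖) (x : T3) :
    HasSum (fun n => mode n (fc v n) x) (v x) := by
  have := Complex.hasSum_re (hasSum_fc_apply hv h.of_norm x)
  simpa [mode] using this

theorem tendsto_trunc {v : T3 → ℝ} (hv : Continuous v) (h : Summable fun n => ‖fc v n‖) (x : T3) :
    Tendsto (fun N => trunc N v x) atTop (𝓝 (v x)) :=
  (hasSum_mode hv h x).comp tendsto_box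

theorem abs_trunc_le {v : T3 → ℝ} (h : Summable fun n => ‖fc v n‖) (N : ℕ) (x : T3) :
    |trunc N v x| ≤ ∑' n, ‖fc v n‖ :=
  (Finset.abs_sum_le_sum_abs _ _).trans ((Finset.sum_le_sum fun n _ => abs_mode_le n _ x).trans
    (h.sum_le_tsum _ fun _ _ => norm_nonneg _))

theorem tendsto_fc {f : ℕ → T3 → ℝ} {g : T3 → ℝ} {C : ℝ} (hf : ∀ N, Continuous (f N))
    (hC : ∀ N x, |f N x| ≤ C) (h : ∀ x, Tendsto (fun N => f N x) atTop (𝓝 (g x)))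
    (n : Fin 3 → ℤ) : Tendsto (fun N => fc (f N) n) atTop (𝓝 (fc g n)) := by
  refine tendsto_integral_of_dominated_convergence (fun _ => C) (fun N => ?_) (integrable_const C)
    (fun N => Eventually.of_forall fun x => ?_) (Eventually.of_forall fun x => ?_)
  · exact ((integrable_mFourier_mul (continuous_integrable (hf N)) (-n))).aestronglyMeasurable
  · rw [norm_mul, norm_mFourier_apply, one_mul, Complex.norm_real]; exact hC N x
  · exact ((Complex.continuous_ofReal.tendsto _).comp (h x)).const_mul _

theorem HB_of_tendsto {k : ℕ} {f : ℕ → T3 → ℝ} {g : T3 → ℝ} {R : ℝ} (hf : ∀ N, HB k (f N) R)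
    (h : ∀ n, Tendsto (fun N => fc (f N) n) atTop (𝓝 (fc g n))) : HB k g R := by
  intro s
  exact le_of_tendsto (tendsto_finsetSum s fun n _ => (((h n).norm).pow 2).const_mul _)
    (Eventually.of_forall fun N => hf N s)

/-- Composition with a smooth function maps bounded sets of `H^k` to bounded sets. -/
theorem HB_comp {k : ℕ} (hk : 8 ≤ k) {Ψ : ℝ → ℝ} (hΨ : ContDiff ℝ ∞ Ψ) {K : ℝ} (hK : 0 ≤ K) :
    ∃ C, 0 ≤ C ∧ ∀ v, Continuous v → HB k v (K ^ 2) → HB k (fun x => Ψ (v x)) (C ^ 2) := by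
  have hCS := CS_nonneg
  have hK' : 0 ≤ (1 + 4 ^ k * CS) * K := by positivity
  choose C hC0 hC using fun i => Ctl.comp (i := i) hk hK' k le_rfl Ψ hΨ
  refine ⟨2 * ∑ i, C i, by have := Finset.sum_nonneg fun i (_ : i ∈ Finset.univ) => hC0 i; positivity,
    fun v hv h => ?_⟩
  have hs := h.summable (by omega)
  obtain ⟨B, hB0, hB⟩ := exists_bound_Icc hΨ.continuous (∑' n, ‖fc v n‖)
  refine HB_of_tendsto (f := fun N x => Ψ (trunc N v x)) (fun N => ?_)
    (tendsto_fc (fun N => hΨ.continuous.comp (isCk_trunc N v).continuous)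
      (fun N x => hB _ (abs_trunc_le hs N x))
      fun x => (hΨ.continuous.tendsto _).comp (tendsto_trunc hv hs x))
  have hN := isCk_trunc N v
  have h1 := Ctl.hb (K := ∑ i, C i) ((hN.comp hΨ).nat k) fun i =>
    (hC i _ hN ((h.trunc N).ctl hK (hN.nat k) i)).mono le_rfl (hC0 i)
      (Finset.single_le_sum (f := C) (fun i _ => hC0 i) (Finset.mem_univ i))
  exact h1.mono (by ring_nf; exact le_rfl)

/-- Composition with a smooth function is Lipschitz on bounded sets of `H^k`. -/
theorem HB_comp_sub {k : ℕ} (hk : 8 ≤ k) {Ψ : ℝ → ℝ} (hΨ : ContDiff ℝ ∞ Ψ) {K : ℝ} (hK : 0 ≤ K) :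
    ∃ C, 0 ≤ C ∧ ∀ v w, Continuous v → Continuous w → HB k v (K ^ 2) → HB k w (K ^ 2) →
      ∀ δ, 0 ≤ δ → HB k (fun x => v x - w x) (δ ^ 2) →
      HB k (fun x => Ψ (v x) - Ψ (w x)) ((C * δ) ^ 2) := by
  have hCS := CS_nonneg
  have hK' : 0 ≤ (1 + 4 ^ k * CS) * K := by positivity
  choose C hC0 hC using fun i => Ctl.comp_sub (i := i) hk hK' k le_rfl Ψ hΨ
  have hsum : 0 ≤ ∑ i, C i := Finset.sum_nonneg fun i _ => hC0 i
  refine ⟨2 * (∑ i, C i) * (1 + 4 ^ k * CS), by positivity, fun v w hv hw h1 h2 δ hδ hd => ?_⟩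
  have hs1 := h1.summable (by omega)
  have hs2 := h2.summable (by omega)
  obtain ⟨B, hB0, hB⟩ := exists_bound_Icc hΨ.continuous (max (∑' n, ‖fc v n‖) (∑' n, ‖fc w n‖))
  refine HB_of_tendsto (f := fun N x => Ψ (trunc N v x) - Ψ (trunc N w x)) (fun N => ?_)
    (tendsto_fc (C := 2 * B) (fun N => (hΨ.continuous.comp (isCk_trunc N v).continuous).sub
        (hΨ.continuous.comp (isCk_trunc N w).continuous))
      (fun N x => ?_)
      fun x => ((hΨ.continuous.tendsto _).comp (tendsto_trunc hv hs1 x)).sub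
        ((hΨ.continuous.tendsto _).comp (tendsto_trunc hw hs2 x)))
  · have hN := isCk_trunc N v
    have hM := isCk_trunc N w
    have hd' : HB k (fun x => trunc N v x - trunc N w x) (δ ^ 2) := by
      intro s
      refine le_trans (Finset.sum_le_sum fun n _ => ?_) (hd s)
      have := W_pos k n
      rw [fc_sub (continuous_integrable hN.continuous) (continuous_integrable hM.continuous),
        fc_sub (continuous_integrable hv) (continuous_integrable hw), fc_trunc, fc_trunc]
      split_ifs
      · exact le_rfl
      · simp; positivity
    have h3 := Ctl.hb (K := (∑ i, C i) * ((1 + 4 ^ k * CS) * δ))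
      (((hN.comp hΨ).sub (hM.comp hΨ)).nat k) fun i =>
        (hC i _ _ hN hM ((h1.trunc N).ctl hK (hN.nat k) i) ((h2.trunc N).ctl hK (hM.nat k) i)
          _ (by positivity) (hd'.ctl hδ ((hN.sub hM).nat k) i)).mono le_rfl
          (mul_nonneg (hC0 i) (by positivity)) (by
            gcongr
            exact Finset.single_le_sum (f := C) (fun i _ => hC0 i) (Finset.mem_univ i))
    exact h3.mono (le_of_eq (by ring))
  · have e1 := hB _ ((abs_trunc_le hs1 N x).trans (le_max_left _ _))
    have e2 := hB _ ((abs_trunc_le hs2 N x).trans (le_max_right _ _))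
    refine (abs_sub _ _).trans ?_
    linarith

/-- Multiplication by a function with controlled derivatives is bounded on `H^k`. -/
theorem HB_mul {k : ℕ} (hk : 8 ≤ k) {f v : T3 → ℝ} {L K : ℝ} (hL : 0 ≤ L) (hK : 0 ≤ K)
    (hf : IsCk k f) (hfc : ∀ i, Ctl i k k L f) (hv : Continuous v) (h : HB k v (K ^ 2)) :
    HB k (fun x => f x * v x) ((2 * (2 ^ k * L * ((1 + 4 ^ k * CS) * K))) ^ 2) := by
  have hCS := CS_nonneg
  have hs := h.summable (by omega)
  obtain ⟨B, hB⟩ := exists_abs_le hf.continuous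
  refine HB_of_tendsto (f := fun N x => f x * trunc N v x) (fun N => ?_)
    (tendsto_fc (C := B * ∑' n, ‖fc v n‖) (fun N => hf.continuous.mul (isCk_trunc N v).continuous)
      (fun N x => ?_) fun x => (tendsto_trunc hv hs x).const_mul _)
  · have hN := isCk_trunc N v
    have h1 := Ctl.hb (hf.mul (hN.nat k)) fun i =>
      (hfc i).mul hk hL (by positivity) hf (hN.nat k) ((h.trunc N).ctl hK (hN.nat k) i)
    exact h1.mono (le_of_eq (by ring))
  · rw [abs_mul]
    exact mul_le_mul (hB x) (abs_trunc_le hs N x) (abs_nonneg _) ((abs_nonneg _).trans (hB x))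

theorem iteratedDeriv_re_exp (z : ℂ) (j : ℕ) (s : ℝ) :
    iteratedDeriv j (fun s : ℝ => (z * Complex.exp (Complex.I * s)).re) s
      = (Complex.I ^ j * z * Complex.exp (Complex.I * s)).re := by
  induction j generalizing s with
  | zero => simp
  | succ j ih =>
    rw [iteratedDeriv_succ, funext ih]
    have h1 : HasDerivAt (fun s : ℝ => Complex.I ^ j * z * Complex.exp (Complex.I * s))
        (Complex.I ^ j * z * (Complex.exp (Complex.I * s) * (Complex.I * 1))) s :=
      ((Complex.ofRealCLM.hasDerivAt.const_mul Complex.I).cexp).const_mul _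
    have h2 := (Complex.reCLM.hasFDerivAt.comp_hasDerivAt s h1).deriv
    simp only [Function.comp_def, Complex.reCLM_apply] at h2
    rw [h2]
    congr 1; ring

theorem norm_iteratedFDeriv_mode_le (n : Fin 3 → ℤ) (z : ℂ) (j : ℕ) (y : Fin 3 → ℝ) :
    ‖iteratedFDeriv ℝ j (lift (mode n z)) y‖ ≤ sz n ^ j * ‖z‖ := by
  let L : (Fin 3 → ℝ) →L[ℝ] ℝ := ∑ i, freq n i • ContinuousLinearMap.proj (R := ℝ) i
  have hLy : ∀ y, L y = ∑ i, freq n i * y i := fun y => by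
    simp [L]
  have hL : ‖L‖ ≤ sz n := by
    refine ContinuousLinearMap.opNorm_le_bound _ (sz_pos n).le fun y => ?_
    rw [hLy]
    calc ‖∑ i, freq n i * y i‖ ≤ ∑ i, |freq n i| * ‖y‖ :=
          (norm_sum_le _ _).trans (Finset.sum_le_sum fun i _ => by
            rw [norm_mul]; exact mul_le_mul_of_nonneg_left (norm_le_pi_norm y i) (norm_nonneg _))
      _ ≤ sz n * ‖y‖ := by
          rw [← Finset.sum_mul]
          unfold sz
          gcongr
          linarith
  have h1 : lift (mode n z) = (fun s : ℝ => (z * Complex.exp (Complex.I * s)).re) ∘ L := by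
    funext y
    simp only [lift, mode, Function.comp, mFourier_proj, hLy]
  have h2 : ContDiff ℝ ∞ (fun s : ℝ => (z * Complex.exp (Complex.I * s)).re) :=
    Complex.reCLM.contDiff.comp (contDiff_const.mul
      (contDiff_const.mul Complex.ofRealCLM.contDiff).cexp)
  rw [h1, L.iteratedFDeriv_comp_right h2 y (i := j) (by exact_mod_cast le_top)]
  refine (ContinuousMultilinearMap.norm_compContinuousLinearMap_le _ _).trans ?_
  rw [norm_iteratedFDeriv_eq_norm_iteratedDeriv, iteratedDeriv_re_exp, mul_comm, Finset.prod_const,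
    Finset.card_univ, Fintype.card_fin]
  have h3 : ‖(Complex.I ^ j * z * Complex.exp (Complex.I * (L y : ℝ))).re‖ ≤ ‖z‖ := by
    refine (Complex.abs_re_le_norm _).trans (le_of_eq ?_)
    rw [norm_mul, norm_mul, norm_pow, Complex.norm_I, one_pow, one_mul, mul_comm Complex.I,
      Complex.norm_exp_ofReal_mul_I, mul_one]
  have := sz_pos n
  gcongr

/-- Sobolev embedding: the continuous representative of an `H^k` function is of class `C^j`. -/
theorem HB.isCk {k j : ℕ} (hjk : j + 4 ≤ k) {v : T3 → ℝ} (hv : Continuous v) {R : ℝ}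
    (h : HB k v R) : IsCk j v := by
  have hs := h.summable (by omega)
  have h1 : lift v = fun y => ∑' n, lift (mode n (fc v n)) y :=
    funext fun y => ((hasSum_mode hv hs (proj y)).tsum_eq).symm
  unfold IsCk
  rw [h1]
  refine contDiff_tsum (𝕜 := ℝ) (N := (j : ℕ∞)) (v := fun l n => sz n ^ l * ‖fc v n‖)
    (fun n => (isCk_mode n (fc v n)).mono (by exact_mod_cast le_top)) (fun l hl => ?_)
    fun l n y _ => norm_iteratedFDeriv_mode_le n _ l y
  have hl' : l ≤ j := by exact_mod_cast hl
  exact h.summable_sz (by omega)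

/-! ### Sobolev spaces in terms of Fourier coefficients -/

/-- The Fourier multiplier of `D^α`. -/
noncomputable def mult (α : Fin 3 → ℕ) (n : Fin 3 → ℤ) : ℂ := ∏ i, (Complex.I * freq n i) ^ α i

theorem pdIter_eq (α : Fin 3 → ℕ) (g : T3 → ℝ) :
    pdIter α g = D 0 (α 0) (D 1 (α 1) (D 2 (α 2) g)) := by
  simp_rw [D_eq_iterate]; rfl

theorem pdIter_mode (α : Fin 3 → ℕ) (n : Fin 3 → ℤ) (z : ℂ) :
    pdIter α (mode n z) = mode n (mult α n * z) := by
  rw [pdIter_eq, D_mode, D_mode, D_mode, mult, Fin.prod_univ_three]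
  congr 1; ring

theorem mult_neg (α : Fin 3 → ℕ) (n : Fin 3 → ℤ) :
    mult α (-n) = (-1) ^ (∑ i, α i) * mult α n := by
  simp only [mult, Fin.prod_univ_three, Fin.sum_univ_three, freq_neg, Complex.ofReal_neg, mul_neg,
    pow_add]
  rw [neg_pow, neg_pow (Complex.I * freq n 1), neg_pow (Complex.I * freq n 2)]
  ring

theorem norm_mult_sq_le {k : ℕ} {α : Fin 3 → ℕ} (hα : ∑ i, α i ≤ k) (n : Fin 3 → ℤ) :
    ‖mult α n‖ ^ 2 ≤ W k n := by
  obtain ⟨i, -, hi⟩ := Finset.exists_max_image Finset.univ (fun i => |freq n i|) ⟨0, by simp⟩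
  have h1 : ‖mult α n‖ = ∏ j, |freq n j| ^ α j := by
    simp [mult, norm_prod]
  have h2 : ‖mult α n‖ ≤ |freq n i| ^ (∑ j, α j) := by
    rw [h1, ← Finset.prod_pow_eq_pow_sum]
    exact Finset.prod_le_prod (fun _ _ => by positivity) fun j hj =>
      pow_le_pow_left₀ (abs_nonneg _) (hi j hj) _
  calc ‖mult α n‖ ^ 2 ≤ (|freq n i| ^ (∑ j, α j)) ^ 2 := by gcongr
    _ = freq n i ^ (2 * ∑ j, α j) := by
        rw [← pow_mul, mul_comm, pow_mul, sq_abs, ← pow_mul]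
    _ ≤ W k n := freq_pow_le_W hα n i

theorem integrable_Lp (f : Lp ℝ 2 (volume : Measure T3)) : Integrable (f : T3 → ℝ) :=
  (Lp.memLp f).integrable (by norm_num)

theorem fc_weakDeriv {α : Fin 3 → ℕ} {f g : Lp ℝ 2 (volume : Measure T3)} (h : IsWeakDeriv α f g)
    (n : Fin 3 → ℤ) : fc g n = mult α n * fc f n := by
  refine eq_of_re_mul fun z => ?_
  have h1 := h (mode (-n) z) (isCk_mode _ _)
  rw [pdIter_mode, re_mul_fc (integrable_Lp f), re_mul_fc (integrable_Lp g), mult_neg] at h1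
  have h2 : ((-1 : ℂ) ^ (∑ i, α i) * mult α n * z * fc f n).re
      = (-1 : ℝ) ^ (∑ i, α i) * (z * (mult α n * fc f n)).re := by
    rw [← Complex.re_ofReal_mul]
    congr 1; push_cast; ring
  rw [h2] at h1
  exact (mul_left_cancel₀ (pow_ne_zero _ (by norm_num)) h1).symm

theorem norm_sq_Lp (f : Lp ℝ 2 (volume : Measure T3)) : ‖f‖ ^ 2 = ∫ x, f x ^ 2 := by
  have h := L2.inner_def (𝕜 := ℝ) f f
  rw [real_inner_self_eq_norm_sq] at h
  rw [h]
  exact integral_congr_ae (Eventually.of_forall fun x => by simp [sq])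

/-- The multi-index of the pure derivative `∂ᵢ^k`. -/
def MultiIdx.pure (k : ℕ) (i : Fin 3) : MultiIdx k :=
  ⟨fun l => if l = i then Fin.last k else 0, by
    rw [Finset.sum_eq_single i] <;> simp +contextual⟩

theorem norm_sq_component_le {k : ℕ} (w : Sob k) (α : MultiIdx k) : ‖w.1 α‖ ^ 2 ≤ ‖w‖ ^ 2 := by
  have h : ‖w‖ = ‖w.1‖ := rfl
  rw [h, PiLp.norm_sq_eq_of_L2]
  exact Finset.single_le_sum (f := fun α => ‖w.1 α‖ ^ 2) (fun _ _ => sq_nonneg _)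
    (Finset.mem_univ α)

/-- The Fourier norm is bounded by the norm defined by weak derivatives; the factor `4` counts the
four terms of `W k`, each of which belongs to one component of `w`. -/
theorem HB_toL2 {k : ℕ} (w : Sob k) : HB k (toL2 w) (4 * ‖w‖ ^ 2) := by
  intro s
  have h0 : ∀ α : MultiIdx k, ∑ n ∈ s, ‖mult (fun i => (α.1 i : ℕ)) n‖ ^ 2 * ‖fc (toL2 w) n‖ ^ 2
      ≤ ‖w‖ ^ 2 := by
    intro α
    refine le_trans ?_ (norm_sq_component_le w α)
    rw [norm_sq_Lp]
    refine le_trans (le_of_eq ?_) (sum_sq_fc_le (Lp.memLp (w.1 α)) s)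
    refine Finset.sum_congr rfl fun n _ => ?_
    rw [fc_weakDeriv (w.2 α), norm_mul, mul_pow]
    rfl
  have h1 : ∀ i n, ‖mult (fun l => ((MultiIdx.pure k i).1 l : ℕ)) n‖ ^ 2 = freq n i ^ (2 * k) := by
    intro i n
    have : mult (fun l => ((MultiIdx.pure k i).1 l : ℕ)) n = (Complex.I * freq n i) ^ k := by
      rw [mult, Finset.prod_eq_single i] <;> simp +contextual [MultiIdx.pure]
    rw [this, norm_pow, norm_mul, Complex.norm_I, one_mul, Complex.norm_real, Real.norm_eq_abs,
      ← pow_mul, mul_comm k, pow_mul, sq_abs, ← pow_mul]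
  have h2 := h0 (MultiIdx.zero k)
  have h3 := fun i => h0 (MultiIdx.pure k i)
  simp_rw [h1] at h3
  have h4 : ∀ n, mult (fun l => ((MultiIdx.zero k).1 l : ℕ)) n = 1 := fun n => by
    simp [mult, MultiIdx.zero]
  simp_rw [h4] at h2
  have h5 : ∑ n ∈ s, W k n * ‖fc (toL2 w) n‖ ^ 2 = ∑ n ∈ s, ‖(1 : ℂ)‖ ^ 2 * ‖fc (toL2 w) n‖ ^ 2
      + ∑ i, ∑ n ∈ s, freq n i ^ (2 * k) * ‖fc (toL2 w) n‖ ^ 2 := by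
    rw [Finset.sum_comm, ← Finset.sum_add_distrib]
    refine Finset.sum_congr rfl fun n _ => ?_
    rw [W, add_mul, Finset.sum_mul]; simp
  rw [h5, Fin.sum_univ_three]
  linarith [h3 0, h3 1, h3 2]

theorem integral_mode_mul_D (n : Fin 3 → ℤ) (i : Fin 3) (j : ℕ) {φ : T3 → ℝ} (hφ : IsCk ∞ φ)
    (z : ℂ) : ∫ x, mode n z x * D i j φ x
      = (-1) ^ j * ∫ x, mode n ((Complex.I * freq n i) ^ j * z) x * φ x := by
  induction j generalizing z with
  | zero => simp [D_zero]
  | succ j ih =>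
    rw [D_succ, integral_mul_pd ((isCk_mode n z).mono (by exact_mod_cast le_top))
      ((hφ.D i).mono (by exact_mod_cast le_top)), pd_mode, ih, pow_succ, pow_succ]
    simp only [mul_assoc]
    ring

theorem integral_mode_mul_pdIter (n : Fin 3 → ℤ) (α : Fin 3 → ℕ) {φ : T3 → ℝ} (hφ : IsCk ∞ φ)
    (z : ℂ) : ∫ x, mode n z x * pdIter α φ x
      = (-1) ^ (∑ i, α i) * ∫ x, mode n (mult α n * z) x * φ x := by
  rw [pdIter_eq, integral_mode_mul_D n 0 _ ((hφ.D 2).D 1), integral_mode_mul_D n 1 _ (hφ.D 2),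
    integral_mode_mul_D n 2 _ hφ, mult, Fin.prod_univ_three, Fin.sum_univ_three, pow_add, pow_add]
  rw [show ∀ a b c : ℂ, c * (b * (a * z)) = a * b * c * z by intros; ring]
  ring

/-- A real Fourier mode as an element of `L²`. -/
noncomputable def modeLp (n : Fin 3 → ℤ) (z : ℂ) : Lp ℝ 2 (volume : Measure T3) :=
  ContinuousMap.toLp 2 volume ℝ ⟨mode n z, (isCk_mode n z).continuous⟩

theorem coeFn_modeLp (n : Fin 3 → ℤ) (z : ℂ) : modeLp n z =ᵐ[volume] mode n z :=
  ContinuousMap.coeFn_toLp (𝕜 := ℝ) volume _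

/-- A real Fourier mode as an element of `H^k`. -/
noncomputable def modeSob (k : ℕ) (n : Fin 3 → ℤ) (z : ℂ) : Sob k :=
  ⟨WithLp.toLp 2 fun α => modeLp n (mult (fun i => (α.1 i : ℕ)) n * z), by
    intro α φ hφ
    have h0 : mult (fun i => ((MultiIdx.zero k).1 i : ℕ)) n = 1 := by simp [mult, MultiIdx.zero]
    have h1 : ∀ (z : ℂ) (ψ : T3 → ℝ), ∫ x, modeLp n z x * ψ x = ∫ x, mode n z x * ψ x := by
      intro z ψ
      refine integral_congr_ae ?_
      filter_upwards [coeFn_modeLp n z] with x hx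
      rw [hx]
    show ∫ x, modeLp n (mult (fun i => ((MultiIdx.zero k).1 i : ℕ)) n * z) x * _
      = _ * ∫ x, modeLp n (mult (fun i => (α.1 i : ℕ)) n * z) x * _
    rw [h1, h1, h0, one_mul, integral_mode_mul_pdIter n _ hφ]⟩

theorem modeLp_sub (n : Fin 3 → ℤ) (z w : ℂ) : modeLp n (z - w) = modeLp n z - modeLp n w := by
  unfold modeLp
  rw [← map_sub]
  congr 1
  ext x
  simp [mode, sub_mul]

theorem modeSob_sub (k : ℕ) (n : Fin 3 → ℤ) (z w : ℂ) :
    modeSob k n (z - w) = modeSob k n z - modeSob k n w := by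
  apply Subtype.ext
  refine PiLp.ext fun α => ?_
  show modeLp n _ = modeLp n _ - modeLp n _
  rw [← modeLp_sub, mul_sub]

theorem integral_trig_sq_le (s : Finset (Fin 3 → ℤ)) (c : (Fin 3 → ℤ) → ℂ) :
    ∫ x, trig s c x ^ 2 ≤ ∑ n ∈ s, ‖c n‖ ^ 2 := by
  let F : C(T3, ℂ) := ∑ n ∈ s, c n • mFourier n
  have h1 := orthonormal_mFourierLp.inner_sum c c s
  have h2 : ∑ n ∈ s, c n • ContinuousMap.toLp (E := ℂ) 2 (volume : Measure T3) ℂ (mFourier n)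
      = ContinuousMap.toLp (E := ℂ) 2 (volume : Measure T3) ℂ F := by
    simp only [F, map_sum, map_smul]
  rw [h2, ContinuousMap.inner_toLp] at h1
  have hF : ∀ x, F x = ∑ n ∈ s, c n * mFourier n x := fun x => by simp [F]
  have h3 : ∀ x, F x * conj (F x) = ((‖F x‖ ^ 2 : ℝ) : ℂ) := fun x => by
    rw [Complex.mul_conj, Complex.normSq_eq_norm_sq]
  have h4 : ∀ n, conj (c n) * c n = ((‖c n‖ ^ 2 : ℝ) : ℂ) := fun n => by
    rw [mul_comm, Complex.mul_conj, Complex.normSq_eq_norm_sq]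
  simp_rw [h3, h4] at h1
  rw [integral_complex_ofReal, ← Complex.ofReal_sum] at h1
  have h5 : ∫ x, ‖F x‖ ^ 2 = ∑ n ∈ s, ‖c n‖ ^ 2 := Complex.ofReal_injective h1
  rw [← h5]
  refine integral_mono (continuous_integrable ((isCk_trig s c).continuous.pow 2))
    (continuous_integrable (F.continuous.norm.pow 2)) fun x => ?_
  have h6 : trig s c x = (F x).re := by
    rw [hF, Complex.re_sum]; rfl
  show trig s c x ^ 2 ≤ ‖F x‖ ^ 2
  rw [h6, ← sq_abs]
  exact pow_le_pow_left₀ (abs_nonneg _) (Complex.abs_re_le_norm _) 2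

theorem norm_sq_sum_modeLp_le (s : Finset (Fin 3 → ℤ)) (c : (Fin 3 → ℤ) → ℂ) :
    ‖∑ n ∈ s, modeLp n (c n)‖ ^ 2 ≤ ∑ n ∈ s, ‖c n‖ ^ 2 := by
  refine le_trans (le_of_eq ?_) (integral_trig_sq_le s c)
  have h1 : ∑ n ∈ s, modeLp n (c n)
      = ContinuousMap.toLp 2 volume ℝ ⟨trig s c, (isCk_trig s c).continuous⟩ := by
    simp only [modeLp]
    rw [← map_sum]
    congr 1
    ext x
    simp [trig]
  rw [norm_sq_Lp, h1]
  refine integral_congr_ae ?_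
  filter_upwards [ContinuousMap.coeFn_toLp (𝕜 := ℝ) (p := 2) (volume : Measure T3)
    ⟨trig s c, (isCk_trig s c).continuous⟩] with x hx
  rw [hx]; rfl

/-- The number of multi-indices of order at most `k`. -/
noncomputable def cardIdx (k : ℕ) : ℝ := Fintype.card (MultiIdx k)

theorem cardIdx_nonneg (k : ℕ) : 0 ≤ cardIdx k := Nat.cast_nonneg _

theorem norm_sq_sum_modeSob_le (k : ℕ) (s : Finset (Fin 3 → ℤ)) (a : (Fin 3 → ℤ) → ℂ) :
    ‖∑ n ∈ s, modeSob k n (a n)‖ ^ 2 ≤ cardIdx k * ∑ n ∈ s, W k n * ‖a n‖ ^ 2 := by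
  have h : ‖∑ n ∈ s, modeSob k n (a n)‖ = ‖(∑ n ∈ s, modeSob k n (a n)).1‖ := rfl
  rw [h, PiLp.norm_sq_eq_of_L2, cardIdx, ← nsmul_eq_mul, ← Finset.card_univ]
  refine Finset.sum_le_card_nsmul _ _ _ fun α _ => ?_
  have h1 : (∑ n ∈ s, modeSob k n (a n)).1 α
      = ∑ n ∈ s, modeLp n (mult (fun i => (α.1 i : ℕ)) n * a n) := by
    rw [Submodule.coe_sum, WithLp.ofLp_sum, Finset.sum_apply]
    rfl
  rw [h1]
  refine (norm_sq_sum_modeLp_le s _).trans (Finset.sum_le_sum fun n _ => ?_)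
  rw [norm_mul, mul_pow]
  gcongr
  exact norm_mult_sq_le α.2 n

theorem continuous_integral_mul {φ : T3 → ℝ} (hφ : Continuous φ) :
    Continuous fun f : Lp ℝ 2 (volume : Measure T3) => ∫ x, f x * φ x := by
  let g : Lp ℝ 2 (volume : Measure T3) := ContinuousMap.toLp 2 volume ℝ ⟨φ, hφ⟩
  have h : ∀ f : Lp ℝ 2 (volume : Measure T3), ∫ x, f x * φ x = inner ℝ g f := by
    intro f
    rw [L2.inner_def]
    refine integral_congr_ae ?_
    filter_upwards [ContinuousMap.coeFn_toLp (𝕜 := ℝ) (p := 2) (volume : Measure T3) ⟨φ, hφ⟩]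
      with x hx
    simp only [g, hx]
    simp
  simp_rw [h]
  fun_prop

instance completeSpace_sob (k : ℕ) : CompleteSpace (Sob k) := by
  have h : IsClosed ((Sob k : Submodule ℝ _) :
      Set (PiLp 2 (fun _ : MultiIdx k => Lp ℝ 2 (volume : Measure T3)))) := by
    have : ((Sob k : Submodule ℝ _) :
      Set (PiLp 2 (fun _ : MultiIdx k => Lp ℝ 2 (volume : Measure T3))))
      = ⋂ α : MultiIdx k, ⋂ φ : T3 → ℝ, ⋂ _ : IsCk ∞ φ, {w |
        ∫ x, w (MultiIdx.zero k) x * pdIter (fun i => (α.1 i : ℕ)) φ x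
          = (-1) ^ (∑ i, (α.1 i : ℕ)) * ∫ x, w α x * φ x} := by
      ext w
      simp only [mem_iInter, mem_ofPred_eq]
      rfl
    rw [this]
    refine isClosed_iInter fun α => isClosed_iInter fun φ => isClosed_iInter fun hφ => ?_
    exact isClosed_eq
      ((continuous_integral_mul (hφ.pdIter _).continuous).comp (PiLp.continuous_apply 2 _ _))
      (((continuous_integral_mul hφ.continuous).comp (PiLp.continuous_apply 2 _ _)).const_mul _)
  exact h.completeSpace_coe

/-- The element of `H^k` with the Fourier coefficients `a`. -/
noncomputable def ofFourier (k : ℕ) (a : (Fin 3 → ℤ) → ℂ) : Sob k := ∑' n, modeSob k n (a n)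

theorem summable_modeSob {k : ℕ} {a : (Fin 3 → ℤ) → ℂ} (h : Summable fun n => W k n * ‖a n‖ ^ 2) :
    Summable fun n => modeSob k n (a n) := by
  rw [summable_iff_vanishing_norm]
  intro ε hε
  have hc := cardIdx_nonneg k
  obtain ⟨s, hs⟩ := (summable_iff_vanishing_norm.1 h) (ε ^ 2 / (cardIdx k + 1)) (by positivity)
  refine ⟨s, fun t ht => ?_⟩
  have h1 := hs t ht
  have h2 := norm_sq_sum_modeSob_le k t a
  rw [Real.norm_eq_abs, lt_div_iff₀ (by positivity)] at h1
  have h3 := le_abs_self (∑ n ∈ t, W k n * ‖a n‖ ^ 2)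
  have h4 := abs_nonneg (∑ n ∈ t, W k n * ‖a n‖ ^ 2)
  refine lt_of_pow_lt_pow_left₀ 2 hε.le ?_
  nlinarith

theorem norm_sq_ofFourier_le {k : ℕ} {a : (Fin 3 → ℤ) → ℂ} {R : ℝ}
    (h : ∀ s : Finset (Fin 3 → ℤ), ∑ n ∈ s, W k n * ‖a n‖ ^ 2 ≤ R) :
    ‖ofFourier k a‖ ^ 2 ≤ cardIdx k * R := by
  have hs : Summable fun n => W k n * ‖a n‖ ^ 2 :=
    summable_of_sum_le (fun n => mul_nonneg (W_pos k n).le (sq_nonneg _)) h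
  have h1 : Tendsto (fun s : Finset (Fin 3 → ℤ) => ‖∑ n ∈ s, modeSob k n (a n)‖ ^ 2) atTop
      (𝓝 (‖ofFourier k a‖ ^ 2)) := ((summable_modeSob hs).hasSum.norm).pow 2
  refine le_of_tendsto h1 (Eventually.of_forall fun s => ?_)
  exact (norm_sq_sum_modeSob_le k s a).trans
    (mul_le_mul_of_nonneg_left (h s) (cardIdx_nonneg k))

theorem ofFourier_sub {k : ℕ} {a b : (Fin 3 → ℤ) → ℂ} (ha : Summable fun n => W k n * ‖a n‖ ^ 2)
    (hb : Summable fun n => W k n * ‖b n‖ ^ 2) :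
    ofFourier k a - ofFourier k b = ofFourier k (fun n => a n - b n) := by
  unfold ofFourier
  rw [← (summable_modeSob ha).tsum_sub (summable_modeSob hb)]
  simp_rw [modeSob_sub]

theorem HB.summable_W {k : ℕ} {g : T3 → ℝ} {R : ℝ} (h : HB k g R) :
    Summable fun n => W k n * ‖fc g n‖ ^ 2 :=
  summable_of_sum_le (fun n => mul_nonneg (W_pos k n).le (sq_nonneg _)) h

theorem represents_ofFourier {k : ℕ} {g : T3 → ℝ} (hg : Continuous g)
    (h1 : Summable fun n => ‖fc g n‖) (h2 : Summable fun n => W k n * ‖fc g n‖ ^ 2) :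
    Represents (ofFourier k (fc g)) g := by
  let L : Sob k →L[ℝ] Lp ℝ 2 (volume : Measure T3) :=
    (PiLp.proj (𝕜 := ℝ) 2 (fun _ : MultiIdx k => Lp ℝ 2 (volume : Measure T3))
      (MultiIdx.zero k)).comp (Sob k).subtypeL
  have hL : ∀ w, L w = toL2 w := fun w => rfl
  have h0 : ∀ n z, toL2 (modeSob k n z) = modeLp n z := fun n z => by
    show modeLp n (mult (fun i => ((MultiIdx.zero k).1 i : ℕ)) n * z) = _
    rw [show mult (fun i => ((MultiIdx.zero k).1 i : ℕ)) n = 1 by simp [mult, MultiIdx.zero],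
      one_mul]
  have h3 : HasSum (fun n => modeLp n (fc g n)) (toL2 (ofFourier k (fc g))) := by
    have := L.hasSum (summable_modeSob h2).hasSum
    simp_rw [hL, h0] at this
    exact this
  let M : (Fin 3 → ℤ) → C(T3, ℝ) := fun n => ⟨mode n (fc g n), (isCk_mode n _).continuous⟩
  have h4 : Summable M := by
    refine Summable.of_norm_bounded h1 fun n => ?_
    exact (ContinuousMap.norm_le _ (norm_nonneg _)).2 fun x => abs_mode_le n _ x
  have h5 : ∑' n, M n = ⟨g, hg⟩ := by
    ext x
    have h6 := (ContinuousMap.evalCLM ℝ x).hasSum h4.hasSum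
    exact h6.unique (hasSum_mode hg h1 x)
  have h7 := (ContinuousMap.toLp (E := ℝ) 2 (volume : Measure T3) ℝ).hasSum h4.hasSum
  rw [h5] at h7
  have h8 : toL2 (ofFourier k (fc g))
      = ContinuousMap.toLp (E := ℝ) 2 (volume : Measure T3) ℝ ⟨g, hg⟩ := h3.unique h7
  unfold Represents
  rw [h8]
  exact ContinuousMap.coeFn_toLp (𝕜 := ℝ) volume _

theorem sobNorm_le {k : ℕ} (hk : 4 ≤ k) {g : T3 → ℝ} (hg : Continuous g) {R : ℝ} (h : HB k g R) :
    sobNorm k g ≤ ENNReal.ofReal √(cardIdx k * R) := by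
  refine (iInf₂_le (ofFourier k (fc g)) (represents_ofFourier hg (h.summable hk) h.summable_W)).trans
    ?_
  rw [← ofReal_norm]
  exact ENNReal.ofReal_le_ofReal (Real.le_sqrt_of_sq_le (norm_sq_ofFourier_le h))

/-- A criterion for membership in `C([0, T]; H^k)`. -/
theorem memC_of_HB {k : ℕ} (hk : 4 ≤ k) {T : ℝ} {g : ℝ → T3 → ℝ} {R : ℝ}
    (hg : ∀ t ∈ Icc 0 T, Continuous (g t)) (hR : ∀ t ∈ Icc 0 T, HB k (g t) R)
    (hc : ∀ t₀ ∈ Icc 0 T, ∀ ε > 0, ∀ᶠ t in 𝓝[Icc 0 T] t₀, HB k (fun x => g t x - g t₀ x) ε) :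
    MemC k T g := by
  refine ⟨fun t => ofFourier k (fc (g t)), fun t₀ ht₀ => ?_, fun t ht =>
    represents_ofFourier (hg t ht) ((hR t ht).summable hk) (hR t ht).summable_W⟩
  have hcard := cardIdx_nonneg k
  rw [ContinuousWithinAt, Metric.tendsto_nhds]
  intro ε hε
  filter_upwards [hc t₀ ht₀ (ε ^ 2 / (2 * (cardIdx k + 1))) (by positivity), self_mem_nhdsWithin]
    with t h1 ht
  rw [dist_eq_norm, ofFourier_sub (hR t ht).summable_W (hR t₀ ht₀).summable_W]
  have h2 : ∀ n, fc (g t) n - fc (g t₀) n = fc (fun x => g t x - g t₀ x) n := fun n =>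
    (fc_sub (continuous_integrable (hg t ht)) (continuous_integrable (hg t₀ ht₀)) n).symm
  simp_rw [h2]
  have h3 := norm_sq_ofFourier_le h1
  refine lt_of_pow_lt_pow_left₀ 2 hε.le (lt_of_le_of_lt h3 ?_)
  rw [← mul_div_assoc, div_lt_iff₀ (by positivity)]
  nlinarith [sq_pos_of_pos hε]

theorem timeNorm_top_le {k : ℕ} (hk : 4 ≤ k) {T : ℝ} {g : ℝ → T3 → ℝ} {R : ℝ}
    (hg : ∀ t ∈ Icc 0 T, Continuous (g t)) (hR : ∀ t ∈ Icc 0 T, HB k (g t) R) :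
    timeNorm ⊤ k T g ≤ ENNReal.ofReal √(cardIdx k * R) := by
  unfold timeNorm
  rw [eLpNorm_exponent_top]
  refine eLpNormEssSup_le_of_ae_enorm_bound ?_
  rw [ae_restrict_iff' measurableSet_Ioo]
  refine Eventually.of_forall fun t ht => ?_
  have ht' := Ioo_subset_Icc_self ht
  exact sobNorm_le hk (hg t ht') (hR t ht')

/-- A criterion for membership in `L²(0, T; H^k)`, with the bound of the norm. -/
theorem memL2_of_integral {k : ℕ} {T : ℝ} (hT : 0 ≤ T) {g : ℝ → T3 → ℝ} {R : ℝ}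
    (hg : ∀ t ∈ Icc 0 T, Continuous (g t)) (hs : ∀ t ∈ Icc 0 T, Summable fun n => ‖fc (g t) n‖)
    (hc : ∀ n, Continuous fun t => fc (g t) n)
    (hR : ∀ s : Finset (Fin 3 → ℤ), ∑ n ∈ s, W k n * ∫ t in (0)..T, ‖fc (g t) n‖ ^ 2 ≤ R) :
    MemL2 k T g ∧ timeNorm 2 k T g ≤ ENNReal.ofReal √(cardIdx k * R) := by
  have hcard := cardIdx_nonneg k
  set μ : Measure ℝ := volume.restrict (Ioo 0 T) with hμ
  set U : ℝ → Sob k := fun t => ofFourier k (fc (g t)) with hU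
  have hcW : ∀ n, Continuous fun t => W k n * ‖fc (g t) n‖ ^ 2 := fun n =>
    continuous_const.mul ((hc n).norm.pow 2)
  have hnn : ∀ n t, 0 ≤ W k n * ‖fc (g t) n‖ ^ 2 := fun n t =>
    mul_nonneg (W_pos k n).le (sq_nonneg _)
  -- Tonelli for the weighted Fourier coefficients
  have hfin : ∫⁻ t, ∑' n, ENNReal.ofReal (W k n * ‖fc (g t) n‖ ^ 2) ∂μ ≤ ENNReal.ofReal R := by
    rw [lintegral_tsum fun n => (hcW n).measurable.ennreal_ofReal.aemeasurable]
    refine ENNReal.summable.tsum_le_of_sum_le fun s => ?_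
    have h1 : ∀ n, ∫⁻ t, ENNReal.ofReal (W k n * ‖fc (g t) n‖ ^ 2) ∂μ
        = ENNReal.ofReal (W k n * ∫ t in (0)..T, ‖fc (g t) n‖ ^ 2) := by
      intro n
      rw [← ofReal_integral_eq_lintegral_ofReal
        (((hcW n).continuousOn.integrableOn_compact isCompact_Icc).mono_set Ioo_subset_Icc_self)
        (Eventually.of_forall (hnn n)), ← intervalIntegral.integral_const_mul,
        intervalIntegral.integral_of_le hT, integral_Ioc_eq_integral_Ioo]
    simp_rw [h1]
    rw [← ENNReal.ofReal_sum_of_nonneg fun n _ => mul_nonneg (W_pos k n).le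
      (intervalIntegral.integral_nonneg hT fun t _ => sq_nonneg _)]
    exact ENNReal.ofReal_le_ofReal (hR s)
  have hmem : ∀ᵐ t ∂μ, t ∈ Icc 0 T := by
    rw [hμ, ae_restrict_iff' measurableSet_Ioo]
    exact Eventually.of_forall fun t ht => Ioo_subset_Icc_self ht
  have hsum : ∀ᵐ t ∂μ, Summable fun n => W k n * ‖fc (g t) n‖ ^ 2 := by
    have h1 := ae_lt_top' (AEMeasurable.tsum fun n =>
      (hcW n).measurable.ennreal_ofReal.aemeasurable) (ne_top_of_le_ne_top ENNReal.ofReal_ne_top hfin)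
    filter_upwards [h1] with t ht
    have h2 := ENNReal.summable_toReal ht.ne
    simpa only [ENNReal.toReal_ofReal (hnn _ t)] using h2
  have hrep : ∀ᵐ t ∂μ, Represents (U t) (g t) := by
    filter_upwards [hsum, hmem] with t h1 h2
    exact represents_ofFourier (hg t h2) (hs t h2) h1
  have hmode : ∀ n, Continuous fun z => modeSob k n z := by
    intro n
    have hadd : LipschitzWith (Real.toNNReal √(cardIdx k * W k n)) fun z => modeSob k n z := by
      refine LipschitzWith.of_dist_le_mul fun z w => ?_
      rw [dist_eq_norm, dist_eq_norm, ← modeSob_sub, Real.coe_toNNReal _ (Real.sqrt_nonneg _)]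
      have h1 := norm_sq_sum_modeSob_le k {n} fun _ => z - w
      simp only [Finset.sum_singleton] at h1
      have h2 := Real.le_sqrt_of_sq_le h1
      rwa [← mul_assoc, Real.sqrt_mul (mul_nonneg hcard (W_pos k n).le),
        Real.sqrt_sq (norm_nonneg _)] at h2
    exact hadd.continuous
  have hmeas : AEStronglyMeasurable U μ := by
    have : SecondCountableTopologyEither ℝ (Sob k) := ⟨Or.inl inferInstance⟩
    refine aestronglyMeasurable_of_tendsto_ae atTop
      (f := fun N t => ∑ n ∈ box N, modeSob k n (fc (g t) n)) (fun N => ?_) ?_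
    · exact (continuous_finsetSum _ fun n _ => (hmode n).comp (hc n)).aestronglyMeasurable
    · filter_upwards [hsum] with t ht
      exact (summable_modeSob ht).hasSum.comp tendsto_box
  have hbound : ∀ᵐ t ∂μ, ‖U t‖ₑ ^ 2
      ≤ ENNReal.ofReal (cardIdx k) * ∑' n, ENNReal.ofReal (W k n * ‖fc (g t) n‖ ^ 2) := by
    filter_upwards [hsum] with t ht
    have h1 := norm_sq_ofFourier_le (k := k) (a := fc (g t)) fun s =>
      ht.sum_le_tsum s fun n _ => hnn n t
    rw [← ENNReal.ofReal_tsum_of_nonneg (fun n => hnn n t) ht, ← ENNReal.ofReal_mul hcard,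
      ← ofReal_norm, ← ENNReal.ofReal_pow (norm_nonneg _)]
    exact ENNReal.ofReal_le_ofReal h1
  have hnorm : eLpNorm U 2 μ ≤ ENNReal.ofReal √(cardIdx k * R) := by
    have hR0 : 0 ≤ R := by simpa using hR ∅
    have h1 : ∫⁻ t, ‖U t‖ₑ ^ (2 : ℝ) ∂μ ≤ ENNReal.ofReal (cardIdx k * R) := by
      simp_rw [ENNReal.rpow_two]
      calc ∫⁻ t, ‖U t‖ₑ ^ 2 ∂μ ≤ ∫⁻ t, ENNReal.ofReal (cardIdx k) *
            ∑' n, ENNReal.ofReal (W k n * ‖fc (g t) n‖ ^ 2) ∂μ := lintegral_mono_ae hbound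
        _ = ENNReal.ofReal (cardIdx k) *
            ∫⁻ t, ∑' n, ENNReal.ofReal (W k n * ‖fc (g t) n‖ ^ 2) ∂μ :=
          lintegral_const_mul' _ _ ENNReal.ofReal_ne_top
        _ ≤ ENNReal.ofReal (cardIdx k) * ENNReal.ofReal R := by gcongr
        _ = _ := (ENNReal.ofReal_mul hcard).symm
    rw [eLpNorm_eq_lintegral_rpow_enorm_toReal (by norm_num) (by norm_num)]
    simp only [ENNReal.toReal_ofNat]
    calc (∫⁻ t, ‖U t‖ₑ ^ (2 : ℝ) ∂μ) ^ (1 / (2 : ℝ))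
        ≤ ENNReal.ofReal (cardIdx k * R) ^ (1 / (2 : ℝ)) := by gcongr
      _ = ENNReal.ofReal √(cardIdx k * R) := by
        rw [ENNReal.ofReal_rpow_of_nonneg (mul_nonneg hcard hR0) (by norm_num), Real.sqrt_eq_rpow]
  refine ⟨⟨U, ⟨hmeas, hnorm.trans_lt ENNReal.ofReal_lt_top⟩, hrep⟩, le_trans ?_ hnorm⟩
  unfold timeNorm
  refine eLpNorm_mono_enorm_ae ?_
  filter_upwards [hrep] with t ht
  exact iInf₂_le (U t) ht

/-! ### The linear heat equation for one frequency and the change of unknown -/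

/-- The energy inequality for a single Fourier coefficient, with an exponential weight. -/
theorem energy {l μ T : ℝ} (hl : 0 < l) {y h : ℝ → ℂ} (hy : Continuous y)
    (hh : Continuous h) (hd : ∀ t ∈ Ioo 0 T, HasDerivAt y (-(l : ℂ) * y t + h t) t)
    {t : ℝ} (ht : t ∈ Icc 0 T) :
    Real.exp (-2 * μ * t) * ‖y t‖ ^ 2
        + (l + 2 * μ) * ∫ s in (0)..t, Real.exp (-2 * μ * s) * ‖y s‖ ^ 2
      ≤ ‖y 0‖ ^ 2 + 1 / l * ∫ s in (0)..t, Real.exp (-2 * μ * s) * ‖h s‖ ^ 2 := by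
  have hcy : Continuous fun s => Real.exp (-2 * μ * s) * ‖y s‖ ^ 2 := by fun_prop
  have hch : Continuous fun s => Real.exp (-2 * μ * s) * ‖h s‖ ^ 2 := by fun_prop
  have hiy : ∀ t, HasDerivAt (fun t => ∫ s in (0)..t, Real.exp (-2 * μ * s) * ‖y s‖ ^ 2)
      (Real.exp (-2 * μ * t) * ‖y t‖ ^ 2) t := fun t => hcy.integral_hasStrictDerivAt 0 t |>.hasDerivAt
  have hih : ∀ t, HasDerivAt (fun t => ∫ s in (0)..t, Real.exp (-2 * μ * s) * ‖h s‖ ^ 2)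
      (Real.exp (-2 * μ * t) * ‖h t‖ ^ 2) t := fun t => hch.integral_hasStrictDerivAt 0 t |>.hasDerivAt
  have hexp : ∀ t, HasDerivAt (fun t => Real.exp (-2 * μ * t))
      (Real.exp (-2 * μ * t) * (-2 * μ)) t := fun t => by
    simpa using ((hasDerivAt_id t).const_mul (-2 * μ)).exp
  let φ : ℝ → ℝ := fun t => Real.exp (-2 * μ * t) * ‖y t‖ ^ 2
    + (l + 2 * μ) * (∫ s in (0)..t, Real.exp (-2 * μ * s) * ‖y s‖ ^ 2)
    - 1 / l * ∫ s in (0)..t, Real.exp (-2 * μ * s) * ‖h s‖ ^ 2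
  have hφ : ∀ t ∈ Ioo 0 T, HasDerivAt φ
      (Real.exp (-2 * μ * t) * (-2 * μ) * ‖y t‖ ^ 2
        + Real.exp (-2 * μ * t) * (2 * inner ℝ (y t) (-(l : ℂ) * y t + h t))
        + (l + 2 * μ) * (Real.exp (-2 * μ * t) * ‖y t‖ ^ 2)
        - 1 / l * (Real.exp (-2 * μ * t) * ‖h t‖ ^ 2)) t := fun t ht =>
    (((hexp t).mul (hd t ht).norm_sq).add ((hiy t).const_mul _)).sub ((hih t).const_mul _)
  have hφc : Continuous φ := by
    refine (hcy.add (continuous_const.mul ?_)).sub (continuous_const.mul ?_)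
    · exact continuous_iff_continuousAt.2 fun t => (hiy t).continuousAt
    · exact continuous_iff_continuousAt.2 fun t => (hih t).continuousAt
  have hanti : AntitoneOn φ (Icc 0 T) := by
    refine antitoneOn_of_deriv_nonpos (convex_Icc 0 T) hφc.continuousOn ?_ ?_
    · rw [interior_Icc]
      exact fun t ht => (hφ t ht).differentiableAt.differentiableWithinAt
    · rw [interior_Icc]
      intro t ht
      rw [(hφ t ht).deriv]
      have h1 : inner ℝ (y t) (-(l : ℂ) * y t + h t) = -l * ‖y t‖ ^ 2 + inner ℝ (y t) (h t) := by
        have : -(l : ℂ) * y t = (-l) • y t := by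
          rw [Complex.real_smul]; push_cast; ring
        rw [inner_add_right, this, inner_smul_right, real_inner_self_eq_norm_sq]
      have h2 : inner ℝ (y t) (h t) ≤ ‖y t‖ * ‖h t‖ := real_inner_le_norm _ _
      have h3 : 2 * (‖y t‖ * ‖h t‖) ≤ l * ‖y t‖ ^ 2 + 1 / l * ‖h t‖ ^ 2 := by
        have h4 : l * ‖y t‖ ^ 2 + 1 / l * ‖h t‖ ^ 2 - 2 * (‖y t‖ * ‖h t‖)
            = 1 / l * (l * ‖y t‖ - ‖h t‖) ^ 2 := by
          field_simp; ring
        have h5 : 0 ≤ 1 / l * (l * ‖y t‖ - ‖h t‖) ^ 2 := by positivity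
        linarith
      have h6 : 2 * inner ℝ (y t) (h t) - l * ‖y t‖ ^ 2 - 1 / l * ‖h t‖ ^ 2 ≤ 0 := by linarith
      rw [h1]
      have h7 := mul_nonpos_of_nonneg_of_nonpos (Real.exp_pos (-2 * μ * t)).le h6
      linarith
  have h0 := hanti ⟨le_rfl, ht.1.trans ht.2⟩ ht ht.1
  simp only [φ, intervalIntegral.integral_same, mul_zero, Real.exp_zero, one_mul, add_zero,
    sub_zero] at h0
  linarith

/-- The solution of `y' = -l y + h`, `y(0) = a`, by Duhamel's formula. -/
noncomputable def duhamel (l : ℝ) (a : ℂ) (h : ℝ → ℂ) (t : ℝ) : ℂ :=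
  Complex.exp (-(l : ℂ) * t) * (a + ∫ s in (0)..t, Complex.exp ((l : ℂ) * s) * h s)

theorem hasDerivAt_duhamel (l : ℝ) (a : ℂ) {h : ℝ → ℂ} (hh : Continuous h) (t : ℝ) :
    HasDerivAt (duhamel l a h) (-(l : ℂ) * duhamel l a h t + h t) t := by
  have hc : Continuous fun s : ℝ => Complex.exp ((l : ℂ) * s) * h s := by fun_prop
  have h1 : HasDerivAt (fun t : ℝ => Complex.exp (-(l : ℂ) * t))
      (Complex.exp (-(l : ℂ) * t) * (-(l : ℂ) * 1)) t :=
    (Complex.ofRealCLM.hasDerivAt.const_mul (-(l : ℂ))).cexp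
  have h2 := (hc.integral_hasStrictDerivAt 0 t).hasDerivAt.const_add a
  have h3 := h1.mul h2
  refine h3.congr_deriv ?_
  rw [duhamel, ← mul_assoc (Complex.exp (-(l : ℂ) * t)) (Complex.exp ((l : ℂ) * t)),
    ← Complex.exp_add]
  simp
  ring

theorem continuous_duhamel (l : ℝ) (a : ℂ) {h : ℝ → ℂ} (hh : Continuous h) :
    Continuous (duhamel l a h) :=
  continuous_iff_continuousAt.2 fun t => (hasDerivAt_duhamel l a hh t).continuousAt

theorem duhamel_zero (l : ℝ) (a : ℂ) (h : ℝ → ℂ) : duhamel l a h 0 = a := by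
  simp [duhamel]

theorem conj_duhamel (l : ℝ) (a : ℂ) (h : ℝ → ℂ) (t : ℝ) :
    conj (duhamel l a h t) = duhamel l (conj a) (fun s => conj (h s)) t := by
  have h1 : ∀ f : ℝ → ℂ, conj (∫ s in (0)..t, f s) = ∫ s in (0)..t, conj (f s) := fun f => by
    simp only [intervalIntegral, map_sub, ← integral_conj]
  unfold duhamel
  rw [map_mul, map_add, ← Complex.exp_conj, h1]
  simp [← Complex.exp_conj]

/-- `Θ` is a smooth monotone function on the line that inverts `s ↦ s + s⁴` for `s ≥ b / 4`. Being
defined everywhere, it can be composed with approximate solutions before any lower bound for them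
is known. -/
structure IsInverse (b : ℝ) (Θ : ℝ → ℝ) : Prop where
  contDiff : ContDiff ℝ ∞ Θ
  deriv_nonneg : ∀ x, 0 ≤ deriv Θ x
  deriv_le_one : ∀ x, deriv Θ x ≤ 1
  left_inv : ∀ s, b / 4 ≤ s → Θ (s + s ^ 4) = s
  right_inv : ∀ x, b / 4 ≤ Θ x → Θ x + Θ x ^ 4 = x

/-- `Θ` is the inverse of `s ↦ s + ρ(s)⁴`, where the smooth cutoff `ρ` of the identity vanishes for
`s ≤ 0`; since `ρ` is nonnegative and monotone, the derivative of this map is at least `1`. -/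
theorem exists_isInverse {b : ℝ} (hb : 0 < b) : ∃ Θ, IsInverse b Θ := by
  let ρ : ℝ → ℝ := fun s => s * Real.smoothTransition (4 * s / b)
  have hρ0 : ∀ s ≤ 0, ρ s = 0 := fun s hs => by
    have : 4 * s / b ≤ 0 := div_nonpos_of_nonpos_of_nonneg (by linarith) hb.le
    simp [ρ, Real.smoothTransition.zero_of_nonpos this]
  have hρ1 : ∀ s, b / 4 ≤ s → ρ s = s := fun s hs => by
    have : 1 ≤ 4 * s / b := by rw [le_div_iff₀ hb]; linarith
    simp [ρ, Real.smoothTransition.one_of_one_le this]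
  have hρc : ContDiff ℝ ∞ ρ :=
    contDiff_id.mul (Real.smoothTransition.contDiff.comp (by fun_prop))
  have hρn : ∀ s, 0 ≤ ρ s := fun s => by
    rcases le_total s 0 with h | h
    · rw [hρ0 s h]
    · exact mul_nonneg h (Real.smoothTransition.nonneg _)
  have hρm : Monotone ρ := by
    intro s t hst
    rcases le_total s 0 with h | h
    · rw [hρ0 s h]; exact hρn t
    · refine mul_le_mul hst (Real.smoothTransition.monotone ?_) (Real.smoothTransition.nonneg _)
        (h.trans hst)
      gcongr
  let A : ℝ → ℝ := fun s => s + ρ s ^ 4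
  have hAc : ContDiff ℝ ∞ A := contDiff_id.add (hρc.pow 4)
  have hAd : ∀ s, HasDerivAt A (deriv A s) s := fun s => (hAc.differentiable (by simp) s).hasDerivAt
  have hA1 : ∀ s, 1 ≤ deriv A s := by
    intro s
    have h1 : HasDerivAt A (1 + deriv (fun s => ρ s ^ 4) s) s :=
      (hasDerivAt_id s).add ((hρc.pow 4).differentiable (by simp) s).hasDerivAt
    rw [h1.deriv]
    have h2 : Monotone fun s => ρ s ^ 4 := fun s t hst => pow_le_pow_left₀ (hρn s) (hρm hst) 4
    have h3 : 0 ≤ deriv (fun s => ρ s ^ 4) s := h2.deriv_nonneg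
    linarith
  have hAm : StrictMono A := strictMono_of_deriv_pos fun s => by linarith [hA1 s]
  have hAs : Function.Surjective A := by
    refine hAc.continuous.surjective ?_ ?_
    · exact tendsto_atTop_mono (fun s => le_add_of_nonneg_right (by have := hρn s; positivity))
        tendsto_id
    · refine tendsto_id.congr' ?_
      filter_upwards [eventually_le_atBot (0 : ℝ)] with s hs
      simp [A, hρ0 s hs]
  let e := (hAm.orderIsoOfSurjective A hAs).toHomeomorph
  have heA : ∀ x, e x = A x := fun x => rfl
  have hAe : ∀ x, A (e.symm x) = x := fun x => by rw [← heA]; exact e.apply_symm_apply x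
  have heA' : ∀ x, e.symm (A x) = x := fun x => by rw [← heA]; exact e.symm_apply_apply x
  have hec : ContDiff ℝ ∞ e.symm := by
    refine e.contDiff_symm_deriv (f' := deriv A) (fun x => by linarith [hA1 x]) ?_ ?_
    · exact hAd
    · exact hAc
  have hder : ∀ x, deriv A (e.symm x) * deriv e.symm x = 1 := by
    intro x
    have h1 : HasDerivAt e.symm (deriv e.symm x) x := (hec.differentiable (by simp) x).hasDerivAt
    have h2 := (hAd (e.symm x)).comp x h1
    have h3 : A ∘ e.symm = id := funext hAe
    rw [h3] at h2
    exact h2.unique (hasDerivAt_id x)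
  have hpos : ∀ x, 0 ≤ deriv e.symm x := fun x => by
    by_contra h
    push Not at h
    nlinarith [hder x, hA1 (e.symm x)]
  refine ⟨e.symm, hec, hpos, fun x => ?_, fun s hs => ?_, fun x hx => ?_⟩
  · nlinarith [hder x, hA1 (e.symm x), hpos x]
  · have : s + s ^ 4 = A s := by simp only [A, hρ1 s hs]
    rw [this, heA']
  · have h1 := hAe x
    simp only [A, hρ1 _ hx] at h1
    exact h1

namespace IsInverse

variable {b : ℝ} {Θ : ℝ → ℝ}

theorem monotone (h : IsInverse b Θ) : Monotone Θ :=
  monotone_of_deriv_nonneg (h.contDiff.differentiable (by simp)) h.deriv_nonneg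

theorem lipschitz (h : IsInverse b Θ) (x y : ℝ) : |Θ x - Θ y| ≤ |x - y| := by
  have := Convex.norm_image_sub_le_of_norm_deriv_le (f := Θ) (C := 1) (s := univ) (x := y) (y := x)
    (fun z _ => h.contDiff.differentiable (by simp) z)
    (fun z _ => by rw [Real.norm_eq_abs, abs_of_nonneg (h.deriv_nonneg z)]; exact h.deriv_le_one z)
    convex_univ (mem_univ _) (mem_univ _)
  simpa using this

end IsInverse

/-- The function `P` for which the equation reads `∂ₜw = Δ(w - P(w)) - div(u Θ(w))`. -/
noncomputable def excess (Θ : ℝ → ℝ) (x : ℝ) : ℝ := 2 / 3 * (x - Θ x)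

namespace IsInverse

variable {b : ℝ} {Θ : ℝ → ℝ}

theorem excess_contDiff (h : IsInverse b Θ) : ContDiff ℝ ∞ (excess Θ) :=
  contDiff_const.mul (contDiff_id.sub h.contDiff)

theorem abs_deriv_excess_le (h : IsInverse b Θ) (x : ℝ) : |deriv (excess Θ) x| ≤ 2 / 3 := by
  have h1 : HasDerivAt (excess Θ) (2 / 3 * (1 - deriv Θ x)) x :=
    ((hasDerivAt_id x).sub (h.contDiff.differentiable (by simp) x).hasDerivAt).const_mul _
  rw [h1.deriv, abs_le]
  constructor <;> linarith [h.deriv_nonneg x, h.deriv_le_one x]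

theorem excess_lipschitz (h : IsInverse b Θ) (x y : ℝ) :
    |excess Θ x - excess Θ y| ≤ 2 / 3 * |x - y| :=
  Convex.norm_image_sub_le_of_norm_deriv_le (s := univ)
    (fun z _ => h.excess_contDiff.differentiable (by simp) z)
    (fun z _ => h.abs_deriv_excess_le z) convex_univ (mem_univ _) (mem_univ _)

end IsInverse

/-! ### The velocity and the equation for the Fourier coefficients -/

/-- A velocity field, defined for all times, whose space derivatives of order at most `k` are
bounded by `L`. -/
structure IsVelocity (k : ℕ) (L : ℝ) (v : Fin 3 → ℝ → T3 → ℝ) : Prop where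
  nonneg : 0 ≤ L
  continuous : ∀ j, Continuous fun p : ℝ × T3 => v j p.1 p.2
  isCk : ∀ j t, IsCk k (v j t)
  ctl : ∀ i j t, Ctl i k k L (v j t)

theorem contDiffOn_pd {m : ℕ} {F : ℝ → T3 → ℝ}
    (hF : ContDiffOn ℝ (m + 1 : ℕ) (fun p : ℝ × (Fin 3 → ℝ) => F p.1 (proj p.2)) (Ici 0 ×ˢ univ))
    (i : Fin 3) :
    ContDiffOn ℝ m (fun p : ℝ × (Fin 3 → ℝ) => pd i (F p.1) (proj p.2)) (Ici 0 ×ˢ univ) := by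
  set S : Set (ℝ × (Fin 3 → ℝ)) := Ici 0 ×ˢ univ
  set G : ℝ × (Fin 3 → ℝ) → ℝ := fun p => F p.1 (proj p.2)
  have hS : UniqueDiffOn ℝ S := (uniqueDiffOn_Ici 0).prod uniqueDiffOn_univ
  have h1 : ContDiffOn ℝ m (fun p => fderivWithin ℝ G S p (0, Pi.single i 1)) S :=
    (hF.fderivWithin hS (by norm_cast)).clm_apply contDiffOn_const
  refine h1.congr fun p hp => ?_
  obtain ⟨t, y⟩ := p
  have hd : HasFDerivWithinAt G (fderivWithin ℝ G S (t, y)) S (t, y) :=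
    ((hF.differentiableOn (by simp)) (t, y) hp).hasFDerivWithinAt
  have hl : HasDerivAt (fun s : ℝ => ((t, y + s • Pi.single i (1 : ℝ)) : ℝ × (Fin 3 → ℝ)))
      (0, Pi.single i 1) 0 := by
    refine (hasDerivAt_const _ _).prodMk ?_
    simpa using ((hasDerivAt_id (0 : ℝ)).smul_const (Pi.single i (1 : ℝ) : Fin 3 → ℝ)).const_add y
  have hd' : HasFDerivWithinAt G (fderivWithin ℝ G S (t, y)) S
      ((fun s : ℝ => ((t, y + s • Pi.single i (1 : ℝ)) : ℝ × (Fin 3 → ℝ))) 0) := by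
    simpa using hd
  have hmaps : MapsTo (fun s : ℝ => ((t, y + s • Pi.single i (1 : ℝ)) : ℝ × (Fin 3 → ℝ))) univ S :=
    fun s _ => mk_mem_prod hp.1 (mem_univ _)
  have hc := hd'.comp_hasDerivWithinAt (0 : ℝ) (hl.hasDerivWithinAt (s := univ)) hmaps
  rw [hasDerivWithinAt_univ] at hc
  show pd i (F t) (proj y) = _
  rw [pd, slice_eq_lift]
  exact hc.deriv

theorem contDiffOn_D {m a : ℕ} {F : ℝ → T3 → ℝ}
    (hF : ContDiffOn ℝ (m + a : ℕ) (fun p : ℝ × (Fin 3 → ℝ) => F p.1 (proj p.2)) (Ici 0 ×ˢ univ))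
    (i : Fin 3) :
    ContDiffOn ℝ m (fun p : ℝ × (Fin 3 → ℝ) => D i a (F p.1) (proj p.2)) (Ici 0 ×ˢ univ) := by
  induction a generalizing m with
  | zero => simpa only [D_zero, add_zero] using hF
  | succ a ih =>
    simp_rw [D_succ]
    exact contDiffOn_pd (F := fun t => D i a (F t)) (ih (by rwa [add_assoc, add_comm 1])) i

theorem exists_mem_cube (x : T3) : ∃ y ∈ Icc (0 : Fin 3 → ℝ) 1, proj y = x := by
  refine ⟨fun i => (AddCircle.equivIco 1 0 (x i)).1, ⟨fun i => ?_, fun i => ?_⟩, ?_⟩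
  · exact (AddCircle.equivIco 1 0 (x i)).2.1
  · have := (AddCircle.equivIco 1 0 (x i)).2.2
    exact (this.trans_eq (zero_add 1)).le
  · funext i
    exact (AddCircle.equivIco 1 0).symm_apply_apply (x i)

theorem exists_bound_velocity {m : ℕ} {F : ℝ → T3 → ℝ}
    (hF : ContDiffOn ℝ m (fun p : ℝ × (Fin 3 → ℝ) => F p.1 (proj p.2)) (Ici 0 ×ˢ univ)) :
    ∃ C, 0 ≤ C ∧ ∀ t ∈ Icc (0 : ℝ) 1, ∀ x, |F t x| ≤ C := by
  obtain ⟨C, hC⟩ := (isCompact_Icc (a := (0 : ℝ)) (b := 1)).prod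
    (isCompact_Icc (a := (0 : Fin 3 → ℝ)) (b := 1)) |>.exists_bound_of_continuousOn
    (hF.continuousOn.mono (prod_mono (fun t ht => ht.1) (subset_univ _)))
  refine ⟨max C 0, le_max_right _ _, fun t ht x => ?_⟩
  obtain ⟨y, hy, rfl⟩ := exists_mem_cube x
  exact (hC (t, y) ⟨ht, hy⟩).trans (le_max_left _ _)

/-- The velocity on `[0, 1]`, extended to all times by constants. -/
noncomputable def clipVelocity (u : ℝ → T3 → Fin 3 → ℝ) : Fin 3 → ℝ → T3 → ℝ := fun j t x =>
  u (projIcc 0 1 zero_le_one t : Icc (0 : ℝ) 1) x j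

theorem exists_isVelocity {k : ℕ} {u : ℝ → T3 → Fin 3 → ℝ} (hu : IsCkVelocity k u) :
    ∃ L, IsVelocity k L (clipVelocity u) := by
  have h1 : ∀ (i j : Fin 3) (a : Fin (k + 1)), ∃ C, 0 ≤ C ∧ ∀ t ∈ Icc (0 : ℝ) 1, ∀ x,
      |D i a (fun x => u t x j) x| ≤ C := by
    intro i j a
    have h2 := hu j
    rw [show k = (k - a) + a by omega] at h2
    exact exists_bound_velocity (F := fun t => D i a (fun x => u t x j))
      (contDiffOn_D (F := fun t x => u t x j) h2 i)
  choose C hC0 hC using h1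
  have hle : ∀ i j a, C i j a ≤ ∑ i, ∑ j, ∑ a, C i j a := by
    intro i j a
    calc C i j a ≤ ∑ a, C i j a :=
          Finset.single_le_sum (f := fun a => C i j a) (fun a _ => hC0 i j a) (Finset.mem_univ a)
      _ ≤ ∑ j, ∑ a, C i j a := Finset.single_le_sum (f := fun j => ∑ a, C i j a)
          (fun j _ => Finset.sum_nonneg fun a _ => hC0 i j a) (Finset.mem_univ j)
      _ ≤ _ := Finset.single_le_sum (f := fun i => ∑ j, ∑ a, C i j a)
          (fun i _ => Finset.sum_nonneg fun j _ => Finset.sum_nonneg fun a _ => hC0 i j a)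
          (Finset.mem_univ i)
  have hbd : ∀ i j, ∀ a ≤ k, ∀ t x, |D i a (clipVelocity u j t) x| ≤ ∑ i, ∑ j, ∑ a, C i j a :=
    fun i j a ha t x => (hC i j ⟨a, by omega⟩ _ (projIcc 0 1 zero_le_one t).2 x).trans (hle _ _ _)
  refine ⟨∑ i, ∑ j, ∑ a, C i j a, ⟨?_, fun j => ?_, fun j t => ?_, fun i j t => ⟨?_, ?_⟩⟩⟩
  · exact Finset.sum_nonneg fun i _ => Finset.sum_nonneg fun j _ => Finset.sum_nonneg
      fun a _ => hC0 i j a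
  · have hq : IsOpenQuotientMap (Prod.map (id : ℝ → ℝ) proj) :=
      IsOpenQuotientMap.id.prodMap isOpenQuotientMap_proj
    rw [hq.isQuotientMap.continuous_iff]
    have hg : Continuous fun p : ℝ × (Fin 3 → ℝ) =>
        (((projIcc 0 1 zero_le_one p.1 : Icc (0 : ℝ) 1) : ℝ), p.2) :=
      (continuous_subtype_val.comp (continuous_projIcc.comp continuous_fst)).prodMk continuous_snd
    exact (hu j).continuousOn.comp_continuous hg fun p =>
      ⟨(projIcc 0 1 zero_le_one p.1).2.1, mem_univ _⟩
  · have hg : ContDiff ℝ k fun y : Fin 3 → ℝ =>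
        (((projIcc 0 1 zero_le_one t : Icc (0 : ℝ) 1) : ℝ), y) := contDiff_const.prodMk contDiff_id
    have := (hu j).comp hg.contDiffOn (s := univ)
      fun y _ => ⟨(projIcc 0 1 zero_le_one t).2.1, mem_univ _⟩
    exact contDiffOn_univ.1 this
  · exact fun a ha _ x => hbd i j a ha t x
  · exact fun a ha => integral_sq_le_of_abs_le (hbd i j a ha t)

theorem continuous_fc {g : ℝ → T3 → ℝ} (hg : Continuous fun p : ℝ × T3 => g p.1 p.2)
    (n : Fin 3 → ℤ) : Continuous fun t => fc (g t) n := by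
  have h : Continuous (Function.uncurry fun (t : ℝ) (x : T3) =>
      mFourier (-n) x * ((g t x : ℝ) : ℂ)) :=
    ((mFourier (-n)).continuous.comp continuous_snd).mul (Complex.continuous_ofReal.comp hg)
  have h2 := continuous_parametric_integral_of_continuous (μ := (volume : Measure T3)) h
    (isCompact_univ (X := T3))
  simpa only [Measure.restrict_univ, fc] using h2

theorem continuous_integral_sq {g : ℝ → T3 → ℝ} (hg : Continuous fun p : ℝ × T3 => g p.1 p.2) :
    Continuous fun t => ∫ x, g t x ^ 2 := by
  have h : Continuous (Function.uncurry fun (t : ℝ) (x : T3) => g t x ^ 2) := hg.pow 2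
  have h2 := continuous_parametric_integral_of_continuous (μ := (volume : Measure T3)) h
    (isCompact_univ (X := T3))
  simpa only [Measure.restrict_univ] using h2

/-- The Fourier coefficients of the right-hand side of the heat equation
`∂ₜw - Δw = -ΔP(w) - div(v Θ(w))`. -/
noncomputable def source (v : Fin 3 → ℝ → T3 → ℝ) (Θ : ℝ → ℝ) (w : ℝ → T3 → ℝ) (n : Fin 3 → ℤ)
    (t : ℝ) : ℂ :=
  lam n * fc (fun x => excess Θ (w t x)) n
    - ∑ j, Complex.I * freq n j * fc (fun x => v j t x * Θ (w t x)) n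

theorem lam_nonneg (n : Fin 3 → ℤ) : 0 ≤ lam n := Finset.sum_nonneg fun _ _ => sq_nonneg _

theorem freq_zero (i : Fin 3) : freq 0 i = 0 := by simp [freq]

theorem freq_sq_le_lam (n : Fin 3 → ℤ) (i : Fin 3) : freq n i ^ 2 ≤ lam n :=
  Finset.single_le_sum (f := fun i => freq n i ^ 2) (fun _ _ => sq_nonneg _) (Finset.mem_univ i)

theorem abs_le_abs_freq (n : Fin 3 → ℤ) (i : Fin 3) : |(n i : ℝ)| ≤ |freq n i| := by
  have := Real.pi_gt_three
  rw [freq, abs_mul, abs_of_pos (show 0 < 2 * Real.pi by positivity)]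
  nlinarith [abs_nonneg (n i : ℝ)]

theorem freq_sq_cases (n : Fin 3 → ℤ) (i : Fin 3) : freq n i = 0 ∨ 1 ≤ freq n i ^ 2 := by
  by_cases h : n i = 0
  · left; simp [freq, h]
  · right
    have h1 : (1 : ℝ) ≤ |(n i : ℝ)| := by exact_mod_cast Int.one_le_abs h
    rw [← sq_abs]
    exact one_le_pow₀ (h1.trans (abs_le_abs_freq n i))

theorem lam_pos {n : Fin 3 → ℤ} (hn : n ≠ 0) : 0 < lam n := by
  obtain ⟨i, hi⟩ := Function.ne_iff.1 hn
  have h1 : (1 : ℝ) ≤ |(n i : ℝ)| := by exact_mod_cast Int.one_le_abs hi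
  have h2 := h1.trans (abs_le_abs_freq n i)
  have h3 := freq_sq_le_lam n i
  rw [← sq_abs] at h3
  nlinarith

theorem source_zero (v : Fin 3 → ℝ → T3 → ℝ) (Θ : ℝ → ℝ) (w : ℝ → T3 → ℝ) (t : ℝ) :
    source v Θ w 0 t = 0 := by
  simp [source, lam, freq_zero]

theorem conj_source (v : Fin 3 → ℝ → T3 → ℝ) (Θ : ℝ → ℝ) (w : ℝ → T3 → ℝ) (n : Fin 3 → ℤ) (t : ℝ) :
    conj (source v Θ w n t) = source v Θ w (-n) t := by
  simp [source, conj_fc, freq_neg, lam]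

theorem continuous_source {k : ℕ} {L : ℝ} {v : Fin 3 → ℝ → T3 → ℝ} (hv : IsVelocity k L v) {b : ℝ}
    {Θ : ℝ → ℝ} (hΘ : IsInverse b Θ) {w : ℝ → T3 → ℝ}
    (hw : Continuous fun p : ℝ × T3 => w p.1 p.2) (n : Fin 3 → ℤ) :
    Continuous (source v Θ w n) := by
  refine (continuous_const.mul (continuous_fc ?_ n)).sub
    (continuous_finsetSum _ fun j _ => continuous_const.mul (continuous_fc ?_ n))
  · exact hΘ.excess_contDiff.continuous.comp hw
  · exact (hv.continuous j).mul (hΘ.contDiff.continuous.comp hw)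

theorem norm_sq_symbol_le (n : Fin 3 → ℤ) (a : ℂ) (c : Fin 3 → ℂ) :
    ‖lam n * a - ∑ j, Complex.I * freq n j * c j‖ ^ 2
      ≤ 5 / 4 * lam n ^ 2 * ‖a‖ ^ 2 + 5 * lam n * ∑ j, ‖c j‖ ^ 2 := by
  have h1 : ‖∑ j, Complex.I * freq n j * c j‖ ^ 2 ≤ lam n * ∑ j, ‖c j‖ ^ 2 := by
    calc ‖∑ j, Complex.I * freq n j * c j‖ ^ 2 ≤ (∑ j, |freq n j| * ‖c j‖) ^ 2 := by
          gcongr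
          refine (norm_sum_le _ _).trans (le_of_eq (Finset.sum_congr rfl fun j _ => ?_))
          rw [norm_mul, norm_mul, Complex.norm_I, one_mul, Complex.norm_real, Real.norm_eq_abs]
      _ ≤ (∑ j, |freq n j| ^ 2) * ∑ j, ‖c j‖ ^ 2 := Finset.sum_mul_sq_le_sq_mul_sq _ _ _
      _ = _ := by simp_rw [sq_abs]; rfl
  have h2 : ‖(lam n : ℂ) * a‖ = lam n * ‖a‖ := by
    rw [norm_mul, Complex.norm_real, Real.norm_eq_abs, abs_of_nonneg (lam_nonneg n)]
  have h3 := norm_sub_le ((lam n : ℂ) * a) (∑ j, Complex.I * freq n j * c j)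
  rw [h2] at h3
  have h4 := pow_le_pow_left₀ (norm_nonneg _) h3 2
  nlinarith [sq_nonneg (lam n * ‖a‖ - 4 * ‖∑ j, Complex.I * freq n j * c j‖)]

/-- The energy inequality for the heat equation with source `-ΔA - div C`. -/
theorem energy_heat {μ T : ℝ} {n : Fin 3 → ℤ} (hn : n ≠ 0) {y a : ℝ → ℂ}
    {c : Fin 3 → ℝ → ℂ} (hy : Continuous y) (ha : Continuous a) (hc : ∀ j, Continuous (c j))
    (hd : ∀ t ∈ Ioo 0 T, HasDerivAt y
      (-(lam n : ℂ) * y t + (lam n * a t - ∑ j, Complex.I * freq n j * c j t)) t)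
    {t : ℝ} (ht : t ∈ Icc 0 T) :
    Real.exp (-2 * μ * t) * ‖y t‖ ^ 2
        + (lam n + 2 * μ) * ∫ s in (0)..t, Real.exp (-2 * μ * s) * ‖y s‖ ^ 2
      ≤ ‖y 0‖ ^ 2 + (5 / 4 * lam n * (∫ s in (0)..t, Real.exp (-2 * μ * s) * ‖a s‖ ^ 2)
        + 5 * ∑ j, ∫ s in (0)..t, Real.exp (-2 * μ * s) * ‖c j s‖ ^ 2) := by
  have hl := lam_pos hn
  have hh : Continuous fun t => lam n * a t - ∑ j, Complex.I * freq n j * c j t := by fun_prop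
  refine (energy hl hy hh hd ht).trans (add_le_add le_rfl ?_)
  have ia : IntervalIntegrable (fun s => Real.exp (-2 * μ * s) * ‖a s‖ ^ 2) volume 0 t :=
    Continuous.intervalIntegrable (by fun_prop) _ _
  have ic : ∀ j ∈ Finset.univ, IntervalIntegrable (fun s => Real.exp (-2 * μ * s) * ‖c j s‖ ^ 2)
      volume 0 t := fun j _ => by
    have := hc j
    exact Continuous.intervalIntegrable (by fun_prop) _ _
  rw [← intervalIntegral.integral_finsetSum ic, ← intervalIntegral.integral_const_mul,
    ← intervalIntegral.integral_const_mul, ← intervalIntegral.integral_const_mul,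
    ← intervalIntegral.integral_add (ia.const_mul _) (Continuous.intervalIntegrable (by fun_prop) _ _)]
  refine intervalIntegral.integral_mono_on ht.1 (Continuous.intervalIntegrable (by fun_prop) _ _)
    (Continuous.intervalIntegrable (by fun_prop) _ _) fun s _ => ?_
  have h1 := norm_sq_symbol_le n (a s) fun j => c j s
  have he := Real.exp_pos (-2 * μ * s)
  rw [← Finset.mul_sum, one_div, inv_mul_le_iff₀ hl]
  nlinarith

/-! ### Bounds for the nonlinear terms -/

theorem continuous_curry_right {w : ℝ → T3 → ℝ} (hw : Continuous fun p : ℝ × T3 => w p.1 p.2) (t : ℝ) :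
    Continuous (w t) :=
  hw.comp (Continuous.prodMk_right t)

/-- At the top order the composition with the excess contributes less than the full norm, up to
terms of lower order; this is what makes the diffusion coercive. -/
theorem sum_excess_le {k : ℕ} (hk : 8 ≤ k) {b : ℝ} {Θ : ℝ → ℝ} (hΘ : IsInverse b Θ) {K : ℝ}
    (hK : 0 ≤ K) :
    ∃ C, 0 ≤ C ∧ ∀ v, IsCk ∞ v → HB k v (K ^ 2) → ∀ (i : Fin 3) (s : Finset (Fin 3 → ℤ)),
      ∑ n ∈ s, freq n i ^ (2 * (k + 1)) * ‖fc (fun x => excess Θ (v x)) n‖ ^ 2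
        ≤ 5 / 9 * (∫ x, D i (k + 1) v x ^ 2) + 5 * C ^ 2 := by
  have hCS := CS_nonneg
  have hK' : 0 ≤ (1 + 4 ^ k * CS) * K := by positivity
  choose C hC0 hC using fun i => Ctl.top_order (i := i) hk hK' hΘ.excess_contDiff
  refine ⟨∑ i, C i, Finset.sum_nonneg fun i _ => hC0 i, fun v hv h i s => ?_⟩
  have hP : IsCk ∞ fun x => excess Θ (v x) := IsCk.comp hΘ.excess_contDiff hv
  have h1 := hC i v hv (h.ctl hK (hv.nat k) i)
  have hD : Continuous (D i (k + 1) v) := (hv.D i).continuous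
  have hDP : Continuous (D i (k + 1) fun x => excess Θ (v x)) := (hP.D i).continuous
  have hd : Continuous fun x => deriv (excess Θ) (v x) :=
    (hΘ.excess_contDiff.continuous_deriv (by simp)).comp hv.continuous
  have h2 := sum_sq_fc_le (continuous_memLp hDP) s
  simp_rw [norm_fc_D (hP.nat (k + 1)), mul_pow, ← pow_mul, mul_comm (k + 1) 2, pow_mul |freq _ i|,
    sq_abs, ← pow_mul] at h2
  refine h2.trans ?_
  have h3 : ∫ x, D i (k + 1) (fun x => excess Θ (v x)) x ^ 2
      ≤ ∫ x, (5 / 9 * D i (k + 1) v x ^ 2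
        + 5 * (D i (k + 1) (fun x => excess Θ (v x)) x
          - deriv (excess Θ) (v x) * D i (k + 1) v x) ^ 2) := by
    refine integral_mono (continuous_integrable (hDP.pow 2)) (continuous_integrable (by fun_prop))
      fun x => ?_
    have h4 := hΘ.abs_deriv_excess_le (v x)
    have h5 : deriv (excess Θ) (v x) ^ 2 ≤ 4 / 9 := by
      rw [← sq_abs]; nlinarith [abs_nonneg (deriv (excess Θ) (v x))]
    have h6 : (deriv (excess Θ) (v x) * D i (k + 1) v x) ^ 2 ≤ 4 / 9 * D i (k + 1) v x ^ 2 := by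
      rw [mul_pow]; gcongr
    -- `(p + r)² ≤ (5 / 4) p² + 5 r²`, and `(5 / 4) (4 / 9) = 5 / 9`
    set p := deriv (excess Θ) (v x) * D i (k + 1) v x
    show D i (k + 1) (fun x => excess Θ (v x)) x ^ 2 ≤ _
    nlinarith [sq_nonneg (p - 4 * (D i (k + 1) (fun x => excess Θ (v x)) x - p))]
  rw [integral_add (f := fun x => 5 / 9 * D i (k + 1) v x ^ 2)
      (g := fun x => 5 * (D i (k + 1) (fun x => excess Θ (v x)) x
          - deriv (excess Θ) (v x) * D i (k + 1) v x) ^ 2)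
      (continuous_integrable (by fun_prop)) (continuous_integrable (by fun_prop)),
    integral_const_mul, integral_const_mul] at h3
  refine h3.trans (add_le_add le_rfl (mul_le_mul_of_nonneg_left (h1.trans ?_) (by norm_num)))
  exact pow_le_pow_left₀ (hC0 i) (Finset.single_le_sum (fun i _ => hC0 i) (Finset.mem_univ i)) 2

theorem integral_D_sq_of_bandlimited {k : ℕ} {v : T3 → ℝ} (hv : IsCk k v) {N : ℕ}
    (hN : ∀ n ∉ box N, fc v n = 0) (i : Fin 3) :
    ∫ x, D i k v x ^ 2 = ∑ n ∈ box N, freq n i ^ (2 * k) * ‖fc v n‖ ^ 2 := by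
  have h := hasSum_sq_fc (continuous_memLp (hv.continuous_D i le_rfl))
  simp_rw [norm_fc_D hv, mul_pow, ← pow_mul, mul_comm k 2, pow_mul |freq _ i|,
    sq_abs, ← pow_mul] at h
  exact h.unique (hasSum_sum_of_ne_finset_zero fun n hn => by simp [hN n hn])

theorem HB_velocity {k : ℕ} (hk : 8 ≤ k) {L : ℝ} {v : Fin 3 → ℝ → T3 → ℝ} (hv : IsVelocity k L v)
    {b : ℝ} {Θ : ℝ → ℝ} (hΘ : IsInverse b Θ) {K : ℝ} (hK : 0 ≤ K) :
    ∃ C, 0 ≤ C ∧ ∀ g, Continuous g → HB k g (K ^ 2) → ∀ j t,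
      HB k (fun x => v j t x * Θ (g x)) (C ^ 2) := by
  obtain ⟨C, hC0, hC⟩ := HB_comp hk hΘ.contDiff hK
  have := CS_nonneg
  have := hv.nonneg
  exact ⟨_, by positivity, fun g hg h j t => HB_mul hk hv.nonneg hC0 (hv.isCk j t)
    (fun i => hv.ctl i j t) (hΘ.contDiff.continuous.comp hg) (hC g hg h)⟩

/-- The function `w` is bounded by `R₁` in `L²(0, T; H^{k+1})` and by `R₂` in a norm stronger
than that of `C([0, T]; H^k)`: each Fourier coefficient may be evaluated at a time of its own. -/
structure TimeBound (k : ℕ) (T R₁ R₂ : ℝ) (w : ℝ → T3 → ℝ) : Prop where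
  par : ∀ (i : Fin 3) (s : Finset (Fin 3 → ℤ)),
    ∑ n ∈ s, freq n i ^ (2 * (k + 1)) * ∫ t in (0)..T, ‖fc (w t) n‖ ^ 2 ≤ R₁
  unif : ∀ τ : (Fin 3 → ℤ) → ℝ, (∀ n, τ n ∈ Icc 0 T) → ∀ s : Finset (Fin 3 → ℤ),
    ∑ n ∈ s, W k n * ‖fc (w (τ n)) n‖ ^ 2 ≤ R₂ ^ 2

theorem TimeBound.hb {k : ℕ} {T R₁ R₂ : ℝ} {w : ℝ → T3 → ℝ} (h : TimeBound k T R₁ R₂ w) {t : ℝ}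
    (ht : t ∈ Icc 0 T) : HB k (w t) (R₂ ^ 2) := fun s => h.unif (fun _ => t) (fun _ => ht) s

/-- An approximate solution: smooth, with finitely many frequencies, satisfying the bounds. -/
structure IsApprox (k : ℕ) (T R₁ R₂ : ℝ) (w : ℝ → T3 → ℝ) : Prop extends
    TimeBound k T R₁ R₂ w where
  smooth : ∀ t, IsCk ∞ (w t)
  continuous : Continuous fun p : ℝ × T3 => w p.1 p.2
  band : ∃ N : ℕ, ∀ t, ∀ n ∉ box N, fc (w t) n = 0

/-- The Fourier coefficients of the solution of the heat equation with the source of `w`. -/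
noncomputable def nextCoef (v : Fin 3 → ℝ → T3 → ℝ) (Θ : ℝ → ℝ) (a : (Fin 3 → ℤ) → ℂ)
    (w : ℝ → T3 → ℝ) (n : Fin 3 → ℤ) (t : ℝ) : ℂ :=
  duhamel (lam n) (a n) (source v Θ w n) t

/-- One step of the iteration, truncated to the frequencies in a box. -/
noncomputable def iterStep (v : Fin 3 → ℝ → T3 → ℝ) (Θ : ℝ → ℝ) (a : (Fin 3 → ℤ) → ℂ) (N : ℕ)
    (w : ℝ → T3 → ℝ) : ℝ → T3 → ℝ := fun t => trig (box N) fun n => nextCoef v Θ a w n t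

section

variable {k : ℕ} {L : ℝ} {v : Fin 3 → ℝ → T3 → ℝ} {b : ℝ} {Θ : ℝ → ℝ} {a : (Fin 3 → ℤ) → ℂ}
  {w : ℝ → T3 → ℝ}

theorem conj_nextCoef (ha : ∀ n, conj (a n) = a (-n)) (n : Fin 3 → ℤ) (t : ℝ) :
    conj (nextCoef v Θ a w n t) = nextCoef v Θ a w (-n) t := by
  unfold nextCoef
  rw [conj_duhamel, ha, funext (conj_source v Θ w n)]
  simp [lam, freq_neg]

theorem fc_iterStep (ha : ∀ n, conj (a n) = a (-n)) (N : ℕ) (t : ℝ) (n : Fin 3 → ℤ) :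
    fc (iterStep v Θ a N w t) n = if n ∈ box N then nextCoef v Θ a w n t else 0 :=
  fc_trig (fun _ => neg_mem_box) (fun n => conj_nextCoef ha n t) n

theorem continuous_nextCoef (hv : IsVelocity k L v) (hΘ : IsInverse b Θ)
    (hw : Continuous fun p : ℝ × T3 => w p.1 p.2) (n : Fin 3 → ℤ) :
    Continuous (nextCoef v Θ a w n) :=
  continuous_duhamel _ _ (continuous_source hv hΘ hw n)

theorem continuous_iterStep (hv : IsVelocity k L v) (hΘ : IsInverse b Θ)
    (hw : Continuous fun p : ℝ × T3 => w p.1 p.2) (N : ℕ) :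
    Continuous fun p : ℝ × T3 => iterStep v Θ a N w p.1 p.2 := by
  refine continuous_finsetSum _ fun n _ => Complex.continuous_re.comp ?_
  exact ((continuous_nextCoef hv hΘ hw n).comp continuous_fst).mul
    ((mFourier n).continuous.comp continuous_snd)

theorem nextCoef_freq_zero (t : ℝ) : nextCoef v Θ a w 0 t = a 0 := by
  simp [nextCoef, duhamel, source_zero, lam, freq_zero]

theorem hasDerivAt_nextCoef (hv : IsVelocity k L v) (hΘ : IsInverse b Θ)
    (hw : Continuous fun p : ℝ × T3 => w p.1 p.2) (n : Fin 3 → ℤ) (t : ℝ) :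
    HasDerivAt (nextCoef v Θ a w n)
      (-(lam n : ℂ) * nextCoef v Θ a w n t + source v Θ w n t) t :=
  hasDerivAt_duhamel _ _ (continuous_source hv hΘ hw n) t

end

/-- Young's inequality for the mixed products: the Fourier weight of `H^{k+1}` without its term of
order zero controls `W k · lam`. -/
theorem W_mul_lam_le (k : ℕ) (n : Fin 3 → ℤ) :
    W k n * lam n ≤ 7 * ∑ i, freq n i ^ (2 * (k + 1)) := by
  have h1 : ∀ i, freq n i ^ 2 ≤ freq n i ^ (2 * (k + 1)) := fun i => by
    rw [pow_mul]
    rcases freq_sq_cases n i with h | h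
    · simp [h]
    · exact le_self_pow₀ h (by omega)
  have h2 : ∀ i j, freq n i ^ (2 * k) * freq n j ^ 2
      ≤ freq n i ^ (2 * (k + 1)) + freq n j ^ (2 * (k + 1)) := fun i j => by
    simp_rw [pow_mul]
    have hi := sq_nonneg (freq n i)
    have hj := sq_nonneg (freq n j)
    rcases le_total (freq n i ^ 2) (freq n j ^ 2) with h | h
    · calc (freq n i ^ 2) ^ k * freq n j ^ 2 ≤ (freq n j ^ 2) ^ k * freq n j ^ 2 := by gcongr
        _ = (freq n j ^ 2) ^ (k + 1) := by ring
        _ ≤ _ := by have := pow_nonneg hi (k + 1); linarith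
    · calc (freq n i ^ 2) ^ k * freq n j ^ 2 ≤ (freq n i ^ 2) ^ k * freq n i ^ 2 := by gcongr
        _ = (freq n i ^ 2) ^ (k + 1) := by ring
        _ ≤ _ := by have := pow_nonneg hj (k + 1); linarith
  simp only [W, lam, Fin.sum_univ_three] at *
  have := h1 0; have := h1 1; have := h1 2
  have := h2 0 0; have := h2 0 1; have := h2 0 2
  have := h2 1 0; have := h2 1 1; have := h2 1 2
  have := h2 2 0; have := h2 2 1; have := h2 2 2
  nlinarith

theorem freq_pow_le_lam_mul_W (k : ℕ) (n : Fin 3 → ℤ) (i : Fin 3) :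
    freq n i ^ (2 * (k + 1)) ≤ lam n * W k n := by
  have h1 := freq_sq_le_lam n i
  have h2 := freq_pow_le_W (le_refl k) n i
  calc freq n i ^ (2 * (k + 1)) = freq n i ^ 2 * freq n i ^ (2 * k) := by ring
    _ ≤ _ := mul_le_mul h1 h2 (by rw [pow_mul]; positivity) (lam_nonneg n)

theorem intervalIntegrable_sq_fc {g : ℝ → T3 → ℝ} (hg : Continuous fun p : ℝ × T3 => g p.1 p.2)
    (n : Fin 3 → ℤ) (a b : ℝ) : IntervalIntegrable (fun t => ‖fc (g t) n‖ ^ 2) volume a b :=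
  ((continuous_fc hg n).norm.pow 2).intervalIntegrable _ _

theorem integral_excess_le {k : ℕ} {b : ℝ} {Θ : ℝ → ℝ} (hΘ : IsInverse b Θ)
    {T R₁ R₂ C : ℝ} (hT : 0 ≤ T)
    (hC : ∀ v, IsCk ∞ v → HB k v (R₂ ^ 2) → ∀ (i : Fin 3) (s : Finset (Fin 3 → ℤ)),
      ∑ n ∈ s, freq n i ^ (2 * (k + 1)) * ‖fc (fun x => excess Θ (v x)) n‖ ^ 2
        ≤ 5 / 9 * (∫ x, D i (k + 1) v x ^ 2) + 5 * C ^ 2)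
    {w : ℝ → T3 → ℝ} (hw : IsApprox k T R₁ R₂ w) (i : Fin 3) (s : Finset (Fin 3 → ℤ)) :
    ∑ n ∈ s, freq n i ^ (2 * (k + 1)) * (∫ t in (0)..T, ‖fc (fun x => excess Θ (w t x)) n‖ ^ 2)
      ≤ 5 / 9 * R₁ + 5 * C ^ 2 * T := by
  obtain ⟨N, hN⟩ := hw.band
  have hP : Continuous fun p : ℝ × T3 => excess Θ (w p.1 p.2) :=
    hΘ.excess_contDiff.continuous.comp hw.continuous
  have iP := fun n => intervalIntegrable_sq_fc (g := fun t x => excess Θ (w t x)) hP n 0 T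
  have iw := fun n => intervalIntegrable_sq_fc hw.continuous n 0 T
  simp_rw [← intervalIntegral.integral_const_mul]
  rw [← intervalIntegral.integral_finsetSum fun n _ => (iP n).const_mul _]
  have h1 : ∫ t in (0)..T, ∑ n ∈ s, freq n i ^ (2 * (k + 1))
        * ‖fc (fun x => excess Θ (w t x)) n‖ ^ 2
      ≤ ∫ t in (0)..T, (5 / 9 * (∑ n ∈ box N, freq n i ^ (2 * (k + 1)) * ‖fc (w t) n‖ ^ 2)
        + 5 * C ^ 2) := by
    refine intervalIntegral.integral_mono_on hT ?_ ?_ fun t ht => ?_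
    · have h := IntervalIntegrable.sum s fun n _ => (iP n).const_mul (freq n i ^ (2 * (k + 1)))
      simpa only [Finset.sum_apply, Finset.sum_fn] using h
    · refine Continuous.intervalIntegrable ?_ _ _
      have := fun n => continuous_fc hw.continuous n
      fun_prop
    · rw [← integral_D_sq_of_bandlimited ((hw.smooth t).nat _) (hN t)]
      exact hC _ (hw.smooth t) (hw.hb ht) i s
  refine h1.trans ?_
  have := fun n => continuous_fc hw.continuous n
  rw [intervalIntegral.integral_add (Continuous.intervalIntegrable (by fun_prop) _ _)
    (Continuous.intervalIntegrable (by fun_prop) _ _), intervalIntegral.integral_const_mul,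
    intervalIntegral.integral_finsetSum fun n _ => (iw n).const_mul _]
  simp_rw [intervalIntegral.integral_const_mul, intervalIntegral.integral_const]
  have := hw.par i (box N)
  rw [smul_eq_mul]
  nlinarith

theorem integral_velocity_le {k : ℕ} {L : ℝ} {v : Fin 3 → ℝ → T3 → ℝ} (hv : IsVelocity k L v)
    {b : ℝ} {Θ : ℝ → ℝ} (hΘ : IsInverse b Θ) {T R₁ R₂ C : ℝ} (hT : 0 ≤ T)
    (hC : ∀ g, Continuous g → HB k g (R₂ ^ 2) → ∀ j t,
      HB k (fun x => v j t x * Θ (g x)) (C ^ 2))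
    {w : ℝ → T3 → ℝ} (hwc : Continuous fun p : ℝ × T3 => w p.1 p.2) (hw : TimeBound k T R₁ R₂ w)
    (j : Fin 3) (s : Finset (Fin 3 → ℤ)) :
    ∑ n ∈ s, W k n * (∫ t in (0)..T, ‖fc (fun x => v j t x * Θ (w t x)) n‖ ^ 2) ≤ C ^ 2 * T := by
  have hP : Continuous fun p : ℝ × T3 => v j p.1 p.2 * Θ (w p.1 p.2) :=
    (hv.continuous j).mul (hΘ.contDiff.continuous.comp hwc)
  have iP := fun n => intervalIntegrable_sq_fc (g := fun t x => v j t x * Θ (w t x)) hP n 0 T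
  simp_rw [← intervalIntegral.integral_const_mul]
  rw [← intervalIntegral.integral_finsetSum fun n _ => (iP n).const_mul _]
  have h1 : ∫ t in (0)..T, ∑ n ∈ s, W k n * ‖fc (fun x => v j t x * Θ (w t x)) n‖ ^ 2
      ≤ ∫ t in (0)..T, C ^ 2 := by
    refine intervalIntegral.integral_mono_on hT ?_ (by simp) fun t ht => ?_
    · have h := IntervalIntegrable.sum s fun n _ => (iP n).const_mul (W k n)
      simpa only [Finset.sum_apply, Finset.sum_fn] using h
    · exact hC _ (continuous_curry_right hwc t) (hw.hb ht) j t s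
  refine h1.trans (le_of_eq ?_)
  rw [intervalIntegral.integral_const, smul_eq_mul]; ring

/-! ### Bounds preserved by the iteration -/

section

variable {k : ℕ} {L : ℝ} {v : Fin 3 → ℝ → T3 → ℝ} {b : ℝ} {Θ : ℝ → ℝ} {a : (Fin 3 → ℤ) → ℂ}
  {w : ℝ → T3 → ℝ}

/-- The unweighted energy inequality for the next iterate. -/
theorem energy_nextCoef (hv : IsVelocity k L v) (hΘ : IsInverse b Θ)
    (hw : Continuous fun p : ℝ × T3 => w p.1 p.2) {n : Fin 3 → ℤ} (hn : n ≠ 0) {T t : ℝ}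
    (ht : t ∈ Icc 0 T) :
    ‖nextCoef v Θ a w n t‖ ^ 2 + lam n * ∫ s in (0)..t, ‖nextCoef v Θ a w n s‖ ^ 2
      ≤ ‖a n‖ ^ 2 + (5 / 4 * lam n * (∫ s in (0)..T, ‖fc (fun x => excess Θ (w s x)) n‖ ^ 2)
        + 5 * ∑ j, ∫ s in (0)..T, ‖fc (fun x => v j s x * Θ (w s x)) n‖ ^ 2) := by
  have cP : Continuous fun p : ℝ × T3 => excess Θ (w p.1 p.2) :=
    hΘ.excess_contDiff.continuous.comp hw
  have cV : ∀ j, Continuous fun p : ℝ × T3 => v j p.1 p.2 * Θ (w p.1 p.2) := fun j =>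
    (hv.continuous j).mul (hΘ.contDiff.continuous.comp hw)
  have h := energy_heat (μ := 0) hn (continuous_nextCoef (a := a) hv hΘ hw n)
    (continuous_fc (g := fun t x => excess Θ (w t x)) cP n)
    (fun j => continuous_fc (g := fun t x => v j t x * Θ (w t x)) (cV j) n)
    (fun t _ => hasDerivAt_nextCoef hv hΘ hw n t) ht
  simp only [mul_zero, zero_mul, Real.exp_zero, one_mul, add_zero] at h
  have h0 : nextCoef v Θ a w n 0 = a n := duhamel_zero _ _ _
  rw [h0] at h
  refine h.trans (add_le_add le_rfl (add_le_add ?_ ?_))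
  · refine mul_le_mul_of_nonneg_left ?_ (by have := lam_nonneg n; positivity)
    exact intervalIntegral.integral_mono_interval le_rfl ht.1 ht.2
      (Eventually.of_forall fun _ => sq_nonneg _)
      (intervalIntegrable_sq_fc (g := fun t x => excess Θ (w t x)) cP n 0 T)
  · refine mul_le_mul_of_nonneg_left (Finset.sum_le_sum fun j _ => ?_) (by norm_num)
    exact intervalIntegral.integral_mono_interval le_rfl ht.1 ht.2
      (Eventually.of_forall fun _ => sq_nonneg _)
      (intervalIntegrable_sq_fc (g := fun t x => v j t x * Θ (w t x)) (cV j) n 0 T)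

/-- The energy inequality for one frequency, multiplied by the weight `x` of a pure derivative of
order `k + 1`: here `l` stands for `lam`, `m` for `W k`, and `Y` for the time integral of the square
of the coefficient. -/
theorem weighted_energy_par {l x m A P S Y : ℝ} (hl : 0 < l) (hx : 0 ≤ x) (hxl : x ≤ l * m)
    (hA : 0 ≤ A) (hS : 0 ≤ S) (h : l * Y ≤ A + (5 / 4 * l * P + 5 * S)) :
    x * Y ≤ m * A + 5 / 4 * (x * P) + 5 * (m * S) := by
  refine le_of_mul_le_mul_left ?_ hl
  calc l * (x * Y) = x * (l * Y) := by ring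
    _ ≤ x * (A + (5 / 4 * l * P + 5 * S)) := by gcongr
    _ = x * (A + 5 * S) + l * (5 / 4 * (x * P)) := by ring
    _ ≤ l * m * (A + 5 * S) + l * (5 / 4 * (x * P)) := by gcongr
    _ = _ := by ring

/-- The energy inequality for one frequency, multiplied by the weight `m` of `H^k`: here `Y` stands
for the square of the coefficient at one time, and `X` for the weight of order `k + 1`. -/
theorem weighted_energy_unif {l X m A P S Y : ℝ} (hm : 0 ≤ m) (hmX : m * l ≤ 7 * X) (hP : 0 ≤ P)
    (h : Y ≤ A + (5 / 4 * l * P + 5 * S)) :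
    m * Y ≤ m * A + 35 / 4 * (X * P) + 5 * (m * S) := by
  calc m * Y ≤ m * (A + (5 / 4 * l * P + 5 * S)) := by gcongr
    _ = m * A + 5 / 4 * ((m * l) * P) + 5 * (m * S) := by ring
    _ ≤ m * A + 5 / 4 * ((7 * X) * P) + 5 * (m * S) := by gcongr
    _ = _ := by ring

/-- The bounds that the iteration preserves, on a time interval that depends only on the size of
the data. -/
theorem exists_isApprox_iterStep (hk : 8 ≤ k) (hv : IsVelocity k L v) (hΘ : IsInverse b Θ)
    {M₀ : ℝ} (hM : 0 ≤ M₀) :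
    ∃ R₁ R₂ T₀ : ℝ, 0 ≤ R₁ ∧ 0 ≤ R₂ ∧ 0 < T₀ ∧ T₀ ≤ 1 ∧ ∀ T, 0 ≤ T → T ≤ T₀ → ∀ w,
      IsApprox k T R₁ R₂ w →
      (∀ (i : Fin 3) (s : Finset (Fin 3 → ℤ)), ∑ n ∈ s, freq n i ^ (2 * (k + 1))
        * (∫ t in (0)..T, ‖fc (fun x => excess Θ (w t x)) n‖ ^ 2) ≤ R₁ + 1) ∧
      ∀ a : (Fin 3 → ℤ) → ℂ, (∀ n, conj (a n) = a (-n)) →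
        (∀ s : Finset (Fin 3 → ℤ), ∑ n ∈ s, W k n * ‖a n‖ ^ 2 ≤ M₀) →
        ∀ N, IsApprox k T R₁ R₂ (iterStep v Θ a N w) := by
  -- One step gives the bound `M₀ + (5 / 4) (5 / 9) R₁ + C₃ T` in `L²(0, T; H^{k+1})`, up to the size
  -- of the last constant. Since `(5 / 4) (5 / 9) = 25 / 36 < 3 / 4`, it is at most `R₁` for small `T`.
  -- The bound in `H^k` does not have to be small compared to `R₂`, which is chosen afterwards.
  set R₁ := 4 * M₀ + 4 with hR₁
  set R₂ := √(M₀ + 15 * R₁ + 1) with hR₂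
  have hR₂0 : 0 ≤ R₂ := Real.sqrt_nonneg _
  have hR₂2 : R₂ ^ 2 = M₀ + 15 * R₁ + 1 := Real.sq_sqrt (by positivity)
  obtain ⟨C, hC0, hC⟩ := sum_excess_le hk hΘ hR₂0
  obtain ⟨CV, hCV0, hCV⟩ := HB_velocity hk hv hΘ hR₂0
  set C₃ := 132 * C ^ 2 + 15 * CV ^ 2 + 1 with hC₃
  have hC₃0 : 1 ≤ C₃ := by have := sq_nonneg C; have := sq_nonneg CV; linarith
  refine ⟨R₁, R₂, 1 / C₃, by positivity, hR₂0, by positivity,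
    by rw [div_le_one (by linarith)]; exact hC₃0, fun T hT hT0 w hw => ?_⟩
  have hTC : C₃ * T ≤ 1 := by
    rw [le_div_iff₀ (by linarith)] at hT0; linarith
  have hTC1 : 132 * (C ^ 2 * T) + 15 * (CV ^ 2 * T) ≤ 1 := by nlinarith
  have hCT : 0 ≤ C ^ 2 * T := by positivity
  have hCVT : 0 ≤ CV ^ 2 * T := by positivity
  have hP := integral_excess_le hΘ hT hC hw
  have hV := integral_velocity_le hv hΘ hT hCV hw.continuous hw.toTimeBound
  refine ⟨fun i s => (hP i s).trans (by nlinarith), fun a ha ha0 N => ?_⟩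
  have hsm : ∀ t, IsCk ∞ (iterStep v Θ a N w t) := fun t => isCk_trig _ _
  set IP : (Fin 3 → ℤ) → ℝ := fun n => ∫ t in (0)..T, ‖fc (fun x => excess Θ (w t x)) n‖ ^ 2
  set IV : Fin 3 → (Fin 3 → ℤ) → ℝ := fun j n =>
    ∫ t in (0)..T, ‖fc (fun x => v j t x * Θ (w t x)) n‖ ^ 2
  have hIP0 : ∀ n, 0 ≤ IP n := fun n => intervalIntegral.integral_nonneg hT fun _ _ => sq_nonneg _
  have hIV0 : ∀ j n, 0 ≤ IV j n := fun j n =>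
    intervalIntegral.integral_nonneg hT fun _ _ => sq_nonneg _
  have hVs : ∀ s : Finset (Fin 3 → ℤ), ∑ n ∈ s, W k n * ∑ j, IV j n ≤ 3 * (CV ^ 2 * T) := by
    intro s
    simp_rw [Finset.mul_sum]
    rw [Finset.sum_comm]
    refine (Finset.sum_le_sum fun j _ => hV j s).trans (le_of_eq ?_)
    rw [Finset.sum_const, Finset.card_univ, Fintype.card_fin]; simp only [nsmul_eq_mul, Nat.cast_ofNat]
  have hE : ∀ n, n ≠ 0 → ∀ t ∈ Icc 0 T,
      ‖nextCoef v Θ a w n t‖ ^ 2 + lam n * (∫ s in (0)..t, ‖nextCoef v Θ a w n s‖ ^ 2)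
        ≤ ‖a n‖ ^ 2 + (5 / 4 * lam n * IP n + 5 * ∑ j, IV j n) := fun n h0 t ht =>
    energy_nextCoef (a := a) hv hΘ hw.continuous h0 ht
  have hPs : ∀ (i : Fin 3) (s : Finset (Fin 3 → ℤ)),
      ∑ n ∈ s, freq n i ^ (2 * (k + 1)) * IP n ≤ 5 / 9 * R₁ + 5 * C ^ 2 * T := hP
  clear_value IP IV
  refine ⟨⟨fun i s => ?_, fun τ hτ s => ?_⟩, hsm, continuous_iterStep hv hΘ hw.continuous N,
    ⟨N, fun t n hn => ?_⟩⟩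
  · have h1 : ∀ n ∈ s, freq n i ^ (2 * (k + 1))
          * (∫ t in (0)..T, ‖fc (iterStep v Θ a N w t) n‖ ^ 2)
        ≤ W k n * ‖a n‖ ^ 2 + 5 / 4 * (freq n i ^ (2 * (k + 1)) * IP n)
          + 5 * (W k n * ∑ j, IV j n) := by
      intro n _
      have hx : 0 ≤ freq n i ^ (2 * (k + 1)) := by rw [pow_mul]; positivity
      have hS : 0 ≤ ∑ j, IV j n := Finset.sum_nonneg fun j _ => hIV0 j n
      have hWn := W_pos k n
      have hpos : 0 ≤ W k n * ‖a n‖ ^ 2 + 5 / 4 * (freq n i ^ (2 * (k + 1)) * IP n)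
          + 5 * (W k n * ∑ j, IV j n) := by have := hIP0 n; positivity
      by_cases h0 : n = 0
      · have : freq n i ^ (2 * (k + 1)) = 0 := by rw [h0, freq_zero]; simp
        rw [this, zero_mul] at hpos
        rw [this, zero_mul, zero_mul]
        exact hpos
      simp_rw [fc_iterStep ha]
      split_ifs with hb
      swap
      · simpa using hpos
      have hl := lam_pos h0
      have h2 := hE n h0 T (right_mem_Icc.2 hT)
      set Y := ∫ t in (0)..T, ‖nextCoef v Θ a w n t‖ ^ 2
      have h3 : lam n * Y ≤ ‖a n‖ ^ 2 + (5 / 4 * lam n * IP n + 5 * ∑ j, IV j n) := by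
        have := sq_nonneg ‖nextCoef v Θ a w n T‖
        linarith
      exact weighted_energy_par hl hx (freq_pow_le_lam_mul_W k n i) (sq_nonneg _) hS h3
    refine (Finset.sum_le_sum h1).trans ?_
    rw [Finset.sum_add_distrib, Finset.sum_add_distrib, ← Finset.mul_sum, ← Finset.mul_sum]
    have h2 := ha0 s
    have h3 := hPs i s
    have h4 := hVs s
    nlinarith
  · have h1 : ∀ n ∈ s, W k n * ‖fc (iterStep v Θ a N w (τ n)) n‖ ^ 2
        ≤ W k n * ‖a n‖ ^ 2 + 35 / 4 * ∑ i, freq n i ^ (2 * (k + 1)) * IP n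
          + 5 * (W k n * ∑ j, IV j n) := by
      intro n _
      have hx : 0 ≤ ∑ i, freq n i ^ (2 * (k + 1)) * IP n := Finset.sum_nonneg fun i _ => by
        rw [pow_mul]; have := hIP0 n; positivity
      have hS : 0 ≤ ∑ j, IV j n := Finset.sum_nonneg fun j _ => hIV0 j n
      have hWn := W_pos k n
      rw [fc_iterStep ha]
      split_ifs with hb
      swap
      · rw [norm_zero, zero_pow two_ne_zero, mul_zero]; positivity
      by_cases h0 : n = 0
      · subst h0
        rw [nextCoef_freq_zero]
        have : 0 ≤ W k 0 * ∑ j, IV j 0 := by positivity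
        linarith
      have hl := lam_pos h0
      have h2 := hE n h0 _ (hτ n)
      have h3 : 0 ≤ ∫ s in (0)..τ n, ‖nextCoef v Θ a w n s‖ ^ 2 :=
        intervalIntegral.integral_nonneg (hτ n).1 fun _ _ => sq_nonneg _
      rw [← Finset.sum_mul]
      refine weighted_energy_unif hWn.le (W_mul_lam_le k n) (hIP0 n) ?_
      have := mul_nonneg hl.le h3
      linarith
    refine (Finset.sum_le_sum h1).trans ?_
    rw [Finset.sum_add_distrib, Finset.sum_add_distrib, ← Finset.mul_sum, ← Finset.mul_sum,
      Finset.sum_comm]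
    have h2 := ha0 s
    have h3 : ∑ i, ∑ n ∈ s, freq n i ^ (2 * (k + 1)) * IP n ≤ 3 * (5 / 9 * R₁ + 5 * C ^ 2 * T) := by
      refine (Finset.sum_le_sum fun i _ => hPs i s).trans (le_of_eq ?_)
      rw [Finset.sum_const, Finset.card_univ, Fintype.card_fin]; simp only [nsmul_eq_mul, Nat.cast_ofNat]
    have h4 := hVs s
    rw [hR₂2]
    nlinarith
  · rw [fc_iterStep ha, if_neg hn]

theorem isApprox_zero {T R₁ R₂ : ℝ} (hR₁ : 0 ≤ R₁) :
    IsApprox k T R₁ R₂ fun _ _ => 0 := by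
  have h : ∀ n, fc (fun _ => 0) n = 0 := fun n => by simp [fc]
  refine ⟨⟨fun i s => ?_, fun τ _ s => ?_⟩, fun _ => contDiff_const, continuous_const,
    ⟨0, fun t n _ => h n⟩⟩
  · simpa [h] using hR₁
  · simpa [h] using sq_nonneg R₂

end

/-! ### Contraction and uniqueness in Fourier form -/

/-- The square of a weighted `L²((0, T) × T3)` norm. -/
noncomputable def wnorm (μ T : ℝ) (g : ℝ → T3 → ℝ) : ℝ :=
  ∫ t in (0)..T, Real.exp (-2 * μ * t) * ∫ x : T3, g t x ^ 2

theorem wnorm_nonneg (μ : ℝ) {T : ℝ} (hT : 0 ≤ T) (g : ℝ → T3 → ℝ) : 0 ≤ wnorm μ T g :=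
  intervalIntegral.integral_nonneg hT fun _ _ =>
    mul_nonneg (Real.exp_pos _).le (integral_nonneg fun _ => sq_nonneg _)

theorem intervalIntegrable_weighted {f : ℝ → ℂ} (hf : Continuous f) (μ a b : ℝ) :
    IntervalIntegrable (fun t => Real.exp (-2 * μ * t) * ‖f t‖ ^ 2) volume a b :=
  Continuous.intervalIntegrable (by fun_prop) _ _

theorem continuous_wnorm_integrand {g : ℝ → T3 → ℝ} (hg : Continuous fun p : ℝ × T3 => g p.1 p.2)
    (μ : ℝ) : Continuous fun t => Real.exp (-2 * μ * t) * ∫ x : T3, g t x ^ 2 := by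
  have := continuous_integral_sq hg
  fun_prop

/-- Bessel's inequality in space-time. -/
theorem sum_weighted_le {μ T κ : ℝ} (hT : 0 ≤ T) {F G g : ℝ → T3 → ℝ}
    (hF : Continuous fun p : ℝ × T3 => F p.1 p.2) (hG : Continuous fun p : ℝ × T3 => G p.1 p.2)
    (hg : Continuous fun p : ℝ × T3 => g p.1 p.2)
    (h : ∀ t x, |F t x - G t x| ≤ κ * |g t x|) (s : Finset (Fin 3 → ℤ)) :
    ∑ n ∈ s, (∫ t in (0)..T, Real.exp (-2 * μ * t) * ‖fc (F t) n - fc (G t) n‖ ^ 2)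
      ≤ κ ^ 2 * wnorm μ T g := by
  have hc : ∀ n, Continuous fun t => fc (F t) n - fc (G t) n := fun n =>
    (continuous_fc hF n).sub (continuous_fc hG n)
  rw [← intervalIntegral.integral_finsetSum fun n _ => intervalIntegrable_weighted (hc n) μ 0 T,
    wnorm, ← intervalIntegral.integral_const_mul]
  have h1 := continuous_wnorm_integrand hg μ
  refine intervalIntegral.integral_mono_on hT (Continuous.intervalIntegrable
    (continuous_finsetSum _ fun n _ => by have := hc n; fun_prop) _ _)
    (Continuous.intervalIntegrable (by fun_prop) _ _) fun t _ => ?_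
  have cF := continuous_curry_right hF t
  have cG := continuous_curry_right hG t
  have cg := continuous_curry_right hg t
  rw [← Finset.mul_sum, mul_left_comm]
  refine mul_le_mul_of_nonneg_left ?_ (Real.exp_pos _).le
  simp_rw [← fc_sub (continuous_integrable cF) (continuous_integrable cG)]
  refine (sum_sq_fc_le (continuous_memLp (cF.sub cG)) s).trans ?_
  rw [← integral_const_mul]
  refine integral_mono (continuous_integrable (by fun_prop)) (continuous_integrable (by fun_prop))
    fun x => ?_
  show (F t x - G t x) ^ 2 ≤ κ ^ 2 * g t x ^ 2
  rw [← sq_abs, ← sq_abs (g t x), ← mul_pow]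
  exact pow_le_pow_left₀ (abs_nonneg _) (h t x) 2

/-- Parseval's identity in space-time, as an inequality. -/
theorem wnorm_le_of_sum_le {μ T R : ℝ} {g : ℝ → T3 → ℝ}
    (hg : Continuous fun p : ℝ × T3 => g p.1 p.2)
    (h : ∀ N : ℕ, ∑ n ∈ box N, (∫ t in (0)..T, Real.exp (-2 * μ * t) * ‖fc (g t) n‖ ^ 2) ≤ R) :
    wnorm μ T g ≤ R := by
  have hc := fun n => continuous_fc hg n
  have hs : ∀ t, HasSum (fun n => ‖fc (g t) n‖ ^ 2) (∫ x : T3, g t x ^ 2) := fun t =>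
    hasSum_sq_fc (continuous_memLp (continuous_curry_right hg t))
  have hlim : Tendsto (fun N => ∫ t in (0)..T, Real.exp (-2 * μ * t)
      * ∑ n ∈ box N, ‖fc (g t) n‖ ^ 2) atTop (𝓝 (wnorm μ T g)) := by
    refine intervalIntegral.tendsto_integral_filter_of_dominated_convergence
      (fun t => Real.exp (-2 * μ * t) * ∫ x : T3, g t x ^ 2) ?_ ?_ ?_ ?_
    · refine Eventually.of_forall fun N => Continuous.aestronglyMeasurable ?_
      fun_prop
    · refine Eventually.of_forall fun N => Eventually.of_forall fun t _ => ?_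
      rw [Real.norm_eq_abs, abs_of_nonneg (mul_nonneg (Real.exp_pos _).le
        (Finset.sum_nonneg fun _ _ => sq_nonneg _))]
      exact mul_le_mul_of_nonneg_left (sum_le_hasSum _ (fun _ _ => sq_nonneg _) (hs t))
        (Real.exp_pos _).le
    · exact (continuous_wnorm_integrand hg μ).intervalIntegrable _ _
    · exact Eventually.of_forall fun t _ => ((hs t).comp tendsto_box).const_mul _
  refine le_of_tendsto hlim (Eventually.of_forall fun N => ?_)
  refine le_trans (le_of_eq ?_) (h N)
  rw [← intervalIntegral.integral_finsetSum fun n _ => intervalIntegrable_weighted (hc n) μ 0 T]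
  simp_rw [Finset.mul_sum]

section

variable {k : ℕ} {L : ℝ} {v : Fin 3 → ℝ → T3 → ℝ} {b : ℝ} {Θ : ℝ → ℝ} {a : (Fin 3 → ℤ) → ℂ}
  {w w' : ℝ → T3 → ℝ}

theorem energy_nextCoef_sub (hv : IsVelocity k L v) (hΘ : IsInverse b Θ)
    (hw : Continuous fun p : ℝ × T3 => w p.1 p.2) (hw' : Continuous fun p : ℝ × T3 => w' p.1 p.2)
    {n : Fin 3 → ℤ} (hn : n ≠ 0) (μ : ℝ) {T t : ℝ} (ht : t ∈ Icc 0 T) :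
    Real.exp (-2 * μ * t) * ‖nextCoef v Θ a w n t - nextCoef v Θ a w' n t‖ ^ 2
      + (lam n + 2 * μ) * (∫ s in (0)..t, Real.exp (-2 * μ * s)
        * ‖nextCoef v Θ a w n s - nextCoef v Θ a w' n s‖ ^ 2)
      ≤ 5 / 4 * lam n * (∫ s in (0)..T, Real.exp (-2 * μ * s)
          * ‖fc (fun x => excess Θ (w s x)) n - fc (fun x => excess Θ (w' s x)) n‖ ^ 2)
        + 5 * ∑ j, ∫ s in (0)..T, Real.exp (-2 * μ * s)
          * ‖fc (fun x => v j s x * Θ (w s x)) n - fc (fun x => v j s x * Θ (w' s x)) n‖ ^ 2 := by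
  have cP : ∀ {w : ℝ → T3 → ℝ}, (Continuous fun p : ℝ × T3 => w p.1 p.2) →
      Continuous fun t => fc (fun x => excess Θ (w t x)) n := fun {w} hw =>
    continuous_fc (g := fun t x => excess Θ (w t x)) (hΘ.excess_contDiff.continuous.comp hw) n
  have cV : ∀ {w : ℝ → T3 → ℝ}, (Continuous fun p : ℝ × T3 => w p.1 p.2) → ∀ j,
      Continuous fun t => fc (fun x => v j t x * Θ (w t x)) n := fun {w} hw j =>
    continuous_fc (g := fun t x => v j t x * Θ (w t x))
      ((hv.continuous j).mul (hΘ.contDiff.continuous.comp hw)) n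
  have hd : ∀ t ∈ Ioo 0 T, HasDerivAt (fun t => nextCoef v Θ a w n t - nextCoef v Θ a w' n t)
      (-(lam n : ℂ) * (nextCoef v Θ a w n t - nextCoef v Θ a w' n t)
        + (lam n * (fc (fun x => excess Θ (w t x)) n - fc (fun x => excess Θ (w' t x)) n)
          - ∑ j, Complex.I * freq n j * (fc (fun x => v j t x * Θ (w t x)) n
            - fc (fun x => v j t x * Θ (w' t x)) n))) t := fun t _ => by
    refine ((hasDerivAt_nextCoef hv hΘ hw n t).sub
      (hasDerivAt_nextCoef hv hΘ hw' n t)).congr_deriv ?_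
    simp only [source, mul_sub, Finset.sum_sub_distrib]
    ring
  have h := energy_heat (μ := μ) hn
    ((continuous_nextCoef (a := a) hv hΘ hw n).sub (continuous_nextCoef (a := a) hv hΘ hw' n))
    ((cP hw).sub (cP hw')) (fun j => (cV hw j).sub (cV hw' j)) hd ht
  simp only [Pi.sub_apply] at h
  have h0 : nextCoef v Θ a w n 0 - nextCoef v Θ a w' n 0 = 0 := by
    simp only [nextCoef, duhamel_zero, sub_self]
  rw [h0, norm_zero, zero_pow two_ne_zero, zero_add] at h
  have hl := lam_nonneg n
  refine h.trans (add_le_add (mul_le_mul_of_nonneg_left ?_ (by positivity))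
    (mul_le_mul_of_nonneg_left (Finset.sum_le_sum fun j _ => ?_) (by norm_num)))
  · exact intervalIntegral.integral_mono_interval le_rfl ht.1 ht.2
      (Eventually.of_forall fun _ => by positivity)
      (intervalIntegrable_weighted ((cP hw).sub (cP hw')) μ 0 T)
  · exact intervalIntegral.integral_mono_interval le_rfl ht.1 ht.2
      (Eventually.of_forall fun _ => by positivity)
      (intervalIntegrable_weighted ((cV hw j).sub (cV hw' j)) μ 0 T)

theorem IsVelocity.abs_le (hk : 4 ≤ k) (hv : IsVelocity k L v) (j : Fin 3) (t : ℝ) (x : T3) :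
    |v j t x| ≤ L := by
  have := (hv.ctl 0 j t).sup 0 (Nat.zero_le _) (by omega) x
  rwa [D_zero] at this

theorem sum_excess_sub_le (hΘ : IsInverse b Θ)
    (hw : Continuous fun p : ℝ × T3 => w p.1 p.2) (hw' : Continuous fun p : ℝ × T3 => w' p.1 p.2)
    (μ : ℝ) {T : ℝ} (hT : 0 ≤ T) (s : Finset (Fin 3 → ℤ)) :
    ∑ n ∈ s, (∫ s in (0)..T, Real.exp (-2 * μ * s)
        * ‖fc (fun x => excess Θ (w s x)) n - fc (fun x => excess Θ (w' s x)) n‖ ^ 2)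
      ≤ 4 / 9 * wnorm μ T fun t x => w t x - w' t x := by
  have h := sum_weighted_le (μ := μ) hT (F := fun t x => excess Θ (w t x))
    (G := fun t x => excess Θ (w' t x)) (g := fun t x => w t x - w' t x)
    (hΘ.excess_contDiff.continuous.comp hw) (hΘ.excess_contDiff.continuous.comp hw') (hw.sub hw')
    (fun t x => hΘ.excess_lipschitz _ _) s
  refine h.trans (le_of_eq ?_)
  norm_num

theorem sum_velocity_sub_le (hk : 4 ≤ k) (hv : IsVelocity k L v) (hΘ : IsInverse b Θ)
    (hw : Continuous fun p : ℝ × T3 => w p.1 p.2) (hw' : Continuous fun p : ℝ × T3 => w' p.1 p.2)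
    (μ : ℝ) {T : ℝ} (hT : 0 ≤ T) (s : Finset (Fin 3 → ℤ)) :
    ∑ n ∈ s, ∑ j, (∫ s in (0)..T, Real.exp (-2 * μ * s)
        * ‖fc (fun x => v j s x * Θ (w s x)) n - fc (fun x => v j s x * Θ (w' s x)) n‖ ^ 2)
      ≤ 3 * L ^ 2 * wnorm μ T fun t x => w t x - w' t x := by
  rw [Finset.sum_comm]
  have h : ∀ j ∈ Finset.univ, _ := fun j (_ : j ∈ Finset.univ) =>
    sum_weighted_le (μ := μ) (κ := L) hT (F := fun t x => v j t x * Θ (w t x))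
    (G := fun t x => v j t x * Θ (w' t x)) (g := fun t x => w t x - w' t x)
    ((hv.continuous j).mul (hΘ.contDiff.continuous.comp hw))
    ((hv.continuous j).mul (hΘ.contDiff.continuous.comp hw')) (hw.sub hw')
    (fun t x => by
      rw [← mul_sub, abs_mul]
      exact mul_le_mul (hv.abs_le hk j t x) (hΘ.lipschitz _ _) (abs_nonneg _) hv.nonneg) s
  refine (Finset.sum_le_sum h).trans (le_of_eq ?_)
  rw [Finset.sum_const, Finset.card_univ, Fintype.card_fin]
  simp only [nsmul_eq_mul, Nat.cast_ofNat]
  ring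

/-- With the weight `exp (-2 μ t)`, `μ = 75 L² + 1`, the map from a function to the solution of
the heat equation with its source is a contraction. -/
theorem sum_nextCoef_sub_le (hk : 4 ≤ k) (hv : IsVelocity k L v) (hΘ : IsInverse b Θ)
    (hw : Continuous fun p : ℝ × T3 => w p.1 p.2) (hw' : Continuous fun p : ℝ × T3 => w' p.1 p.2)
    {T : ℝ} (hT : 0 ≤ T) (s : Finset (Fin 3 → ℤ)) :
    ∑ n ∈ s, (∫ t in (0)..T, Real.exp (-2 * (75 * L ^ 2 + 1) * t)
        * ‖nextCoef v Θ a w n t - nextCoef v Θ a w' n t‖ ^ 2)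
      ≤ 2 / 3 * wnorm (75 * L ^ 2 + 1) T fun t x => w t x - w' t x := by
  set μ := 75 * L ^ 2 + 1 with hμ
  have hμ0 : 1 ≤ μ := by have := sq_nonneg L; linarith
  have h1 := sum_excess_sub_le hΘ hw hw' μ hT s
  have h2 := sum_velocity_sub_le hk hv hΘ hw hw' μ hT s
  have hE := fun n (hn : n ≠ 0) =>
    energy_nextCoef_sub (a := a) hv hΘ hw hw' hn μ (right_mem_Icc.2 hT)
  set δ := wnorm μ T fun t x => w t x - w' t x with hδ
  have hδ0 : 0 ≤ δ := wnorm_nonneg _ hT _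
  set A : (Fin 3 → ℤ) → ℝ := fun n => ∫ s in (0)..T, Real.exp (-2 * μ * s)
    * ‖fc (fun x => excess Θ (w s x)) n - fc (fun x => excess Θ (w' s x)) n‖ ^ 2
  set V : (Fin 3 → ℤ) → ℝ := fun n => ∑ j, (∫ s in (0)..T, Real.exp (-2 * μ * s)
        * ‖fc (fun x => v j s x * Θ (w s x)) n - fc (fun x => v j s x * Θ (w' s x)) n‖ ^ 2)
  have hpos : ∀ f : ℝ → ℂ, 0 ≤ ∫ t in (0)..T, Real.exp (-2 * μ * t) * ‖f t‖ ^ 2 := fun f =>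
    intervalIntegral.integral_nonneg hT fun t _ => by positivity
  have hA : ∀ n, 0 ≤ A n := fun n => hpos _
  have hV : ∀ n, 0 ≤ V n := fun n => Finset.sum_nonneg fun j _ => hpos _
  set Y : (Fin 3 → ℤ) → ℝ := fun n => ∫ t in (0)..T, Real.exp (-2 * μ * t)
        * ‖nextCoef v Θ a w n t - nextCoef v Θ a w' n t‖ ^ 2
  have hY : ∀ n, 0 ≤ Y n := fun n => hpos _
  have hY0 : Y 0 = 0 := by simp [Y, nextCoef_freq_zero]
  have hE' : ∀ n, n ≠ 0 → (lam n + 2 * μ) * Y n ≤ 5 / 4 * lam n * A n + 5 * V n := by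
    intro n hn
    refine le_trans ?_ (hE n hn)
    exact le_add_of_nonneg_left (by positivity)
  -- This is where `μ` is chosen: the constant is `(5 / 4) (4 / 9) + 1 / 10 ≤ 2 / 3`.
  have hμV : 5 / (2 * μ) * (3 * L ^ 2) ≤ 1 / 10 := by
    rw [div_mul_eq_mul_div, div_le_iff₀ (by linarith)]; linarith
  show ∑ n ∈ s, Y n ≤ 2 / 3 * δ
  change ∑ n ∈ s, A n ≤ 4 / 9 * δ at h1
  change ∑ n ∈ s, V n ≤ 3 * L ^ 2 * δ at h2
  clear_value A V Y δ
  have h3 : ∀ n ∈ s, Y n ≤ 5 / 4 * A n + 5 / (2 * μ) * V n := by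
    intro n _
    have hAn := hA n
    have hVn := hV n
    by_cases hn : n = 0
    · rw [hn, hY0, ← hn]; positivity
    have hl := lam_pos hn
    refine le_of_mul_le_mul_left ((hE' n hn).trans ?_) (show 0 < lam n + 2 * μ by linarith)
    have h4 : (lam n + 2 * μ) * (5 / 4 * A n + 5 / (2 * μ) * V n)
        = 5 / 4 * lam n * A n + 5 * V n + (5 / 2 * μ * A n + lam n * (5 / (2 * μ)) * V n) := by
      field_simp
      ring
    rw [h4]
    exact le_add_of_nonneg_right (by positivity)
  refine (Finset.sum_le_sum h3).trans ?_
  rw [Finset.sum_add_distrib, ← Finset.mul_sum, ← Finset.mul_sum]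
  have h5 : 5 / (2 * μ) * ∑ n ∈ s, V n ≤ 5 / (2 * μ) * (3 * L ^ 2 * δ) := by
    refine mul_le_mul_of_nonneg_left h2 (by positivity)
  nlinarith

theorem norm_sq_nextCoef_sub_le (hk : 4 ≤ k) (hv : IsVelocity k L v) (hΘ : IsInverse b Θ)
    (hw : Continuous fun p : ℝ × T3 => w p.1 p.2) (hw' : Continuous fun p : ℝ × T3 => w' p.1 p.2)
    {T t : ℝ} (ht : t ∈ Icc 0 T) (μ : ℝ) (hμ : 0 ≤ μ) (n : Fin 3 → ℤ) :
    ‖nextCoef v Θ a w n t - nextCoef v Θ a w' n t‖ ^ 2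
      ≤ Real.exp (2 * μ * T) * (lam n + 15 * L ^ 2) * wnorm μ T fun t x => w t x - w' t x := by
  have hT : 0 ≤ T := ht.1.trans ht.2
  have hδ0 : 0 ≤ wnorm μ T fun t x => w t x - w' t x := wnorm_nonneg _ hT _
  have hl := lam_nonneg n
  by_cases hn : n = 0
  · rw [hn, nextCoef_freq_zero, nextCoef_freq_zero, sub_self, norm_zero, zero_pow two_ne_zero,
      ← hn]
    positivity
  have h1 := sum_excess_sub_le hΘ hw hw' μ hT {n}
  have h2 := sum_velocity_sub_le hk hv hΘ hw hw' μ hT {n}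
  have hE := energy_nextCoef_sub (a := a) hv hΘ hw hw' hn μ ht
  rw [Finset.sum_singleton] at h1 h2
  set δ := wnorm μ T fun t x => w t x - w' t x
  have h3 : 0 ≤ ∫ s in (0)..t, Real.exp (-2 * μ * s)
        * ‖nextCoef v Θ a w n s - nextCoef v Θ a w' n s‖ ^ 2 :=
    intervalIntegral.integral_nonneg ht.1 fun t _ => by positivity
  have h4 := mul_nonneg (show 0 ≤ lam n + 2 * μ by linarith) h3
  have h5 : Real.exp (-2 * μ * t) * ‖nextCoef v Θ a w n t - nextCoef v Θ a w' n t‖ ^ 2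
      ≤ (lam n + 15 * L ^ 2) * δ := by
    have h6 := mul_le_mul_of_nonneg_left h1 (show 0 ≤ 5 / 4 * lam n by positivity)
    have h7 := mul_nonneg hl hδ0
    nlinarith
  have h6 : Real.exp (-2 * μ * T) ≤ Real.exp (-2 * μ * t) := by
    apply Real.exp_le_exp.2; nlinarith [ht.2]
  have h7 : Real.exp (2 * μ * T) * Real.exp (-2 * μ * T) = 1 := by
    rw [← Real.exp_add]; simp
  calc ‖nextCoef v Θ a w n t - nextCoef v Θ a w' n t‖ ^ 2
      = Real.exp (2 * μ * T) * (Real.exp (-2 * μ * T)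
        * ‖nextCoef v Θ a w n t - nextCoef v Θ a w' n t‖ ^ 2) := by rw [← mul_assoc, h7, one_mul]
    _ ≤ Real.exp (2 * μ * T) * (Real.exp (-2 * μ * t)
        * ‖nextCoef v Θ a w n t - nextCoef v Θ a w' n t‖ ^ 2) := by gcongr
    _ ≤ Real.exp (2 * μ * T) * ((lam n + 15 * L ^ 2) * δ) := by gcongr
    _ = _ := by ring

/-- Uniqueness for the equation in Fourier form. -/
theorem eq_of_nextCoef (hk : 4 ≤ k) (hv : IsVelocity k L v) (hΘ : IsInverse b Θ)
    (hw : Continuous fun p : ℝ × T3 => w p.1 p.2) (hw' : Continuous fun p : ℝ × T3 => w' p.1 p.2)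
    {T : ℝ} (h : ∀ t ∈ Icc 0 T, ∀ n, fc (w t) n = nextCoef v Θ a w n t)
    (h' : ∀ t ∈ Icc 0 T, ∀ n, fc (w' t) n = nextCoef v Θ a w' n t) {t : ℝ} (ht : t ∈ Icc 0 T) :
    w t = w' t := by
  have hT : 0 ≤ T := ht.1.trans ht.2
  set μ := 75 * L ^ 2 + 1
  have hμ : 0 ≤ μ := by positivity
  have h1 : wnorm μ T (fun t x => w t x - w' t x)
      ≤ 2 / 3 * wnorm μ T fun t x => w t x - w' t x := by
    refine wnorm_le_of_sum_le (hw.sub hw') fun N => ?_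
    refine le_trans (le_of_eq (Finset.sum_congr rfl fun n _ =>
      intervalIntegral.integral_congr fun t ht => ?_))
      (sum_nextCoef_sub_le (a := a) hk hv hΘ hw hw' hT (box N))
    rw [uIcc_of_le hT] at ht
    show _ * ‖fc (fun x => w t x - w' t x) n‖ ^ 2 = _
    rw [fc_sub (continuous_integrable (continuous_curry_right hw t))
      (continuous_integrable (continuous_curry_right hw' t)), h t ht, h' t ht]
  have h2 : wnorm μ T (fun t x => w t x - w' t x) = 0 :=
    le_antisymm (by linarith) (wnorm_nonneg _ hT _)
  refine eq_of_fc (continuous_curry_right hw t) (continuous_curry_right hw' t) fun n => ?_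
  have h3 := norm_sq_nextCoef_sub_le (a := a) hk hv hΘ hw hw' ht μ hμ n
  rw [h2, mul_zero] at h3
  rw [h t ht, h' t ht]
  exact sub_eq_zero.1 (norm_eq_zero.1 (pow_eq_zero_iff two_ne_zero |>.1
    (le_antisymm h3 (sq_nonneg _))))

end

/-! ### Convergence of the iteration -/

/-- The approximate solutions. The frequency cutoffs grow geometrically, so that the truncation
errors are summable. -/
noncomputable def approx (v : Fin 3 → ℝ → T3 → ℝ) (Θ : ℝ → ℝ) (a : (Fin 3 → ℤ) → ℂ) :
    ℕ → ℝ → T3 → ℝ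
  | 0 => fun _ _ => 0
  | m + 1 => iterStep v Θ a (2 ^ m) (approx v Θ a m)

/-- Outside the box the weight of order `k + 1` is large, which bounds the truncation error. -/
theorem four_pow_le_of_notMem_box (k : ℕ) {m : ℕ} {n : Fin 3 → ℤ} (hn : n ∉ box (2 ^ m)) :
    (4 : ℝ) ^ m ≤ ∑ i, freq n i ^ (2 * (k + 1)) := by
  rw [mem_box] at hn
  push Not at hn
  obtain ⟨i, hi⟩ := hn
  have h1 : (2 : ℝ) ^ m ≤ |freq n i| := by
    refine le_trans ?_ (abs_le_abs_freq n i)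
    exact_mod_cast hi.le
  have h2 : (4 : ℝ) ^ m ≤ freq n i ^ 2 := by
    rw [← sq_abs]
    calc (4 : ℝ) ^ m = (2 ^ m) ^ 2 := by rw [← pow_mul, mul_comm, pow_mul]; norm_num
      _ ≤ _ := by gcongr
  have h3 : (1 : ℝ) ≤ freq n i ^ 2 := (one_le_pow₀ (by norm_num)).trans h2
  calc (4 : ℝ) ^ m ≤ freq n i ^ 2 := h2
    _ ≤ (freq n i ^ 2) ^ (k + 1) := le_self_pow₀ h3 (by omega)
    _ = freq n i ^ (2 * (k + 1)) := by rw [pow_mul]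
    _ ≤ _ := Finset.single_le_sum (f := fun i => freq n i ^ (2 * (k + 1)))
        (fun i _ => by rw [pow_mul]; positivity) (Finset.mem_univ i)

section

variable {k : ℕ} {L : ℝ} {v : Fin 3 → ℝ → T3 → ℝ} {b : ℝ} {Θ : ℝ → ℝ} {a : (Fin 3 → ℤ) → ℂ}

/-- The frequencies that the earlier truncation retains are treated by the contraction estimate, the
others by the bound in `L²(0, T; H^{k+1})`. -/
theorem wnorm_iterStep_sub_le (hk : 4 ≤ k) (hv : IsVelocity k L v) (hΘ : IsInverse b Θ)
    (ha : ∀ n, conj (a n) = a (-n)) {T R₁ R₂ : ℝ} (hT : 0 ≤ T) {w : ℝ → T3 → ℝ}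
    (hw : IsApprox k T R₁ R₂ w) (m : ℕ)
    (hw1 : IsApprox k T R₁ R₂ (iterStep v Θ a (2 ^ m) w))
    (hw2 : IsApprox k T R₁ R₂ (iterStep v Θ a (2 ^ (m + 1)) (iterStep v Θ a (2 ^ m) w))) :
    wnorm (75 * L ^ 2 + 1) T (fun t x =>
        iterStep v Θ a (2 ^ (m + 1)) (iterStep v Θ a (2 ^ m) w) t x - iterStep v Θ a (2 ^ m) w t x)
      ≤ 2 / 3 * wnorm (75 * L ^ 2 + 1) T (fun t x => iterStep v Θ a (2 ^ m) w t x - w t x)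
        + 3 * R₁ * (1 / 4) ^ m := by
  set w1 := iterStep v Θ a (2 ^ m) w with hw1d
  set w2 := iterStep v Θ a (2 ^ (m + 1)) w1 with hw2d
  set μ := 75 * L ^ 2 + 1 with hμ
  refine wnorm_le_of_sum_le (hw2.continuous.sub hw1.continuous) fun N => ?_
  have c2 := fun t => continuous_integrable (continuous_curry_right hw2.continuous t)
  have c1 := fun t => continuous_integrable (continuous_curry_right hw1.continuous t)
  have h1 := sum_nextCoef_sub_le (a := a) hk hv hΘ hw1.continuous hw.continuous hT (box N)
  have h2 : ∑ n ∈ box N, ∑ i, freq n i ^ (2 * (k + 1)) * (∫ t in (0)..T, ‖fc (w2 t) n‖ ^ 2)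
      ≤ 3 * R₁ := by
    rw [Finset.sum_comm]
    refine (Finset.sum_le_sum fun i _ => hw2.par i (box N)).trans (le_of_eq ?_)
    rw [Finset.sum_const, Finset.card_univ, Fintype.card_fin]
    simp only [nsmul_eq_mul, Nat.cast_ofNat]
  have h3 : ∀ n ∈ box N,
      (∫ t in (0)..T, Real.exp (-2 * μ * t) * ‖fc (fun x => w2 t x - w1 t x) n‖ ^ 2)
      ≤ (∫ t in (0)..T, Real.exp (-2 * μ * t)
          * ‖nextCoef v Θ a w1 n t - nextCoef v Θ a w n t‖ ^ 2)
        + (1 / 4) ^ m * ∑ i, freq n i ^ (2 * (k + 1)) * (∫ t in (0)..T, ‖fc (w2 t) n‖ ^ 2) := by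
    intro n _
    have hA : 0 ≤ ∫ t in (0)..T, Real.exp (-2 * μ * t)
          * ‖nextCoef v Θ a w1 n t - nextCoef v Θ a w n t‖ ^ 2 :=
      intervalIntegral.integral_nonneg hT fun t _ => by positivity
    have hI : 0 ≤ ∫ t in (0)..T, ‖fc (w2 t) n‖ ^ 2 :=
      intervalIntegral.integral_nonneg hT fun t _ => by positivity
    have hB : 0 ≤ ∑ i, freq n i ^ (2 * (k + 1)) * (∫ t in (0)..T, ‖fc (w2 t) n‖ ^ 2) :=
      Finset.sum_nonneg fun i _ => by rw [pow_mul]; positivity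
    by_cases hn : n ∈ box (2 ^ m)
    · have hn2 : n ∈ box (2 ^ (m + 1)) := box_mono (by gcongr <;> omega) hn
      refine le_trans (le_of_eq ?_) (le_add_of_nonneg_right (by positivity))
      refine intervalIntegral.integral_congr fun t _ => ?_
      show _ * ‖fc (fun x => w2 t x - w1 t x) n‖ ^ 2 = _
      rw [fc_sub (c2 t) (c1 t), hw2d, fc_iterStep ha, if_pos hn2, hw1d, fc_iterStep ha, if_pos hn]
    · refine le_trans ?_ (le_add_of_nonneg_left hA)
      have h4 := four_pow_le_of_notMem_box k hn
      rw [← Finset.sum_mul]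
      calc (∫ t in (0)..T, Real.exp (-2 * μ * t) * ‖fc (fun x => w2 t x - w1 t x) n‖ ^ 2)
          ≤ ∫ t in (0)..T, ‖fc (w2 t) n‖ ^ 2 := by
            have cc : Continuous fun t => ‖fc (fun x => w2 t x - w1 t x) n‖ ^ 2 :=
              (continuous_fc (g := fun t x => w2 t x - w1 t x)
                (hw2.continuous.sub hw1.continuous) n).norm.pow 2
            refine intervalIntegral.integral_mono_on hT
              (Continuous.intervalIntegrable (by fun_prop) _ _)
              (intervalIntegrable_sq_fc hw2.continuous n 0 T) fun t ht => ?_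
            have hz : fc (w1 t) n = 0 := by rw [hw1d, fc_iterStep ha, if_neg hn]
            rw [fc_sub (c2 t) (c1 t), hz, sub_zero]
            refine mul_le_of_le_one_left (sq_nonneg _) (Real.exp_le_one_iff.2 ?_)
            have : 0 ≤ μ * t := mul_nonneg (by positivity) ht.1
            linarith
        _ = (1 / 4) ^ m * (4 ^ m * ∫ t in (0)..T, ‖fc (w2 t) n‖ ^ 2) := by
            rw [← mul_assoc, ← mul_pow]; norm_num
        _ ≤ _ := by gcongr
  refine (Finset.sum_le_sum h3).trans ?_
  rw [Finset.sum_add_distrib, ← Finset.mul_sum, mul_comm (3 * R₁)]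
  exact add_le_add h1 (mul_le_mul_of_nonneg_left h2 (by positivity))

theorem wnorm_approx_sub_le (hk : 4 ≤ k) (hv : IsVelocity k L v) (hΘ : IsInverse b Θ)
    (ha : ∀ n, conj (a n) = a (-n)) {T R₁ R₂ : ℝ} (hT : 0 ≤ T) (hR₁ : 0 ≤ R₁)
    (hw : ∀ m, IsApprox k T R₁ R₂ (approx v Θ a m)) :
    ∃ K, 0 ≤ K ∧ ∀ m, wnorm (75 * L ^ 2 + 1) T
      (fun t x => approx v Θ a (m + 1) t x - approx v Θ a m t x) ≤ K * (5 / 6) ^ m := by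
  set δ : ℕ → ℝ := fun m => wnorm (75 * L ^ 2 + 1) T
      (fun t x => approx v Θ a (m + 1) t x - approx v Θ a m t x)
  have h0 : 0 ≤ δ 0 := wnorm_nonneg _ hT _
  -- `18 = 3 / (5 / 6 - 2 / 3)`, so that the induction step closes
  refine ⟨δ 0 + 18 * R₁, by positivity, fun m => ?_⟩
  show δ m ≤ _
  induction m with
  | zero => simpa using hR₁
  | succ m ih =>
    have h1 : δ (m + 1) ≤ 2 / 3 * δ m + 3 * R₁ * (1 / 4) ^ m :=
      wnorm_iterStep_sub_le hk hv hΘ ha hT (hw m) m (hw (m + 1)) (hw (m + 2))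
    have h2 : (1 / 4 : ℝ) ^ m ≤ (5 / 6) ^ m := pow_le_pow_left₀ (by norm_num) (by norm_num) m
    have h3 : 0 ≤ δ 0 * (5 / 6) ^ m := by positivity
    rw [pow_succ]
    nlinarith

/-- The Fourier coefficients of the approximate solutions converge uniformly in time. -/
theorem exists_limit_nextCoef (hk : 4 ≤ k) (hv : IsVelocity k L v) (hΘ : IsInverse b Θ)
    (ha : ∀ n, conj (a n) = a (-n)) {T R₁ R₂ : ℝ} (hT : 0 ≤ T) (hR₁ : 0 ≤ R₁)
    (hw : ∀ m, IsApprox k T R₁ R₂ (approx v Θ a m)) (n : Fin 3 → ℤ) :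
    ∃ c : ℝ → ℂ, TendstoUniformlyOn (fun m t => fc (approx v Θ a m t) n) c atTop (Icc 0 T) := by
  obtain ⟨K, hK0, hK⟩ := wnorm_approx_sub_le hk hv hΘ ha hT hR₁ hw
  set μ := 75 * L ^ 2 + 1
  have hμ : 0 ≤ μ := by positivity
  have hl := lam_nonneg n
  set A := √(Real.exp (2 * μ * T) * (lam n + 15 * L ^ 2) * K)
  set r := √(5 / 6 : ℝ)
  have hr : r < 1 := by
    rw [Real.sqrt_lt' one_pos]; norm_num
  have hA : ∀ t ∈ Icc 0 T, ∀ m, dist (nextCoef v Θ a (approx v Θ a m) n t)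
      (nextCoef v Θ a (approx v Θ a (m + 1)) n t) ≤ A * r ^ m := by
    intro t ht m
    rw [dist_comm, dist_eq_norm]
    refine le_of_sq_le_sq ?_ (by positivity)
    refine (norm_sq_nextCoef_sub_le hk hv hΘ (hw (m + 1)).continuous (hw m).continuous ht μ hμ
      n).trans ?_
    rw [mul_pow, ← pow_mul, mul_comm m 2, pow_mul, Real.sq_sqrt (by positivity),
      Real.sq_sqrt (by norm_num), mul_assoc _ K]
    exact mul_le_mul_of_nonneg_left (hK m) (by positivity)
  have hex : ∀ t, ∃ z, t ∈ Icc 0 T →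
      Tendsto (fun m => nextCoef v Θ a (approx v Θ a m) n t) atTop (𝓝 z) := by
    intro t
    by_cases ht : t ∈ Icc 0 T
    · obtain ⟨z, hz⟩ := cauchySeq_tendsto_of_complete (cauchySeq_of_le_geometric r A hr (hA t ht))
      exact ⟨z, fun _ => hz⟩
    · exact ⟨0, fun h => absurd h ht⟩
  choose c hc using hex
  have hu : TendstoUniformlyOn (fun m t => nextCoef v Θ a (approx v Θ a m) n t) c atTop
      (Icc 0 T) := by
    rw [Metric.tendstoUniformlyOn_iff]
    intro ε hε
    have h1 : Tendsto (fun m : ℕ => A * r ^ m / (1 - r)) atTop (𝓝 (A * 0 / (1 - r))) :=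
      ((tendsto_pow_atTop_nhds_zero_of_lt_one (Real.sqrt_nonneg _) hr).const_mul A).div_const _
    rw [mul_zero, zero_div] at h1
    filter_upwards [h1.eventually (gt_mem_nhds hε)] with m hm t ht
    rw [dist_comm]
    exact (dist_le_of_le_geometric_of_tendsto r A hr (hA t ht) (hc t ht) m).trans_lt hm
  refine ⟨c, ?_⟩
  obtain ⟨N, hN⟩ := exists_mem_box n
  rw [Metric.tendstoUniformlyOn_iff] at hu ⊢
  intro ε hε
  have h2 := hu ε hε
  rw [eventually_atTop] at h2 ⊢
  obtain ⟨m₀, hm₀⟩ := h2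
  refine ⟨max m₀ N + 1, fun m hm t ht => ?_⟩
  obtain ⟨m, rfl⟩ : ∃ m', m = m' + 1 := ⟨m - 1, by omega⟩
  have hmem : n ∈ box (2 ^ m) := box_mono (by have := Nat.lt_two_pow_self (n := m); omega) hN
  have h3 : fc (approx v Θ a (m + 1) t) n = nextCoef v Θ a (approx v Θ a m) n t := by
    rw [approx, fc_iterStep ha, if_pos hmem]
  rw [h3]
  exact hm₀ m (by omega) t ht

end

/-! ### Existence in Fourier form -/

theorem tendsto_integral_sq {T B : ℝ} (hT : 0 ≤ T) {f : ℕ → ℝ → ℂ} {g : ℝ → ℂ}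
    (hf : ∀ m, Continuous (f m)) (hB : ∀ m, ∀ t ∈ Icc 0 T, ‖f m t‖ ≤ B)
    (h : ∀ t ∈ Icc 0 T, Tendsto (fun m => f m t) atTop (𝓝 (g t))) :
    Tendsto (fun m => ∫ t in (0)..T, ‖f m t‖ ^ 2) atTop (𝓝 (∫ t in (0)..T, ‖g t‖ ^ 2)) := by
  refine intervalIntegral.tendsto_integral_filter_of_dominated_convergence (fun _ => B ^ 2)
    (Eventually.of_forall fun m => ((hf m).norm.pow 2).aestronglyMeasurable)
    (Eventually.of_forall fun m => Eventually.of_forall fun t ht => ?_) (by simp)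
    (Eventually.of_forall fun t ht => ?_)
  · rw [uIoc_of_le hT] at ht
    rw [norm_pow, norm_norm]
    exact pow_le_pow_left₀ (norm_nonneg _) (hB m t (Ioc_subset_Icc_self ht)) 2
  · rw [uIoc_of_le hT] at ht
    exact ((h t (Ioc_subset_Icc_self ht)).norm).pow 2

theorem tendsto_duhamel {T B : ℝ} {f : ℕ → ℝ → ℂ} {g : ℝ → ℂ}
    (hf : ∀ m, Continuous (f m)) (hB : ∀ m, ∀ t ∈ Icc 0 T, ‖f m t‖ ≤ B)
    (h : ∀ t ∈ Icc 0 T, Tendsto (fun m => f m t) atTop (𝓝 (g t))) (l : ℝ) (a : ℂ) {t : ℝ}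
    (ht : t ∈ Icc 0 T) :
    Tendsto (fun m => duhamel l a (f m) t) atTop (𝓝 (duhamel l a g t)) := by
  refine Tendsto.const_mul _ (Tendsto.const_add _ ?_)
  have hsub : ∀ s ∈ uIoc 0 t, s ∈ Icc 0 T := fun s hs => by
    rw [uIoc_of_le ht.1] at hs
    exact ⟨hs.1.le, hs.2.trans ht.2⟩
  refine intervalIntegral.tendsto_integral_filter_of_dominated_convergence
    (fun s : ℝ => ‖Complex.exp ((l : ℂ) * s)‖ * B)
    (Eventually.of_forall fun m => Continuous.aestronglyMeasurable (by have := hf m; fun_prop))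
    (Eventually.of_forall fun m => Eventually.of_forall fun s hs => ?_)
    (Continuous.intervalIntegrable (by fun_prop) _ _)
    (Eventually.of_forall fun s hs => (h s (hsub s hs)).const_mul _)
  rw [norm_mul]
  exact mul_le_mul_of_nonneg_left (hB m s (hsub s hs)) (norm_nonneg _)

theorem tendsto_fc_mul_comp {q : T3 → ℝ} (hq : Continuous q) {Φ : ℝ → ℝ} (hΦ : Continuous Φ)
    {f : ℕ → T3 → ℝ} {g : T3 → ℝ} {B : ℝ} (hf : ∀ m, Continuous (f m)) (hB : ∀ m x, |f m x| ≤ B)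
    (h : ∀ x, Tendsto (fun m => f m x) atTop (𝓝 (g x))) (n : Fin 3 → ℤ) :
    Tendsto (fun m => fc (fun x => q x * Φ (f m x)) n) atTop (𝓝 (fc (fun x => q x * Φ (g x)) n)) := by
  obtain ⟨Q, hQ⟩ := exists_abs_le hq
  obtain ⟨C, hC⟩ := (isCompact_Icc (a := -B) (b := B)).exists_bound_of_continuousOn hΦ.continuousOn
  have hQ0 : 0 ≤ Q := (abs_nonneg _).trans (hQ 0)
  refine tendsto_fc (f := fun m x => q x * Φ (f m x)) (C := Q * C) (fun m => hq.mul (hΦ.comp (hf m))) (fun m x => ?_) (fun x => ?_) n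
  · rw [abs_mul]
    exact mul_le_mul (hQ x) (hC _ (abs_le.1 (hB m x))) (abs_nonneg _) hQ0
  · exact ((hΦ.tendsto _).comp (h x)).const_mul _

section

variable {k : ℕ} {L : ℝ} {v : Fin 3 → ℝ → T3 → ℝ} {b : ℝ} {Θ : ℝ → ℝ}

/-- Bounds on the Fourier coefficients in the source, uniform over functions with values
in a fixed interval. -/
theorem exists_norm_source_le (hk : 4 ≤ k) (hv : IsVelocity k L v) (hΘ : IsInverse b Θ) (B : ℝ)
    (n : Fin 3 → ℤ) :
    ∃ C, ∀ w : ℝ → T3 → ℝ, ∀ t, (∀ x, |w t x| ≤ B) →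
      ‖fc (fun x => excess Θ (w t x)) n‖ ≤ C ∧ ‖source v Θ w n t‖ ≤ C := by
  obtain ⟨P, hP⟩ := (isCompact_Icc (a := -B) (b := B)).exists_bound_of_continuousOn
    hΘ.excess_contDiff.continuous.continuousOn
  obtain ⟨Q, hQ⟩ := (isCompact_Icc (a := -B) (b := B)).exists_bound_of_continuousOn
    hΘ.contDiff.continuous.continuousOn
  refine ⟨max P (lam n * P + ∑ j, |freq n j| * (L * Q)), fun w t h => ?_⟩
  have h1 : ‖fc (fun x => excess Θ (w t x)) n‖ ≤ P := norm_fc_le (fun x => hP _ (abs_le.1 (h x))) n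
  have h2 : ∀ j, ‖fc (fun x => v j t x * Θ (w t x)) n‖ ≤ L * Q := fun j =>
    norm_fc_le (fun x => by
      rw [abs_mul]
      exact mul_le_mul (hv.abs_le hk j t x) (hQ _ (abs_le.1 (h x))) (abs_nonneg _) hv.nonneg) n
  refine ⟨h1.trans (le_max_left _ _), le_trans ?_ (le_max_right _ _)⟩
  refine (norm_sub_le _ _).trans (add_le_add ?_ ((norm_sum_le _ _).trans
    (Finset.sum_le_sum fun j _ => ?_)))
  · rw [norm_mul, Complex.norm_real, Real.norm_eq_abs, abs_of_nonneg (lam_nonneg n)]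
    exact mul_le_mul_of_nonneg_left h1 (lam_nonneg n)
  · rw [norm_mul, norm_mul, Complex.norm_I, one_mul, Complex.norm_real, Real.norm_eq_abs]
    exact mul_le_mul_of_nonneg_left (h2 j) (abs_nonneg _)

/-- The limit of the approximate solutions. -/
theorem exists_limit (hk : 8 ≤ k) (hv : IsVelocity k L v) (hΘ : IsInverse b Θ)
    {a : (Fin 3 → ℤ) → ℂ} (ha : ∀ n, conj (a n) = a (-n)) {T R₁ R₂ : ℝ} (hT : 0 ≤ T)
    (hR₁ : 0 ≤ R₁) (hR₂ : 0 ≤ R₂) (hw : ∀ m, IsApprox k T R₁ R₂ (approx v Θ a m))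
    (hP : ∀ m (i : Fin 3) (s : Finset (Fin 3 → ℤ)), ∑ n ∈ s, freq n i ^ (2 * (k + 1))
        * (∫ t in (0)..T, ‖fc (fun x => excess Θ (approx v Θ a m t x)) n‖ ^ 2) ≤ R₁ + 1) :
    ∃ w : ℝ → T3 → ℝ, (Continuous fun p : ℝ × T3 => w p.1 p.2) ∧ TimeBound k T R₁ R₂ w ∧
      (∀ (i : Fin 3) (s : Finset (Fin 3 → ℤ)), ∑ n ∈ s, freq n i ^ (2 * (k + 1))
        * (∫ t in (0)..T, ‖fc (fun x => excess Θ (w t x)) n‖ ^ 2) ≤ R₁ + 1) ∧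
      ∀ t ∈ Icc 0 T, ∀ n, fc (w t) n = nextCoef v Θ a w n t := by
  choose c hc using exists_limit_nextCoef (by omega) hv hΘ ha hT hR₁ hw
  set A : ℕ → ℝ → T3 → ℝ := approx v Θ a
  have cA : ∀ m t, Continuous (A m t) := fun m t => continuous_curry_right (hw m).continuous t
  have hAHB : ∀ m, ∀ t ∈ Icc 0 T, HB k (A m t) (R₂ ^ 2) := fun m t ht => (hw m).hb ht
  have hc' : ∀ n, ∀ t ∈ Icc 0 T, Tendsto (fun m => fc (A m t) n) atTop (𝓝 (c n t)) :=
    fun n t ht => (hc n).tendsto_at ht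
  have hcc : ∀ n, ContinuousOn (c n) (Icc 0 T) := fun n =>
    (hc n).continuousOn (Frequently.of_forall fun m =>
      (continuous_fc (hw m).continuous n).continuousOn)
  have hAn : ∀ m, ∀ t ∈ Icc 0 T, ∀ n, ‖fc (A m t) n‖ ≤ 4 ^ k * R₂ * (sz n ^ 4)⁻¹ :=
    fun m t ht n => by
      simpa using sz_pow_mul_norm_le (j := 0) (by omega) hR₂ ((hAHB m t ht).single n)
  have hcn : ∀ n, ∀ t ∈ Icc 0 T, ‖c n t‖ ≤ 4 ^ k * R₂ * (sz n ^ 4)⁻¹ := fun n t ht =>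
    le_of_tendsto (hc' n t ht).norm (Eventually.of_forall fun m => hAn m t ht n)
  set p : ℝ → ℝ := fun t => projIcc 0 T hT t with hp
  have hpc : Continuous p := continuous_subtype_val.comp continuous_projIcc
  have hpm : ∀ t, p t ∈ Icc 0 T := fun t => (projIcc 0 T hT t).2
  have hpe : ∀ t ∈ Icc 0 T, p t = t := fun t ht => by
    show ((projIcc 0 T hT t : Icc 0 T) : ℝ) = t
    rw [projIcc_of_mem hT ht]
  have hsum := summable_sz.mul_left (4 ^ k * R₂)
  let w : ℝ → T3 → ℝ := fun t x => ∑' n, mode n (c n (p t)) x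
  have hwc : Continuous fun q : ℝ × T3 => w q.1 q.2 := by
    refine continuous_tsum (fun n => ?_) hsum fun n q =>
      (abs_mode_le n _ _).trans (hcn n _ (hpm q.1))
    exact Complex.continuous_re.comp ((((hcc n).comp_continuous hpc hpm).comp continuous_fst).mul
      ((mFourier n).continuous.comp continuous_snd))
  have hlim : ∀ t ∈ Icc 0 T, ∀ x, Tendsto (fun m => A m t x) atTop (𝓝 (w t x)) := by
    intro t ht x
    have h1 : ∀ m, A m t x = ∑' n, mode n (fc (A m t) n) x := fun m =>
      (hasSum_mode (cA m t) ((hAHB m t ht).summable (by omega)) x).tsum_eq.symm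
    simp_rw [h1]
    refine tendsto_tsum_of_dominated_convergence hsum (fun n => ?_)
      (Eventually.of_forall fun m n => (abs_mode_le n _ x).trans (hAn m t ht n))
    rw [hpe t ht]
    exact (Complex.continuous_re.tendsto _).comp ((hc' n t ht).mul_const _)
  have hAB : ∀ m, ∀ t ∈ Icc 0 T, ∀ x, |A m t x| ≤ 4 ^ k * R₂ * CS := fun m t ht x =>
    (hAHB m t ht).abs_le (by omega) (cA m t) hR₂ x
  have hfc : ∀ t ∈ Icc 0 T, ∀ n, Tendsto (fun m => fc (A m t) n) atTop (𝓝 (fc (w t) n)) :=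
    fun t ht n => tendsto_fc (fun m => cA m t) (fun m x => hAB m t ht x) (hlim t ht) n
  have hfP : ∀ t ∈ Icc 0 T, ∀ n, Tendsto (fun m => fc (fun x => excess Θ (A m t x)) n) atTop
      (𝓝 (fc (fun x => excess Θ (w t x)) n)) := fun t ht n => by
    simpa using tendsto_fc_mul_comp (q := fun _ => 1) continuous_const
      hΘ.excess_contDiff.continuous (fun m => cA m t) (fun m x => hAB m t ht x) (hlim t ht) n
  have hfV : ∀ t ∈ Icc 0 T, ∀ n j, Tendsto (fun m => fc (fun x => v j t x * Θ (A m t x)) n) atTop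
      (𝓝 (fc (fun x => v j t x * Θ (w t x)) n)) := fun t ht n j =>
    tendsto_fc_mul_comp (continuous_curry_right (hv.continuous j) t)
      hΘ.contDiff.continuous (fun m => cA m t) (fun m x => hAB m t ht x) (hlim t ht) n
  have hsrc : ∀ t ∈ Icc 0 T, ∀ n, Tendsto (fun m => source v Θ (A m) n t) atTop
      (𝓝 (source v Θ w n t)) := fun t ht n =>
    ((hfP t ht n).const_mul _).sub (tendsto_finsetSum _ fun j _ => (hfV t ht n j).const_mul _)
  refine ⟨w, hwc, ⟨fun i s => ?_, fun τ hτ s => ?_⟩, fun i s => ?_, fun t ht n => ?_⟩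
  · refine le_of_tendsto (x := (atTop : Filter ℕ)) (tendsto_finsetSum s fun n _ => Tendsto.const_mul _
      (tendsto_integral_sq hT (fun m => continuous_fc (hw m).continuous n)
        (fun m t ht => hAn m t ht n) fun t ht => hfc t ht n))
      (Eventually.of_forall fun m => (hw m).par i s)
  · refine le_of_tendsto (x := (atTop : Filter ℕ)) (tendsto_finsetSum s fun n _ => Tendsto.const_mul _
      ((hfc (τ n) (hτ n) n).norm.pow 2)) (Eventually.of_forall fun m => (hw m).unif τ hτ s)
  · refine le_of_tendsto (x := (atTop : Filter ℕ)) (tendsto_finsetSum s fun n _ => Tendsto.const_mul _ ?_)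
      (Eventually.of_forall fun m => hP m i s)
    obtain ⟨C, hC⟩ := exists_norm_source_le (by omega) hv hΘ (4 ^ k * R₂ * CS) n
    exact tendsto_integral_sq (f := fun m t => fc (fun x => excess Θ (A m t x)) n) hT
      (fun m => continuous_fc (g := fun t x => excess Θ (A m t x))
        (hΘ.excess_contDiff.continuous.comp (hw m).continuous) n)
      (fun m t ht => (hC (A m) t (hAB m t ht)).1) fun t ht => hfP t ht n
  · obtain ⟨C, hC⟩ := exists_norm_source_le (by omega) hv hΘ (4 ^ k * R₂ * CS) n
    have h1 : Tendsto (fun m => nextCoef v Θ a (A m) n t) atTop (𝓝 (nextCoef v Θ a w n t)) :=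
      tendsto_duhamel (fun m => continuous_source hv hΘ (hw m).continuous n)
        (fun m t ht => (hC (A m) t (hAB m t ht)).2) (fun t ht => hsrc t ht n) _ _ ht
    refine tendsto_nhds_unique ((tendsto_add_atTop_iff_nat 1).2 (hfc t ht n)) (h1.congr' ?_)
    obtain ⟨N, hN⟩ := exists_mem_box n
    filter_upwards [eventually_ge_atTop N] with m hm
    have hmem : n ∈ box (2 ^ m) := box_mono (by have := Nat.lt_two_pow_self (n := m); omega) hN
    show _ = fc (approx v Θ a (m + 1) t) n
    rw [approx, fc_iterStep ha, if_pos hmem]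

/-- Local existence for the equation in Fourier form. -/
theorem exists_fourier_solution (hk : 8 ≤ k) (hv : IsVelocity k L v) (hΘ : IsInverse b Θ)
    {M₀ : ℝ} (hM : 0 ≤ M₀) :
    ∃ R₁ R₂ T₀ : ℝ, 0 ≤ R₁ ∧ 0 ≤ R₂ ∧ 0 < T₀ ∧ T₀ ≤ 1 ∧ ∀ T, 0 ≤ T → T ≤ T₀ →
      ∀ a : (Fin 3 → ℤ) → ℂ, (∀ n, conj (a n) = a (-n)) →
        (∀ s : Finset (Fin 3 → ℤ), ∑ n ∈ s, W k n * ‖a n‖ ^ 2 ≤ M₀) →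
      ∃ w : ℝ → T3 → ℝ, (Continuous fun p : ℝ × T3 => w p.1 p.2) ∧ TimeBound k T R₁ R₂ w ∧
        (∀ (i : Fin 3) (s : Finset (Fin 3 → ℤ)), ∑ n ∈ s, freq n i ^ (2 * (k + 1))
          * (∫ t in (0)..T, ‖fc (fun x => excess Θ (w t x)) n‖ ^ 2) ≤ R₁ + 1) ∧
        ∀ t ∈ Icc 0 T, ∀ n, fc (w t) n = nextCoef v Θ a w n t := by
  obtain ⟨R₁, R₂, T₀, hR₁, hR₂, hT₀, hT₀1, h⟩ := exists_isApprox_iterStep hk hv hΘ hM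
  refine ⟨R₁, R₂, T₀, hR₁, hR₂, hT₀, hT₀1, fun T hT hTT a ha ha0 => ?_⟩
  have hw : ∀ m, IsApprox k T R₁ R₂ (approx v Θ a m) := by
    intro m
    induction m with
    | zero => exact isApprox_zero hR₁
    | succ m ih => exact (h T hT hTT _ ih).2 a ha ha0 _
  exact exists_limit hk hv hΘ ha hT hR₁ hR₂ hw fun m => (h T hT hTT _ (hw m)).1

end

/-! ### Regularity of the limit -/

/-- Continuity in time with values in `H^k`: the bound with individual times for the Fourier
coefficients gives a summable majorant of the coefficients that does not depend on time. -/
theorem TimeBound.eventually_HB_sub {k : ℕ} {T R₁ R₂ : ℝ} {w : ℝ → T3 → ℝ}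
    (hw : Continuous fun p : ℝ × T3 => w p.1 p.2) (h : TimeBound k T R₁ R₂ w) {t₀ : ℝ}
    (ht₀ : t₀ ∈ Icc 0 T) {ε : ℝ} (hε : 0 < ε) :
    ∀ᶠ t : ℝ in 𝓝[Icc 0 T] t₀, HB k (fun x => w t x - w t₀ x) ε := by
  have hc := fun n => continuous_fc hw n
  have hmax : ∀ n, ∃ τ ∈ Icc 0 T, ∀ t ∈ Icc 0 T, ‖fc (w t) n‖ ≤ ‖fc (w τ) n‖ := fun n =>
    isCompact_Icc.exists_isMaxOn ⟨t₀, ht₀⟩ (hc n).norm.continuousOn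
  choose τ hτ hτm using hmax
  have hs : Summable fun n => W k n * ‖fc (w (τ n)) n‖ ^ 2 :=
    summable_of_sum_le (fun n => mul_nonneg (W_pos k n).le (sq_nonneg _)) (h.unif τ hτ)
  obtain ⟨s₀, hs₀⟩ := summable_iff_vanishing_norm.1 hs (ε / 8) (by positivity)
  have hfin : Tendsto (fun t => ∑ n ∈ s₀, W k n * ‖fc (w t) n - fc (w t₀) n‖ ^ 2) (𝓝 t₀)
      (𝓝 (∑ n ∈ s₀, W k n * ‖fc (w t₀) n - fc (w t₀) n‖ ^ 2)) := by
    refine Continuous.tendsto ?_ t₀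
    fun_prop
  simp only [sub_self, norm_zero, zero_pow two_ne_zero, mul_zero, Finset.sum_const_zero] at hfin
  filter_upwards [nhdsWithin_le_nhds (hfin.eventually (gt_mem_nhds (half_pos hε))),
    self_mem_nhdsWithin] with t ht htm s
  have hpos : ∀ n, 0 ≤ W k n * ‖fc (w t) n - fc (w t₀) n‖ ^ 2 := fun n =>
    mul_nonneg (W_pos k n).le (sq_nonneg _)
  simp_rw [fc_sub (continuous_integrable (continuous_curry_right hw t))
    (continuous_integrable (continuous_curry_right hw t₀))]
  rw [← Finset.sum_inter_add_sum_sdiff s s₀]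
  have h1 : ∑ n ∈ s ∩ s₀, W k n * ‖fc (w t) n - fc (w t₀) n‖ ^ 2 ≤ ε / 2 :=
    (Finset.sum_le_sum_of_subset_of_nonneg Finset.inter_subset_right fun n _ _ => hpos n).trans ht.le
  have h2 : ∑ n ∈ s \ s₀, W k n * ‖fc (w t) n - fc (w t₀) n‖ ^ 2
      ≤ 4 * ∑ n ∈ s \ s₀, W k n * ‖fc (w (τ n)) n‖ ^ 2 := by
    rw [Finset.mul_sum]
    refine Finset.sum_le_sum fun n _ => ?_
    have h3 := hτm n t htm
    have h4 := hτm n t₀ ht₀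
    have h5 : ‖fc (w t) n - fc (w t₀) n‖ ≤ 2 * ‖fc (w (τ n)) n‖ :=
      (norm_sub_le _ _).trans (by linarith)
    have h6 := pow_le_pow_left₀ (norm_nonneg _) h5 2
    have := W_pos k n
    calc W k n * ‖fc (w t) n - fc (w t₀) n‖ ^ 2 ≤ W k n * (2 * ‖fc (w (τ n)) n‖) ^ 2 := by gcongr
      _ = _ := by ring
  have h3 := (le_abs_self _).trans_lt (hs₀ (s \ s₀) Finset.sdiff_disjoint)
  linarith

/-- Composition with a smooth function preserves `C([0, T]; H^k)`. -/
theorem exists_memC_comp {k : ℕ} (hk : 8 ≤ k) {Ψ : ℝ → ℝ} (hΨ : ContDiff ℝ ∞ Ψ) {R₂ : ℝ}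
    (hR₂ : 0 ≤ R₂) :
    ∃ C, 0 ≤ C ∧ ∀ (T R₁ : ℝ) (w : ℝ → T3 → ℝ), (Continuous fun p : ℝ × T3 => w p.1 p.2) →
      TimeBound k T R₁ R₂ w →
      (∀ t ∈ Icc 0 T, HB k (fun x => Ψ (w t x)) (C ^ 2)) ∧ MemC k T (fun t x => Ψ (w t x)) ∧
        timeNorm ⊤ k T (fun t x => Ψ (w t x)) ≤ ENNReal.ofReal √(cardIdx k * C ^ 2) := by
  obtain ⟨C, hC0, hC⟩ := HB_comp hk hΨ hR₂
  obtain ⟨C', hC'0, hC'⟩ := HB_comp_sub hk hΨ hR₂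
  refine ⟨C, hC0, fun T R₁ w hw h => ?_⟩
  have hwt := continuous_curry_right hw
  have hg : ∀ t ∈ Icc 0 T, Continuous fun x => Ψ (w t x) := fun t _ =>
    hΨ.continuous.comp (hwt t)
  have hR : ∀ t ∈ Icc 0 T, HB k (fun x => Ψ (w t x)) (C ^ 2) := fun t ht =>
    hC _ (hwt t) (h.hb ht)
  refine ⟨hR, memC_of_HB (by omega) hg hR fun t₀ ht₀ ε hε => ?_,
    timeNorm_top_le (by omega) hg hR⟩
  have hδ : 0 < √ε / (C' + 1) := by positivity
  filter_upwards [h.eventually_HB_sub hw ht₀ (pow_pos hδ 2), self_mem_nhdsWithin] with t ht htm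
  refine (hC' _ _ (hwt t) (hwt t₀) (h.hb htm) (h.hb ht₀) _ hδ.le ht).mono ?_
  calc (C' * (√ε / (C' + 1))) ^ 2 = (C' / (C' + 1)) ^ 2 * √ε ^ 2 := by ring
    _ ≤ 1 * √ε ^ 2 := by
        gcongr
        refine pow_le_one₀ (by positivity) ?_
        rw [div_le_one (by positivity)]; linarith
    _ = ε := by rw [one_mul, Real.sq_sqrt hε.le]

/-- A bound in `L²(0, T; H^{k+1})` from the bound on the derivatives of order `k + 1`. -/
theorem memL2_of_par {k : ℕ} (hk : 4 ≤ k) {T : ℝ} (hT : 0 ≤ T) (hT1 : T ≤ 1) {g : ℝ → T3 → ℝ}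
    (hg : Continuous fun p : ℝ × T3 => g p.1 p.2) {C R : ℝ}
    (hC : ∀ t ∈ Icc 0 T, HB k (g t) (C ^ 2))
    (hR : ∀ (i : Fin 3) (s : Finset (Fin 3 → ℤ)), ∑ n ∈ s, freq n i ^ (2 * (k + 1))
      * (∫ t in (0)..T, ‖fc (g t) n‖ ^ 2) ≤ R) :
    MemL2 (k + 1) T g ∧
      timeNorm 2 (k + 1) T g ≤ ENNReal.ofReal √(cardIdx (k + 1) * (C ^ 2 + 3 * R)) := by
  refine memL2_of_integral hT (fun t _ => continuous_curry_right hg t)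
    (fun t ht => (hC t ht).summable hk) (continuous_fc hg) fun s => ?_
  have hc := fun n => continuous_fc hg n
  have h0 : ∑ n ∈ s, (∫ t in (0)..T, ‖fc (g t) n‖ ^ 2) ≤ C ^ 2 := by
    rw [← intervalIntegral.integral_finsetSum fun n _ => intervalIntegrable_sq_fc hg n 0 T]
    have h1 : ∫ t in (0)..T, ∑ n ∈ s, ‖fc (g t) n‖ ^ 2 ≤ ∫ t in (0)..T, C ^ 2 := by
      refine intervalIntegral.integral_mono_on hT (Continuous.intervalIntegrable (by fun_prop) _ _)
        (by simp) fun t ht => ?_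
      refine le_trans (Finset.sum_le_sum fun n _ => ?_) (hC t ht s)
      exact le_mul_of_one_le_left (sq_nonneg _) (one_le_W k n)
    rw [intervalIntegral.integral_const, smul_eq_mul, sub_zero] at h1
    exact h1.trans (mul_le_of_le_one_left (sq_nonneg _) hT1)
  have h1 : ∑ n ∈ s, ∑ i, freq n i ^ (2 * (k + 1)) * (∫ t in (0)..T, ‖fc (g t) n‖ ^ 2) ≤ 3 * R := by
    rw [Finset.sum_comm]
    refine (Finset.sum_le_sum fun i _ => hR i s).trans (le_of_eq ?_)
    rw [Finset.sum_const, Finset.card_univ, Fintype.card_fin]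
    simp only [nsmul_eq_mul, Nat.cast_ofNat]
  simp only [W, add_mul, one_mul, Finset.sum_mul]
  rw [Finset.sum_add_distrib]
  exact add_le_add h0 h1

theorem par_add {k : ℕ} {T A B α β : ℝ} (hT : 0 ≤ T) {g h : ℝ → T3 → ℝ}
    (hg : Continuous fun p : ℝ × T3 => g p.1 p.2) (hh : Continuous fun p : ℝ × T3 => h p.1 p.2)
    {i : Fin 3} {s : Finset (Fin 3 → ℤ)}
    (hA : ∑ n ∈ s, freq n i ^ (2 * (k + 1)) * (∫ t in (0)..T, ‖fc (g t) n‖ ^ 2) ≤ A)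
    (hB : ∑ n ∈ s, freq n i ^ (2 * (k + 1)) * (∫ t in (0)..T, ‖fc (h t) n‖ ^ 2) ≤ B) :
    ∑ n ∈ s, freq n i ^ (2 * (k + 1)) * (∫ t in (0)..T, ‖fc (fun x => α * g t x + β * h t x) n‖ ^ 2)
      ≤ 2 * α ^ 2 * A + 2 * β ^ 2 * B := by
  have cg := fun n => continuous_fc hg n
  have ch := fun n => continuous_fc hh n
  have h1 : ∀ n ∈ s, freq n i ^ (2 * (k + 1))
        * (∫ t in (0)..T, ‖fc (fun x => α * g t x + β * h t x) n‖ ^ 2)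
      ≤ 2 * α ^ 2 * (freq n i ^ (2 * (k + 1)) * (∫ t in (0)..T, ‖fc (g t) n‖ ^ 2))
        + 2 * β ^ 2 * (freq n i ^ (2 * (k + 1)) * (∫ t in (0)..T, ‖fc (h t) n‖ ^ 2)) := by
    intro n _
    have h2 : ∀ t, fc (fun x => α * g t x + β * h t x) n = α * fc (g t) n + β * fc (h t) n := by
      intro t
      rw [fc_add (f := fun x => α * g t x) (g := fun x => β * h t x)
        (continuous_integrable (continuous_const.mul (continuous_curry_right hg t)))
        (continuous_integrable (continuous_const.mul (continuous_curry_right hh t))),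
        fc_const_mul, fc_const_mul]
    simp_rw [h2]
    have h3 : ∫ t in (0)..T, ‖α * fc (g t) n + β * fc (h t) n‖ ^ 2
        ≤ ∫ t in (0)..T, (2 * α ^ 2 * ‖fc (g t) n‖ ^ 2 + 2 * β ^ 2 * ‖fc (h t) n‖ ^ 2) := by
      have := cg n
      have := ch n
      refine intervalIntegral.integral_mono_on hT (Continuous.intervalIntegrable (by fun_prop) _ _)
        (Continuous.intervalIntegrable (by fun_prop) _ _) fun t _ => ?_
      have h4 := norm_add_le ((α : ℂ) * fc (g t) n) (β * fc (h t) n)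
      simp only [norm_mul, Complex.norm_real, Real.norm_eq_abs] at h4
      have h5 := pow_le_pow_left₀ (norm_nonneg _) h4 2
      rw [← sq_abs α, ← sq_abs β]
      nlinarith [sq_nonneg (|α| * ‖fc (g t) n‖ - |β| * ‖fc (h t) n‖)]
    rw [intervalIntegral.integral_add ((intervalIntegrable_sq_fc hg n 0 T).const_mul _)
      ((intervalIntegrable_sq_fc hh n 0 T).const_mul _), intervalIntegral.integral_const_mul,
      intervalIntegral.integral_const_mul] at h3
    have hx : 0 ≤ freq n i ^ (2 * (k + 1)) := by rw [pow_mul]; positivity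
    nlinarith [mul_le_mul_of_nonneg_left h3 hx]
  refine (Finset.sum_le_sum h1).trans ?_
  rw [Finset.sum_add_distrib, ← Finset.mul_sum, ← Finset.mul_sum]
  gcongr

theorem ae_eq_of_fc {f g : T3 → ℝ} (hf : MemLp f 2) (hg : MemLp g 2)
    (h : ∀ n, fc f n = fc g n) : f =ᵐ[volume] g := by
  have hd : MemLp (fun x => f x - g x) 2 := hf.sub hg
  have h1 := hasSum_sq_fc hd
  have h3 : ∀ n, fc (fun x => f x - g x) n = 0 := fun n => by
    rw [fc_sub (hf.integrable (by norm_num)) (hg.integrable (by norm_num)), h, sub_self]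
  simp_rw [h3, norm_zero, zero_pow two_ne_zero] at h1
  have h4 := h1.unique hasSum_zero
  rw [integral_eq_zero_iff_of_nonneg (fun x => sq_nonneg _) hd.integrable_sq] at h4
  filter_upwards [h4] with x hx
  exact sub_eq_zero.1 (pow_eq_zero_iff two_ne_zero |>.1 hx)

theorem fc_laplacian {g : T3 → ℝ} (hg : IsCk 2 g) (n : Fin 3 → ℤ) :
    fc (laplacian g) n = -(lam n : ℂ) * fc g n := by
  have h1 : ∀ i, IsCk 1 (pd i g) := fun i => IsCk.pd_nat (m := 1) hg i
  unfold laplacian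
  rw [fc_sum _ fun i _ => continuous_integrable ((h1 i).continuous_pd i)]
  simp_rw [fc_pd (h1 _), fc_pd (hg.mono one_le_two)]
  rw [lam, Complex.ofReal_sum, neg_mul, Finset.sum_mul, ← Finset.sum_neg_distrib]
  refine Finset.sum_congr rfl fun i _ => ?_
  rw [← mul_assoc, ← neg_mul]
  congr 1
  push_cast
  linear_combination (freq n i : ℂ) ^ 2 * Complex.I_sq

theorem fc_divergence {g : T3 → Fin 3 → ℝ} (hg : ∀ i, IsCk 1 fun x => g x i) (n : Fin 3 → ℤ) :
    fc (divergence g) n = ∑ i, Complex.I * freq n i * fc (fun x => g x i) n := by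
  unfold divergence
  rw [fc_sum _ fun i _ => continuous_integrable ((hg i).continuous_pd i)]
  simp_rw [fc_pd (hg _)]

theorem continuous_laplacian {g : T3 → ℝ} (hg : IsCk 2 g) : Continuous (laplacian g) :=
  continuous_finsetSum _ fun i _ => (IsCk.pd_nat (m := 1) hg i).continuous_pd i

theorem continuous_divergence {g : T3 → Fin 3 → ℝ} (hg : ∀ i, IsCk 1 fun x => g x i) :
    Continuous (divergence g) :=
  continuous_finsetSum _ fun i _ => (hg i).continuous_pd i

/-! ### Classical solutions -/

theorem lam_le_sz_sq (n : Fin 3 → ℤ) : lam n ≤ sz n ^ 2 := by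
  have h0 := abs_nonneg (freq n 0)
  have h1 := abs_nonneg (freq n 1)
  have h2 := abs_nonneg (freq n 2)
  simp only [lam, sz, Fin.sum_univ_three, ← sq_abs (freq n _)]
  nlinarith [mul_nonneg h0 h1, mul_nonneg h0 h2, mul_nonneg h1 h2]

theorem lam_mul_norm_le {k : ℕ} (hk : 6 ≤ k) {g : T3 → ℝ} {K : ℝ} (hK : 0 ≤ K)
    (h : HB k g (K ^ 2)) (n : Fin 3 → ℤ) : lam n * ‖fc g n‖ ≤ 4 ^ k * K * (sz n ^ 4)⁻¹ :=
  (mul_le_mul_of_nonneg_right (lam_le_sz_sq n) (norm_nonneg _)).trans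
    (sz_pow_mul_norm_le hk hK (h.single n))

theorem freq_mul_norm_le {k : ℕ} (hk : 5 ≤ k) {g : T3 → ℝ} {K : ℝ} (hK : 0 ≤ K)
    (h : HB k g (K ^ 2)) (n : Fin 3 → ℤ) (j : Fin 3) :
    ‖Complex.I * freq n j * fc g n‖ ≤ 4 ^ k * K * (sz n ^ 4)⁻¹ := by
  rw [norm_mul, norm_mul, Complex.norm_I, one_mul, Complex.norm_real, Real.norm_eq_abs]
  refine (mul_le_mul_of_nonneg_right (abs_freq_le_sz n j) (norm_nonneg _)).trans ?_
  simpa using sz_pow_mul_norm_le (j := 1) hk hK (h.single n)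

theorem norm_lam_mul (n : Fin 3 → ℤ) (z : ℂ) : ‖(lam n : ℂ) * z‖ = lam n * ‖z‖ := by
  rw [norm_mul, Complex.norm_real, Real.norm_eq_abs, abs_of_nonneg (lam_nonneg n)]

/-- Differentiation in time of a Fourier series. -/
theorem hasDerivAt_of_fc {T B : ℝ} {w : ℝ → T3 → ℝ} (hw : ∀ t ∈ Ioo 0 T, Continuous (w t))
    (hs : ∀ t ∈ Ioo 0 T, Summable fun n => ‖fc (w t) n‖) {d : (Fin 3 → ℤ) → ℝ → ℂ}
    (hd : ∀ n, ∀ t ∈ Ioo 0 T, HasDerivAt (fun s => fc (w s) n) (d n t) t)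
    (hB : ∀ n, ∀ t ∈ Ioo 0 T, ‖d n t‖ ≤ B * (sz n ^ 4)⁻¹) {t : ℝ} (ht : t ∈ Ioo 0 T)
    {G : T3 → ℝ} (hG : Continuous G) (hGd : ∀ n, fc G n = d n t) (x : T3) :
    HasDerivAt (fun s => w s x) (G x) t := by
  have hu := summable_sz.mul_left B
  have h1 := hasDerivAt_tsum_of_isPreconnected (𝕜 := ℝ) (g := fun n s => mode n (fc (w s) n) x)
    (g' := fun n s => mode n (d n s) x) hu isOpen_Ioo isPreconnected_Ioo
    (fun n s hs => Complex.reCLM.hasFDerivAt.comp_hasDerivAt s ((hd n s hs).mul_const _))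
    (fun n s hs => (abs_mode_le n _ x).trans (hB n s hs)) ht (hasSum_mode (hw t ht) (hs t ht) x).summable
    ht
  have h2 : ∑' n, mode n (d n t) x = G x := by
    simp_rw [← hGd]
    refine (hasSum_mode hG (Summable.of_nonneg_of_le (fun _ => norm_nonneg _) (fun n => ?_) hu)
      x).tsum_eq
    rw [hGd]; exact hB n t ht
  rw [h2] at h1
  refine h1.congr_of_eventuallyEq ?_
  filter_upwards [isOpen_Ioo.mem_nhds ht] with s hs'
  exact (hasSum_mode (hw s hs') (hs s hs') x).tsum_eq.symm

section

variable {k : ℕ} {L : ℝ} {v : Fin 3 → ℝ → T3 → ℝ} {b : ℝ} {Θ : ℝ → ℝ}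

/-- The time derivatives of the Fourier coefficients are dominated by a summable family. -/
theorem exists_norm_deriv_le (hk : 8 ≤ k) (hv : IsVelocity k L v) (hΘ : IsInverse b Θ) {R₂ : ℝ}
    (hR₂ : 0 ≤ R₂) :
    ∃ B, 0 ≤ B ∧ ∀ (w : ℝ → T3 → ℝ) (t : ℝ), Continuous (w t) → HB k (w t) (R₂ ^ 2) →
      ∀ n, ‖-(lam n : ℂ) * fc (w t) n + source v Θ w n t‖ ≤ B * (sz n ^ 4)⁻¹ := by
  obtain ⟨C, hC0, hC⟩ := HB_comp hk hΘ.excess_contDiff hR₂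
  obtain ⟨CV, hCV0, hCV⟩ := HB_velocity hk hv hΘ hR₂
  refine ⟨4 ^ k * R₂ + 4 ^ k * C + ∑ _j : Fin 3, 4 ^ k * CV, by positivity, fun w t hw h n => ?_⟩
  rw [add_mul, add_mul, Finset.sum_mul, source]
  refine (norm_add_le _ _).trans ?_
  rw [add_assoc]
  refine add_le_add ?_ ((norm_sub_le _ _).trans (add_le_add ?_ ((norm_sum_le _ _).trans
    (Finset.sum_le_sum fun j _ => ?_))))
  · rw [neg_mul, norm_neg, norm_lam_mul]
    exact lam_mul_norm_le (by omega) hR₂ h n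
  · rw [norm_lam_mul]
    exact lam_mul_norm_le (by omega) hC0 (hC _ hw h) n
  · exact freq_mul_norm_le (by omega) hCV0 (hCV _ hw h j t) n j

/-- Solutions of the equation in Fourier form are Lipschitz in time, uniformly in space. -/
theorem abs_sub_initial_le {a : (Fin 3 → ℤ) → ℂ} (hv : IsVelocity k L v)
    (hΘ : IsInverse b Θ) {T B : ℝ} {w : ℝ → T3 → ℝ}
    (hw : Continuous fun p : ℝ × T3 => w p.1 p.2)
    (hB : ∀ t ∈ Icc 0 T, ∀ n, ‖-(lam n : ℂ) * fc (w t) n + source v Θ w n t‖ ≤ B * (sz n ^ 4)⁻¹)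
    (hfc : ∀ t ∈ Icc 0 T, ∀ n, fc (w t) n = nextCoef v Θ a w n t) {t : ℝ} (ht : t ∈ Icc 0 T)
    (x : T3) : |w t x - w 0 x| ≤ B * CS * t := by
  have h0 : (0 : ℝ) ∈ Icc 0 T := ⟨le_rfl, ht.1.trans ht.2⟩
  have h1 : ∀ n, ‖fc (fun x => w t x - w 0 x) n‖ ≤ B * t * (sz n ^ 4)⁻¹ := fun n => by
    rw [fc_sub (continuous_integrable (continuous_curry_right hw t))
      (continuous_integrable (continuous_curry_right hw 0)), hfc t ht, hfc 0 h0]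
    have h2 := norm_image_sub_le_of_norm_deriv_le_segment' (f := nextCoef v Θ a w n)
      (a := 0) (b := T) (C := B * (sz n ^ 4)⁻¹)
      (fun s _ => (hasDerivAt_nextCoef hv hΘ hw n s).hasDerivWithinAt)
      (fun s hs => by
        rw [← hfc s (Ico_subset_Icc_self hs)]; exact hB s (Ico_subset_Icc_self hs) n) t ht
    rw [sub_zero] at h2
    exact h2.trans (le_of_eq (by ring))
  have hu := summable_sz.mul_left (B * t)
  have hs : Summable fun n => ‖fc (fun x => w t x - w 0 x) n‖ :=
    Summable.of_nonneg_of_le (fun _ => norm_nonneg _) h1 hu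
  refine (abs_le_tsum_fc (g := fun x => w t x - w 0 x)
    ((continuous_curry_right hw t).sub (continuous_curry_right hw 0)) hs x).trans ?_
  refine (hs.tsum_le_tsum h1 hu).trans (le_of_eq ?_)
  rw [tsum_mul_left, CS]; ring

theorem isCk_comp_smooth {j : ℕ} {Ψ : ℝ → ℝ} (hΨ : ContDiff ℝ ∞ Ψ) {g : T3 → ℝ} (hg : IsCk j g) :
    IsCk j fun x => Ψ (g x) :=
  IsCk.comp (hΨ.of_le (by exact_mod_cast le_top)) hg

theorem isCk_excess_sub {j : ℕ} (hΘ : IsInverse b Θ) {g : T3 → ℝ} (hg : IsCk j g) :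
    IsCk j fun x => g x - excess Θ (g x) :=
  hg.sub (isCk_comp_smooth hΘ.excess_contDiff hg)

theorem isCk_velocity_mul {j : ℕ} (hjk : j ≤ k) (hv : IsVelocity k L v) (hΘ : IsInverse b Θ)
    {g : T3 → ℝ} (hg : IsCk j g) (i : Fin 3) (t : ℝ) : IsCk j fun x => v i t x * Θ (g x) :=
  ((hv.isCk i t).mono (by exact_mod_cast hjk)).mul
    (isCk_comp_smooth hΘ.contDiff hg)

/-- The symbol of the right-hand side of the equation. -/
theorem fc_rhs (hk : 8 ≤ k) (hv : IsVelocity k L v) (hΘ : IsInverse b Θ) {w : ℝ → T3 → ℝ} {t : ℝ}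
    (hg : IsCk 2 (w t)) (n : Fin 3 → ℤ) :
    fc (fun x => laplacian (fun y => w t y - excess Θ (w t y)) x
        - divergence (fun y i => v i t y * Θ (w t y)) x) n
      = -(lam n : ℂ) * fc (w t) n + source v Θ w n t := by
  have h2 : IsCk 2 fun y => w t y - excess Θ (w t y) := isCk_excess_sub (j := 2) hΘ hg
  have h1 : ∀ i, IsCk 1 fun y => v i t y * Θ (w t y) := fun i =>
    isCk_velocity_mul (j := 1) (by omega) hv hΘ (hg.mono one_le_two) i t
  rw [fc_sub (continuous_integrable (continuous_laplacian h2))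
    (continuous_integrable (continuous_divergence (g := fun y i => v i t y * Θ (w t y)) h1)),
    fc_laplacian h2, fc_divergence (g := fun y i => v i t y * Θ (w t y)) h1,
    fc_sub (g := fun y => excess Θ (w t y)) (continuous_integrable hg.continuous)
      (continuous_integrable (hΘ.excess_contDiff.continuous.comp hg.continuous)), source]
  ring

theorem clipVelocity_apply (u : ℝ → T3 → Fin 3 → ℝ) {t : ℝ} (ht : t ∈ Icc (0 : ℝ) 1) (j : Fin 3)
    (x : T3) : clipVelocity u j t x = u t x j := by
  rw [clipVelocity, projIcc_of_mem _ ht]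

/-- A solution of the equation in Fourier form gives a classical solution, as long as it does not
reach the region where the nonlinearity was modified. -/
theorem isSolution_of_fourier (hk : 8 ≤ k) {u : ℝ → T3 → Fin 3 → ℝ}
    (hv : IsVelocity k L (clipVelocity u)) (hΘ : IsInverse b Θ) (hb : 0 < b) {T R₁ R₂ B : ℝ}
    (hT : 0 ≤ T) (hT1 : T ≤ 1) {θ₀ : Sob k} {g₀ : T3 → ℝ} (hg₀ : Continuous g₀)
    (hgθ : g₀ =ᵐ[volume] toL2 θ₀) (hg₀b : ∀ x, b ≤ g₀ x) {w : ℝ → T3 → ℝ}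
    (hw : Continuous fun p : ℝ × T3 => w p.1 p.2) (hwb : TimeBound k T R₁ R₂ w)
    (hB : ∀ t ∈ Icc 0 T, ∀ n,
      ‖-(lam n : ℂ) * fc (w t) n + source (clipVelocity u) Θ w n t‖ ≤ B * (sz n ^ 4)⁻¹)
    (hfc : ∀ t ∈ Icc 0 T, ∀ n, fc (w t) n
      = nextCoef (clipVelocity u) Θ (fc fun x => g₀ x + g₀ x ^ 4) w n t)
    (hpos : ∀ t ∈ Icc 0 T, ∀ x, b / 2 ≤ Θ (w t x))
    (hθC : MemC k T fun t x => Θ (w t x)) (hfC : MemC k T fun t x => w t x - Θ (w t x))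
    (hθL : MemL2 (k + 1) T fun t x => Θ (w t x))
    (hfL : MemL2 (k + 1) T fun t x => w t x - Θ (w t x)) :
    IsSolution k u θ₀ T (fun t x => Θ (w t x)) fun t x => w t x - Θ (w t x) := by
  have hwt := continuous_curry_right hw
  have hCk : ∀ t ∈ Icc 0 T, IsCk 2 (w t) := fun t ht =>
    (hwb.hb ht).isCk (j := 2) (by omega) (hwt t)
  have hinv : ∀ t ∈ Icc 0 T, ∀ x, Θ (w t x) + Θ (w t x) ^ 4 = w t x := fun t ht x =>
    hΘ.right_inv _ (by linarith [hpos t ht x])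
  have h0 : (0 : ℝ) ∈ Icc 0 T := ⟨le_rfl, hT⟩
  have hw0 : w 0 = fun x => g₀ x + g₀ x ^ 4 := eq_of_fc (hwt 0) (by fun_prop) fun n => by
    rw [hfc 0 h0, nextCoef, duhamel_zero]
  have hθ0 : ∀ x, Θ (w 0 x) = g₀ x := fun x => by
    rw [hw0]; exact hΘ.left_inv _ (by linarith [hg₀b x])
  have hderiv : ∀ t ∈ Ioo 0 T, ∀ x, HasDerivAt (fun s => Θ (w s x) + Θ (w s x) ^ 4)
      (laplacian (fun y => w t y - excess Θ (w t y)) x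
        - divergence (fun y i => clipVelocity u i t y * Θ (w t y)) x) t := by
    intro t ht x
    have ht' := Ioo_subset_Icc_self ht
    have hG : Continuous fun x => laplacian (fun y => w t y - excess Θ (w t y)) x
        - divergence (fun y i => clipVelocity u i t y * Θ (w t y)) x :=
      (continuous_laplacian (isCk_excess_sub (j := 2) hΘ (hCk t ht'))).sub
        (continuous_divergence (g := fun y i => clipVelocity u i t y * Θ (w t y)) fun i =>
          isCk_velocity_mul (j := 1) (by omega) hv hΘ ((hCk t ht').mono one_le_two) i t)
    have h1 := hasDerivAt_of_fc (w := w)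
      (d := fun n t => -(lam n : ℂ) * fc (w t) n + source (clipVelocity u) Θ w n t)
      (fun t _ => hwt t)
      (fun t ht => (hwb.hb (Ioo_subset_Icc_self ht)).summable (by omega))
      (fun n t ht => by
        rw [hfc t (Ioo_subset_Icc_self ht)]
        refine (hasDerivAt_nextCoef hv hΘ hw n t).congr_of_eventuallyEq ?_
        filter_upwards [isOpen_Ioo.mem_nhds ht] with s hs
        exact hfc s (Ioo_subset_Icc_self hs) n)
      (fun n t ht => hB t (Ioo_subset_Icc_self ht) n) ht hG
      (fun n => fc_rhs hk hv hΘ (hCk t ht') n) x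
    refine h1.congr_of_eventuallyEq ?_
    filter_upwards [isOpen_Ioo.mem_nhds ht] with s hs
    exact hinv s (Ioo_subset_Icc_self hs) x
  refine ⟨hθC, hθL, hfC, hfL, fun t ht => ?_, fun t ht x => ?_, fun t ht x =>
    (hderiv t ht x).differentiableAt, fun t ht x => ?_, ?_, ?_⟩
  · exact isCk_comp_smooth (j := 2) hΘ.contDiff (hCk t ht)
  · linarith [hinv t ht x]
  · have ht' := Ioo_subset_Icc_self ht
    rw [(hderiv t ht x).deriv]
    have h1 : (fun y => Θ (w t y) + 1 / 3 * Θ (w t y) ^ 4)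
        = fun y => w t y - excess Θ (w t y) := funext fun y => by
      have := hinv t ht' y
      rw [excess]; linarith
    have h2 : (fun (y : T3) (i : Fin 3) => u t y i * Θ (w t y))
        = fun y i => clipVelocity u i t y * Θ (w t y) := funext fun y => funext fun i => by
      rw [clipVelocity_apply u ⟨ht'.1, ht'.2.trans hT1⟩]
    rw [h1, h2]; ring
  · filter_upwards [hgθ] with x hx
    rw [hθ0, hx]
  · filter_upwards [hgθ] with x hx
    have := hinv 0 h0 x
    rw [hθ0] at this ⊢
    rw [← hx]; linarith

end

/-- The continuous representative of an element of a Sobolev space. -/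
theorem exists_continuous_rep {k : ℕ} (hk : 4 ≤ k) (θ₀ : Sob k) :
    ∃ g : T3 → ℝ, Continuous g ∧ g =ᵐ[volume] toL2 θ₀ := by
  have h := HB_toL2 θ₀
  have hs := h.summable hk
  have hc : Continuous fun x => ∑' n, mode n (fc (toL2 θ₀) n) x :=
    continuous_tsum (fun n => (isCk_mode n _).continuous) hs fun n x => abs_mode_le n _ x
  refine ⟨_, hc, ae_eq_of_fc (continuous_memLp hc) (Lp.memLp _) fun n => ?_⟩
  have h1 := tendsto_fc (f := fun N => trunc N (toL2 θ₀)) (g := fun x => ∑' n, mode n (fc (toL2 θ₀) n) x)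
    (fun N => (isCk_trunc N _).continuous) (fun N x => abs_trunc_le hs N x) (fun x => by
      have h2 : Summable fun n => mode n (fc (toL2 θ₀) n) x :=
        Summable.of_norm_bounded hs fun n => abs_mode_le n _ x
      exact h2.hasSum.comp tendsto_box) n
  refine tendsto_nhds_unique h1 (tendsto_const_nhds.congr' ?_)
  obtain ⟨N, hN⟩ := exists_mem_box n
  filter_upwards [eventually_ge_atTop N] with m hm
  rw [fc_trunc, if_pos (box_mono hm hN)]

theorem forall_le_of_ae_le {g : T3 → ℝ} (hg : Continuous g) {b : ℝ}
    (h : ∀ᵐ x, b ≤ g x) (x : T3) : b ≤ g x := by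
  by_contra hx
  have : (volume : Measure T3).IsOpenPosMeasure := by rw [volume_T3]; infer_instance
  have ho : IsOpen {x | g x < b} := isOpen_lt hg continuous_const
  have h1 : volume {x | g x < b} = 0 := by
    rw [ae_iff] at h
    simpa using h
  rw [IsOpen.measure_eq_zero_iff (volume : Measure T3) ho] at h1
  have : x ∈ {x | g x < b} := not_le.1 hx
  rw [h1] at this
  exact this

/-! ### Uniqueness of classical solutions -/

/-- Variation of constants. -/
theorem eq_duhamel {l T : ℝ} {y h : ℝ → ℂ} (hy : Continuous y) (hh : Continuous h)
    (hd : ∀ t ∈ Ioo 0 T, HasDerivAt y (-(l : ℂ) * y t + h t) t) {t : ℝ} (ht : t ∈ Icc 0 T) :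
    y t = duhamel l (y 0) h t := by
  rcases ht.1.eq_or_lt with rfl | ht0
  · rw [duhamel_zero]
  have hT : 0 < T := ht0.trans_le ht.2
  set z : ℝ → ℂ := fun t => Complex.exp ((l : ℂ) * t) * (y t - duhamel l (y 0) h t) with hz
  have hzc : Continuous z := by
    have := continuous_duhamel l (y 0) hh
    fun_prop
  have hzd : ∀ t ∈ Ioo 0 T, HasDerivAt z 0 t := fun t ht => by
    have h1 : HasDerivAt (fun t : ℝ => Complex.exp ((l : ℂ) * t))
        (Complex.exp ((l : ℂ) * t) * ((l : ℂ) * 1)) t :=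
      (Complex.ofRealCLM.hasDerivAt.const_mul (l : ℂ)).cexp
    refine (h1.mul ((hd t ht).sub (hasDerivAt_duhamel l (y 0) hh t))).congr_deriv ?_
    simp only [Pi.sub_apply]
    ring
  obtain ⟨c, hc⟩ := isOpen_Ioo.exists_is_const_of_deriv_eq_zero isPreconnected_Ioo
    (fun t ht => (hzd t ht).differentiableAt.differentiableWithinAt)
    (fun t ht => (hzd t ht).deriv)
  have h2 : EqOn z (fun _ => c) (closure (Ioo 0 T)) :=
    EqOn.closure (fun t ht => hc t ht) hzc continuous_const
  rw [closure_Ioo hT.ne] at h2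
  have h3 := (h2 ht).trans (h2 ⟨le_rfl, hT.le⟩).symm
  simp only [hz, duhamel_zero, sub_self, mul_zero] at h3
  exact sub_eq_zero.1 ((mul_eq_zero.1 h3).resolve_left (Complex.exp_ne_zero _))

theorem toL2_sub {k : ℕ} (U V : Sob k) : toL2 (U - V) =ᵐ[volume] fun x => toL2 U x - toL2 V x :=
  Lp.coeFn_sub _ _

theorem HB_of_represents {k : ℕ} {U : Sob k} {g : T3 → ℝ} (h : Represents U g) :
    HB k g ((2 * ‖U‖) ^ 2) := by
  intro s
  have h1 := HB_toL2 U s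
  simp_rw [fc_congr_ae h] at h1
  linarith

/-- A function in `C([0, T]; H^k)` whose values are continuous in space is continuous in space
and time. -/
theorem exists_continuous_extension {k : ℕ} (hk : 4 ≤ k) {T : ℝ} (hT : 0 ≤ T) {θ : ℝ → T3 → ℝ}
    (h : MemC k T θ) (hc : ∀ t ∈ Icc 0 T, Continuous (θ t)) :
    ∃ q : ℝ → T3 → ℝ, (Continuous fun p : ℝ × T3 => q p.1 p.2) ∧ (∀ t ∈ Icc 0 T, q t = θ t) ∧
      ∃ K, 0 ≤ K ∧ ∀ t, Continuous (q t) ∧ HB k (q t) (K ^ 2) := by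
  obtain ⟨U, hU, hr⟩ := h
  set p : ℝ → ℝ := fun t => projIcc 0 T hT t with hp
  have hpc : Continuous p := continuous_subtype_val.comp continuous_projIcc
  have hpm : ∀ t, p t ∈ Icc 0 T := fun t => (projIcc 0 T hT t).2
  have hpe : ∀ t ∈ Icc 0 T, p t = t := fun t ht => by
    show ((projIcc 0 T hT t : Icc 0 T) : ℝ) = t
    rw [projIcc_of_mem hT ht]
  have hUp : Continuous fun t => U (p t) := hU.comp_continuous hpc hpm
  let F : ℝ → C(T3, ℝ) := fun t => ⟨θ (p t), hc _ (hpm t)⟩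
  have hsub : ∀ s t, HB k (fun x => θ (p s) x - θ (p t) x) ((2 * ‖U (p s) - U (p t)‖) ^ 2) := by
    intro s t
    refine HB_of_represents ?_
    filter_upwards [toL2_sub (U (p s)) (U (p t)), hr _ (hpm s), hr _ (hpm t)] with x h1 h2 h3
    rw [h1, h2, h3]
  have hF : Continuous F := by
    rw [continuous_iff_continuousAt]
    intro t
    rw [ContinuousAt, tendsto_iff_dist_tendsto_zero]
    have h1 : Tendsto (fun s => 4 ^ k * (2 * ‖U (p s) - U (p t)‖) * CS) (𝓝 t)
        (𝓝 (4 ^ k * (2 * ‖U (p t) - U (p t)‖) * CS)) := by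
      exact Continuous.tendsto ((continuous_const.mul (continuous_const.mul
        (hUp.sub continuous_const).norm)).mul continuous_const) t
    rw [sub_self, norm_zero, mul_zero, mul_zero, zero_mul] at h1
    refine squeeze_zero (fun _ => dist_nonneg) (fun s => ?_) h1
    have := CS_nonneg
    refine (ContinuousMap.dist_le (by positivity)).2 fun x => ?_
    rw [Real.dist_eq]
    exact (hsub s t).abs_le hk ((hc _ (hpm s)).sub (hc _ (hpm t))) (by positivity) x
  obtain ⟨K, hK⟩ := (isCompact_Icc (a := (0 : ℝ)) (b := T)).exists_bound_of_continuousOn hU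
  refine ⟨fun t x => F t x, (hF.comp continuous_fst).eval continuous_snd, fun t ht => ?_, 2 * K,
    ?_, fun t => ⟨(F t).continuous, ?_⟩⟩
  · show θ (p t) = θ t
    rw [hpe t ht]
  · have := (norm_nonneg _).trans (hK 0 ⟨le_rfl, hT⟩)
    positivity
  · refine (HB_of_represents (hr _ (hpm t))).mono ?_
    have := hK _ (hpm t)
    gcongr

/-- Differentiation of the Fourier coefficients of a function that is differentiable in time. -/
theorem hasDerivAt_fc {T C : ℝ} {q G : ℝ → T3 → ℝ}
    (hq : Continuous fun p : ℝ × T3 => q p.1 p.2) (hG : ∀ t ∈ Ioo 0 T, Continuous (G t))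
    (hd : ∀ t ∈ Ioo 0 T, ∀ x, HasDerivAt (fun s => q s x) (G t x) t)
    (hC : ∀ t ∈ Ioo 0 T, ∀ x, |G t x| ≤ C) {t : ℝ} (ht : t ∈ Ioo 0 T) (n : Fin 3 → ℤ) :
    HasDerivAt (fun s => fc (q s) n) (fc (G t) n) t := by
  have h := hasDerivAt_integral_of_dominated_loc_of_deriv_le (μ := (volume : Measure T3)) (𝕜 := ℝ)
    (F := fun s x => mFourier (-n) x * ((q s x : ℝ) : ℂ))
    (F' := fun s x => mFourier (-n) x * ((G s x : ℝ) : ℂ)) (x₀ := t) (bound := fun _ => C)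
    (isOpen_Ioo.mem_nhds ht)
    (Eventually.of_forall fun s => (integrable_mFourier_mul
      (continuous_integrable (continuous_curry_right hq s)) (-n)).aestronglyMeasurable)
    (integrable_mFourier_mul (continuous_integrable (continuous_curry_right hq t)) (-n))
    (integrable_mFourier_mul (continuous_integrable (hG t ht)) (-n)).aestronglyMeasurable
    (Eventually.of_forall fun x s hs => by
      rw [norm_mul, norm_mFourier_apply, one_mul, Complex.norm_real]; exact hC s hs x)
    (integrable_const C)
    (Eventually.of_forall fun x s hs => ((hd s hs x).ofReal_comp).const_mul _)
  exact h.2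

section

variable {k : ℕ} {L : ℝ} {b : ℝ} {Θ : ℝ → ℝ}

/-- The right-hand side of the equation is bounded along a solution. -/
theorem exists_rhs_bound (hk : 8 ≤ k) {v : Fin 3 → ℝ → T3 → ℝ} (hv : IsVelocity k L v) {K : ℝ}
    (hK : 0 ≤ K) :
    ∃ C, ∀ (t : ℝ) (g : T3 → ℝ), Continuous g → HB k g (K ^ 2) → ∀ x,
      |laplacian (fun y => g y + 1 / 3 * g y ^ 4) x - divergence (fun y i => v i t y * g y) x| ≤ C := by
  have hΨ : ContDiff ℝ ∞ fun y : ℝ => y + 1 / 3 * y ^ 4 := by fun_prop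
  have hCS := CS_nonneg
  have hL := hv.nonneg
  obtain ⟨C₁, hC₁0, hC₁⟩ := HB_comp hk hΨ hK
  set C₂ := 2 * (2 ^ k * L * ((1 + 4 ^ k * CS) * K))
  refine ⟨4 ^ k * C₁ * CS + ∑ _j : Fin 3, 4 ^ k * C₂ * CS, fun t g hg h => ?_⟩
  have hg2 : IsCk 2 g := h.isCk (j := 2) (by omega) hg
  have h1 : IsCk 2 fun y => g y + 1 / 3 * g y ^ 4 := isCk_comp_smooth (j := 2) hΨ hg2
  have h2 : ∀ i, IsCk 1 fun y => v i t y * g y := fun i =>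
    ((hv.isCk i t).mono (by exact_mod_cast (show 1 ≤ k by omega))).mul (hg2.mono one_le_two)
  have h3 : ∀ i, HB k (fun y => v i t y * g y) (C₂ ^ 2) := fun i =>
    HB_mul hk hL hK (hv.isCk i t) (fun j => hv.ctl j i t) hg h
  have hC₂ : 0 ≤ C₂ := by positivity
  have hG : Continuous fun x => laplacian (fun y => g y + 1 / 3 * g y ^ 4) x
      - divergence (fun y i => v i t y * g y) x := (continuous_laplacian h1).sub
    (continuous_divergence (g := fun y i => v i t y * g y) h2)
  have hb : ∀ n, ‖fc (fun x => laplacian (fun y => g y + 1 / 3 * g y ^ 4) x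
      - divergence (fun y i => v i t y * g y) x) n‖
      ≤ (4 ^ k * C₁ + ∑ _j : Fin 3, 4 ^ k * C₂) * (sz n ^ 4)⁻¹ := fun n => by
    rw [fc_sub (continuous_integrable (continuous_laplacian h1)) (continuous_integrable
      (continuous_divergence (g := fun y i => v i t y * g y) h2)), fc_laplacian h1,
      fc_divergence (g := fun y i => v i t y * g y) h2, add_mul, Finset.sum_mul]
    refine (norm_sub_le _ _).trans (add_le_add ?_ ((norm_sum_le _ _).trans
      (Finset.sum_le_sum fun j _ => ?_)))
    · rw [neg_mul, norm_neg, norm_lam_mul]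
      exact lam_mul_norm_le (by omega) hC₁0 (hC₁ _ hg h) n
    · exact freq_mul_norm_le (by omega) hC₂ (h3 j) n j
  have hu := summable_sz.mul_left (4 ^ k * C₁ + ∑ _j : Fin 3, 4 ^ k * C₂)
  have hs := Summable.of_nonneg_of_le (fun _ => norm_nonneg _) hb hu
  intro x
  refine (abs_le_tsum_fc hG hs x).trans ((hs.tsum_le_tsum hb hu).trans (le_of_eq ?_))
  rw [tsum_mul_left, CS, add_mul, Finset.sum_mul]

/-- As long as a solution stays in the region where the nonlinearity was not modified, it solves
the equation in Fourier form. -/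
theorem fc_eq_nextCoef_of_isSolution (hk : 8 ≤ k) {u : ℝ → T3 → Fin 3 → ℝ}
    (hv : IsVelocity k L (clipVelocity u)) (hΘ : IsInverse b Θ) {T : ℝ} (hT1 : T ≤ 1)
    {θ₀ : Sob k} {g₀ : T3 → ℝ} (hgθ : g₀ =ᵐ[volume] toL2 θ₀)
    {θ f : ℝ → T3 → ℝ} (hs : IsSolution k u θ₀ T θ f) {q : ℝ → T3 → ℝ}
    (hq : Continuous fun p : ℝ × T3 => q p.1 p.2) (hqθ : ∀ t ∈ Icc 0 T, q t = θ t) {K : ℝ}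
    (hK : 0 ≤ K) (hqK : ∀ t, Continuous (q t) ∧ HB k (q t) (K ^ 2)) {τ : ℝ} (hτ : τ ∈ Icc 0 T)
    (hb : ∀ t ∈ Icc 0 τ, ∀ x, b / 4 ≤ q t x) {t : ℝ} (ht : t ∈ Icc 0 τ) (n : Fin 3 → ℤ) :
    fc (fun x => q t x + q t x ^ 4) n = nextCoef (clipVelocity u) Θ
      (fc fun x => g₀ x + g₀ x ^ 4) (fun t x => q t x + q t x ^ 4) n t := by
  set v := clipVelocity u
  have hw : Continuous fun p : ℝ × T3 => q p.1 p.2 + q p.1 p.2 ^ 4 := by fun_prop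
  obtain ⟨C, hC⟩ := exists_rhs_bound hk hv hK
  have hΨ : ContDiff ℝ ∞ fun y : ℝ => y + 1 / 3 * y ^ 4 := by fun_prop
  have hq2 : ∀ t, IsCk 2 (q t) := fun t => (hqK t).2.isCk (j := 2) (by omega) (hqK t).1
  have h1 : ∀ t, IsCk 2 fun y => q t y + 1 / 3 * q t y ^ 4 := fun t =>
    isCk_comp_smooth (j := 2) hΨ (hq2 t)
  have h2 : ∀ t i, IsCk 1 fun y => v i t y * q t y := fun t i =>
    ((hv.isCk i t).mono (by exact_mod_cast (show 1 ≤ k by omega))).mul ((hq2 t).mono one_le_two)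
  have hG : ∀ t, Continuous fun x => laplacian (fun y => q t y + 1 / 3 * q t y ^ 4) x
      - divergence (fun y i => v i t y * q t y) x := fun t => (continuous_laplacian (h1 t)).sub
    (continuous_divergence (g := fun y i => v i t y * q t y) (h2 t))
  have hd : ∀ t ∈ Ioo 0 T, ∀ x, HasDerivAt (fun s => q s x + q s x ^ 4)
      (laplacian (fun y => q t y + 1 / 3 * q t y ^ 4) x
        - divergence (fun y i => v i t y * q t y) x) t := by
    intro t ht x
    have ht' := Ioo_subset_Icc_self ht
    have h3 := (hs.differentiableAt_time t ht x).hasDerivAt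
    have h4 := hs.equation t ht x
    have h5 : (fun (y : T3) (i : Fin 3) => u t y i * θ t y) = fun y i => v i t y * q t y :=
      funext fun y => funext fun i => by
        rw [show v i t y = u t y i from clipVelocity_apply u ⟨ht'.1, ht'.2.trans hT1⟩ i y,
          hqθ t ht']
    rw [h5, ← hqθ t ht'] at h4
    have h6 : deriv (fun s => θ s x + θ s x ^ 4) t
        = laplacian (fun y => q t y + 1 / 3 * q t y ^ 4) x
        - divergence (fun y i => v i t y * q t y) x := by linarith
    rw [h6] at h3
    refine h3.congr_of_eventuallyEq ?_
    filter_upwards [isOpen_Ioo.mem_nhds ht] with s hs'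
    rw [hqθ s (Ioo_subset_Icc_self hs')]
  have hΘq : ∀ t ∈ Icc 0 τ, ∀ x, Θ (q t x + q t x ^ 4) = q t x := fun t ht x =>
    hΘ.left_inv _ (hb t ht x)
  have hsub : Ioo 0 τ ⊆ Ioo 0 T := Ioo_subset_Ioo_right hτ.2
  have hfd : ∀ t ∈ Ioo 0 τ, HasDerivAt (fun s => fc (fun x => q s x + q s x ^ 4) n)
      (-(lam n : ℂ) * fc (fun x => q t x + q t x ^ 4) n
        + source v Θ (fun t x => q t x + q t x ^ 4) n t) t := by
    intro t ht
    have ht' := Ioo_subset_Icc_self ht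
    refine (hasDerivAt_fc (q := fun t x => q t x + q t x ^ 4) hw (fun t _ => hG t) hd
      (fun t _ x => hC t (q t) (hqK t).1 (hqK t).2 x) (hsub ht) n).congr_deriv ?_
    rw [← fc_rhs (w := fun t x => q t x + q t x ^ 4) hk hv hΘ
      (isCk_comp_smooth (j := 2) (Ψ := fun y => y + y ^ 4) (by fun_prop) (hq2 t)) n]
    have e1 : (fun y => q t y + q t y ^ 4 - excess Θ (q t y + q t y ^ 4))
        = fun y => q t y + 1 / 3 * q t y ^ 4 := funext fun y => by
      rw [excess, hΘq t ht']; ring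
    have e2 : (fun (y : T3) (i : Fin 3) => v i t y * Θ (q t y + q t y ^ 4))
        = fun y i => v i t y * q t y := funext fun y => funext fun i => by rw [hΘq t ht']
    rw [e1, e2]
  have h0 : fc (fun x => q 0 x + q 0 x ^ 4) n = fc (fun x => g₀ x + g₀ x ^ 4) n := by
    refine fc_congr_ae ?_ n
    rw [hqθ 0 ⟨le_rfl, hτ.1.trans hτ.2⟩]
    filter_upwards [hs.initial_θ, hgθ] with x hx hx'
    rw [hx, hx']
  have h3 := eq_duhamel (continuous_fc (g := fun t x => q t x + q t x ^ 4) hw n)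
    (continuous_source hv hΘ hw n) hfd ht
  rw [h0] at h3
  exact h3

/-- Any solution agrees with a solution of the equation in Fourier form that stays above `b / 2`:
the first time at which the former reaches `b / 3` would contradict uniqueness up to that time. -/
theorem eq_of_isSolution (hk : 8 ≤ k) {u : ℝ → T3 → Fin 3 → ℝ}
    (hv : IsVelocity k L (clipVelocity u)) (hΘ : IsInverse b Θ) (hb : 0 < b) {T : ℝ} (hT : 0 ≤ T)
    (hT1 : T ≤ 1) {θ₀ : Sob k} {g₀ : T3 → ℝ}
    (hgθ : g₀ =ᵐ[volume] toL2 θ₀) (hg₀b : ∀ x, b ≤ g₀ x) {w : ℝ → T3 → ℝ}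
    (hw : Continuous fun p : ℝ × T3 => w p.1 p.2)
    (hfc : ∀ t ∈ Icc 0 T, ∀ n, fc (w t) n
      = nextCoef (clipVelocity u) Θ (fc fun x => g₀ x + g₀ x ^ 4) w n t)
    (hpos : ∀ t ∈ Icc 0 T, ∀ x, b / 2 ≤ Θ (w t x))
    {θ f : ℝ → T3 → ℝ} (hs : IsSolution k u θ₀ T θ f) {t : ℝ} (ht : t ∈ Icc 0 T) (x : T3) :
    θ t x = Θ (w t x) := by
  obtain ⟨q, hq, hqθ, K, hK, hqK⟩ := exists_continuous_extension (by omega) hT hs.memC_θ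
    fun t ht => (hs.isC2_θ t ht).continuous
  have hqt := continuous_curry_right hq
  have key : ∀ τ ∈ Icc 0 T, (∀ t ∈ Icc 0 τ, ∀ x, b / 4 ≤ q t x) → ∀ t ∈ Icc 0 τ, ∀ x,
      q t x = Θ (w t x) := by
    intro τ hτ hbq t ht x
    have hw' : Continuous fun p : ℝ × T3 => q p.1 p.2 + q p.1 p.2 ^ 4 := by fun_prop
    have h1 := eq_of_nextCoef (w := fun t x => q t x + q t x ^ 4) (w' := w) (by omega) hv hΘ hw' hw
      (fun t ht n => fc_eq_nextCoef_of_isSolution hk hv hΘ hT1 hgθ hs hq hqθ hK hqK hτ hbq ht n)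
      (fun t ht n => hfc t ⟨ht.1, ht.2.trans hτ.2⟩ n) ht
    rw [← h1]
    exact (hΘ.left_inv _ (hbq t ht x)).symm
  have hq0 : ∀ x, b ≤ q 0 x := by
    refine forall_le_of_ae_le (hqt 0) ?_
    rw [hqθ 0 ⟨le_rfl, hT⟩]
    filter_upwards [hs.initial_θ, hgθ] with x hx hx'
    rw [hx, ← hx']; exact hg₀b x
  have hall : ∀ t ∈ Icc 0 T, ∀ x, b / 3 < q t x := by
    by_contra hcon
    push Not at hcon
    obtain ⟨t₁, ht₁, x₁, hx₁⟩ := hcon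
    set Z : Set (ℝ × T3) := (Icc 0 T ×ˢ univ) ∩ {p | q p.1 p.2 ≤ b / 3}
    have hZ : IsCompact Z := (isCompact_Icc.prod isCompact_univ).inter_right
      (isClosed_le hq continuous_const)
    obtain ⟨⟨τ, y⟩, hτ, hmin⟩ := hZ.exists_isMinOn ⟨(t₁, x₁), ⟨ht₁, mem_univ _⟩, hx₁⟩
      continuous_fst.continuousOn
    have hτT : τ ∈ Icc 0 T := hτ.1.1
    have hqτ : q τ y ≤ b / 3 := hτ.2
    have hbefore : ∀ t ∈ Icc 0 T, t < τ → ∀ x, b / 4 ≤ q t x := by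
      intro t ht htτ x
      by_contra hx
      have : τ ≤ t := hmin (show (t, x) ∈ Z from ⟨⟨ht, mem_univ _⟩, show q t x ≤ b / 3 by
        linarith⟩)
      linarith
    have hτ0 : 0 < τ := by
      rcases hτT.1.eq_or_lt with h | h
      · have := hq0 y; rw [h] at this; linarith
      · exact h
    have hlim : Tendsto (fun t => q t y) (𝓝[<] τ) (𝓝 (q τ y)) :=
      ((hq.comp (Continuous.prodMk_left y)).tendsto τ).mono_left nhdsWithin_le_nhds
    have hge : b / 2 ≤ q τ y := by
      refine ge_of_tendsto hlim ?_
      filter_upwards [Ioo_mem_nhdsLT hτ0] with t ht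
      have htT : t ∈ Icc 0 T := ⟨ht.1.le, ht.2.le.trans hτT.2⟩
      rw [key t htT (fun s hs x => hbefore s ⟨hs.1, hs.2.trans htT.2⟩ (hs.2.trans_lt ht.2) x) t
        ⟨ht.1.le, le_rfl⟩ y]
      exact hpos t htT y
    linarith
  rw [← hqθ t ht]
  exact key T ⟨hT, le_rfl⟩ (fun t ht x => by linarith [hall t ht x]) t ht x

end

/-! ### Existence, uniqueness and bounds -/

section

variable {k : ℕ} {b : ℝ} {Θ : ℝ → ℝ}

/-- Both `Θ(w)` and `w - Θ(w)` are linear combinations of `w` and the excess of `w`, so that they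
inherit the bound on the derivatives of order `k + 1`. -/
theorem par_inverse {T R₁ R₂ : ℝ} (hT : 0 ≤ T) (hΘ : IsInverse b Θ) {w : ℝ → T3 → ℝ}
    (hw : Continuous fun p : ℝ × T3 => w p.1 p.2) (hwb : TimeBound k T R₁ R₂ w)
    (hP : ∀ (i : Fin 3) (s : Finset (Fin 3 → ℤ)), ∑ n ∈ s, freq n i ^ (2 * (k + 1))
      * (∫ t in (0)..T, ‖fc (fun x => excess Θ (w t x)) n‖ ^ 2) ≤ R₁ + 1)
    (i : Fin 3) (s : Finset (Fin 3 → ℤ)) :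
    ∑ n ∈ s, freq n i ^ (2 * (k + 1)) * (∫ t in (0)..T, ‖fc (fun x => Θ (w t x)) n‖ ^ 2)
        ≤ 2 * 1 ^ 2 * R₁ + 2 * (-(3 / 2)) ^ 2 * (R₁ + 1) ∧
      ∑ n ∈ s, freq n i ^ (2 * (k + 1)) * (∫ t in (0)..T, ‖fc (fun x => w t x - Θ (w t x)) n‖ ^ 2)
        ≤ 2 * 0 ^ 2 * R₁ + 2 * (3 / 2) ^ 2 * (R₁ + 1) := by
  have hPc : Continuous fun p : ℝ × T3 => excess Θ (w p.1 p.2) :=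
    hΘ.excess_contDiff.continuous.comp hw
  have h1 : ∀ t x, Θ (w t x) = 1 * w t x + -(3 / 2) * excess Θ (w t x) := fun t x => by
    rw [excess]; ring
  have h2 : ∀ t x, w t x - Θ (w t x) = 0 * w t x + 3 / 2 * excess Θ (w t x) := fun t x => by
    rw [excess]; ring
  constructor
  · simp_rw [fun t => funext (h1 t)]
    exact par_add (h := fun t x => excess Θ (w t x)) hT hw hPc (hwb.par i s) (hP i s)
  · simp_rw [fun t => funext (h2 t)]
    exact par_add (h := fun t x => excess Θ (w t x)) hT hw hPc (hwb.par i s) (hP i s)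

end

end EquilibriumLimit

theorem theorem3p2 (N : ℕ) (hN : 9 ≤ N)
    (u : ℝ → EquilibriumLimit.T3 → Fin 3 → ℝ)
    (hu : EquilibriumLimit.IsCkVelocity (N + 2) u)
    (b : ℝ) (hb : 0 < b) (M : ℝ) :
    ∃ T > 0, ∃ C : ℝ, ∀ θ₀ : EquilibriumLimit.Sob (N + 2),
      (∀ᵐ x, b ≤ EquilibriumLimit.toL2 θ₀ x) → ‖θ₀‖ ≤ M →
      ∃ θ f : ℝ → EquilibriumLimit.T3 → ℝ,
        EquilibriumLimit.IsSolution (N + 2) u θ₀ T θ f ∧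
        (∀ θ' f' : ℝ → EquilibriumLimit.T3 → ℝ,
          EquilibriumLimit.IsSolution (N + 2) u θ₀ T θ' f' →
          ∀ t ∈ Set.Icc 0 T, ∀ x, θ' t x = θ t x ∧ f' t x = f t x) ∧
        EquilibriumLimit.timeNorm ⊤ (N + 2) T θ + EquilibriumLimit.timeNorm ⊤ (N + 2) T f
          + EquilibriumLimit.timeNorm 2 (N + 3) T θ + EquilibriumLimit.timeNorm 2 (N + 3) T f
          ≤ ENNReal.ofReal C ∧
        ∀ t ∈ Set.Icc 0 T, ∀ x, b / 2 ≤ θ t x := by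
  open EquilibriumLimit in
  have hk : 8 ≤ N + 2 := by omega
  obtain ⟨L, hv⟩ := exists_isVelocity hu
  obtain ⟨Θ, hΘ⟩ := exists_isInverse hb
  have hΨ : ContDiff ℝ ∞ fun y : ℝ => y + y ^ 4 := by fun_prop
  have hK : 0 ≤ 2 * |M| := by positivity
  obtain ⟨C₀, hC₀0, hC₀⟩ := HB_comp hk hΨ hK
  obtain ⟨R₁, R₂, T₀, hR₁, hR₂, hT₀, hT₀1, hex⟩ :=
    exists_fourier_solution hk hv hΘ (sq_nonneg C₀)
  obtain ⟨B, hB0, hB⟩ := exists_norm_deriv_le hk hv hΘ hR₂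
  obtain ⟨Cθ, -, hCθ⟩ := exists_memC_comp hk hΘ.contDiff hR₂
  obtain ⟨Cf, -, hCf⟩ := exists_memC_comp hk (contDiff_id.sub hΘ.contDiff) hR₂
  have hCS := CS_nonneg
  -- Up to this time `w` differs from its initial value by at most `b / 2`.
  set T := min T₀ (b / 2 / (B * CS + 1)) with hTdef
  have hT0 : 0 < T := lt_min hT₀ (by positivity)
  have hTT₀ : T ≤ T₀ := min_le_left _ _
  have hT1 : T ≤ 1 := hTT₀.trans hT₀1
  have hBT : B * CS * T ≤ b / 2 := by
    have h1 : T ≤ b / 2 / (B * CS + 1) := min_le_right _ _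
    rw [le_div_iff₀ (by positivity)] at h1
    linarith
  set A₁ := √(cardIdx (N + 2) * Cθ ^ 2)
  set A₂ := √(cardIdx (N + 2) * Cf ^ 2)
  set A₃ := √(cardIdx (N + 2 + 1)
    * (Cθ ^ 2 + 3 * (2 * 1 ^ 2 * R₁ + 2 * (-(3 / 2)) ^ 2 * (R₁ + 1))))
  set A₄ := √(cardIdx (N + 2 + 1)
    * (Cf ^ 2 + 3 * (2 * 0 ^ 2 * R₁ + 2 * (3 / 2) ^ 2 * (R₁ + 1))))
  refine ⟨T, hT0, A₁ + A₂ + A₃ + A₄, fun θ₀ hθ₀ hM => ?_⟩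
  obtain ⟨g₀, hg₀, hgθ⟩ := exists_continuous_rep (by omega) θ₀
  have hg₀b : ∀ x, b ≤ g₀ x := forall_le_of_ae_le hg₀ (by
    filter_upwards [hθ₀, hgθ] with x hx hx'
    rwa [hx'])
  have hg₀H : HB (N + 2) g₀ ((2 * |M|) ^ 2) := (HB_of_represents (U := θ₀) hgθ.symm).mono (by
    have := hM.trans (le_abs_self M)
    gcongr)
  obtain ⟨w, hw, hwb, hwP, hfc⟩ := hex T hT0.le hTT₀ (fc fun x => g₀ x + g₀ x ^ 4) (conj_fc _)
    (hC₀ g₀ hg₀ hg₀H)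
  have hwB : ∀ t ∈ Icc 0 T, ∀ n,
      ‖-(lam n : ℂ) * fc (w t) n + source (clipVelocity u) Θ w n t‖ ≤ B * (sz n ^ 4)⁻¹ :=
    fun t ht n => hB w t (continuous_curry_right hw t) (hwb.hb ht) n
  have hw0 : w 0 = fun x => g₀ x + g₀ x ^ 4 :=
    eq_of_fc (continuous_curry_right hw 0) (by fun_prop) fun n => by
      rw [hfc 0 ⟨le_rfl, hT0.le⟩, nextCoef, duhamel_zero]
  have hpos : ∀ t ∈ Icc 0 T, ∀ x, b / 2 ≤ Θ (w t x) := by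
    intro t ht x
    have h1 := (abs_le.1 (abs_sub_initial_le hv hΘ hw hwB hfc ht x)).1
    have h2 : B * CS * t ≤ B * CS * T := mul_le_mul_of_nonneg_left ht.2 (by positivity)
    have h3 : w 0 x = g₀ x + g₀ x ^ 4 := by rw [hw0]
    have h4 : (b / 2) ^ 4 ≤ g₀ x ^ 4 := by
      have := hg₀b x
      gcongr
      linarith
    have h5 := hΘ.left_inv (b / 2) (by linarith)
    rw [← h5]
    exact hΘ.monotone (by linarith [hg₀b x])
  have hθc : Continuous fun p : ℝ × T3 => Θ (w p.1 p.2) := hΘ.contDiff.continuous.comp hw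
  have hfc' : Continuous fun p : ℝ × T3 => w p.1 p.2 - Θ (w p.1 p.2) := hw.sub hθc
  obtain ⟨hθH, hθC, hθN⟩ := hCθ T R₁ w hw hwb
  obtain ⟨hfH, hfC, hfN⟩ := hCf T R₁ w hw hwb
  obtain ⟨hθL, hθN'⟩ := memL2_of_par (g := fun t x => Θ (w t x)) (by omega) hT0.le hT1 hθc hθH
    fun i s => (par_inverse hT0.le hΘ hw hwb hwP i s).1
  obtain ⟨hfL, hfN'⟩ := memL2_of_par (g := fun t x => w t x - Θ (w t x)) (by omega) hT0.le hT1
    hfc' hfH fun i s => (par_inverse hT0.le hΘ hw hwb hwP i s).2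
  have hsol := isSolution_of_fourier hk hv hΘ hb hT0.le hT1 hg₀ hgθ hg₀b hw hwb hwB hfc hpos
    hθC hfC hθL hfL
  refine ⟨_, _, hsol, fun θ' f' hs t ht x => ?_, ?_, hpos⟩
  · have h1 := eq_of_isSolution hk hv hΘ hb hT0.le hT1 hgθ hg₀b hw hfc hpos hs ht x
    exact ⟨h1, by rw [hs.f_eq t ht, hsol.f_eq t ht, h1]⟩
  · have h := add_le_add (add_le_add (add_le_add hθN hfN) hθN') hfN'
    rwa [← ENNReal.ofReal_add (by positivity) (by positivity),
      ← ENNReal.ofReal_add (by positivity) (by positivity),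
      ← ENNReal.ofReal_add (by positivity) (by positivity)] at h
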